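/- For a sequence $K=(k_2,k_3,\dots)$ of complex numbers define polynomials $\theta_n(z;K)$ by $$\sum_{n\ge 0}\theta_n(z;K)\lambda^n=\exp\Big(z\lambda-\sum_{j\ge 2}\frac{k_j\lambda^{2j-1}}{2j-1}\Big),$$ and let $\Theta_n(z,K)=c_n\,W(\theta_1,\theta_3,\dots,\theta_{2n-1})$ be the Adler-Moser polynomials, where $W$ is the Wronskian and $c_n=\prod_{j=1}^n(2j+1)^{n-j}$ (so $\Theta_n$ is monic of degree $n(n+1)/2$). Put $$A_n(z)=\Theta_n\big(z+\tfrac12,K\big)\ \text{ with } k_j=-\tfrac12 \text{ for all } j,\qquad B_n(z)=(-1)^{n(n+3)/2}A_n(-z),$$ $$\phi_n=\frac{A_{n+1}}{A_n},\qquad \psi_n=\frac{B_n}{A_n}e^{z}.$$ Let $N\ge 1$ and assume (A): $A_N$ and $A_{N-1}$ have no common roots. Let $\xi_N,\eta_N$ be complex polynomials of degree less than $N(N+1)/2$ that satisfy the equation $A_N''B_N-2A_N'B_N'+A_NB_N''=2(A_N'B_N-A_NB_N')$ linearized at $(A_N,B_N)$: $$\xi_N''B_N-2\xi_N'B_N'+\xi_NB_N''-2(\xi_N'B_N-\xi_NB_N')+A_N''\eta_N-2A_N'\eta_N'+A_N\eta_N''-2(A_N'\eta_N-A_N\eta_N')=0.$$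 Set $f_N=(\xi_N/A_N)'$ and $\sigma_N=e^{z}\big(-B_N\xi_N/A_N^2+\eta_N/A_N\big)$. Run the linearized Darboux transformation backwards: for $n=N-1,\dots,0$, $$f_n=-\phi_n^2\int_{-\infty}^z\phi_n^{-2}\big(f_{n+1}'+2(\ln\phi_n)'f_{n+1}\big)\,ds,\qquad \sigma_n=\phi_n\int_{-\infty}^z\phi_n^{-1}\big(\psi_n(f_{n+1}-f_n)-\sigma_{n+1}\big)\,ds,$$ $$\xi_n=A_n\int_{-\infty}^z f_n\,ds,\qquad \eta_n=A_n\sigma_ne^{-z}+\frac{B_n}{A_n}\xi_n ,$$ where the integrals run along the horizontal half-line from $-\infty$ to $z$ and $z$ is in the set $D$ of those points for which $A_0,\dots,A_N$ do not vanish on $z+(-\infty,0]$. Then on $D$ the integrals that define $f_n$ and $\sigma_n$ ($0\le n<N$) converge, $(f_n,\sigma_n)$ solves the linearized Darboux system $$f_n'-2(\ln\phi_n)'f_n+f_{n+1}'+2(\ln\phi_n)'f_{n+1}=0,\qquad \sigma_n'-\sigma_n(\ln\phi_n)'=\psi_n(f_{n+1}-f_n)-\sigma_{n+1},$$ and $f_0=\sigma_0=0$,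 $\xi_0=\eta_0=0$. -/

import Mathlib

noncomputable section

namespace AdlerMoser

open Polynomial

/-- The exponent `z λ - ∑_{j ≥ 2} k_j λ^(2j-1) / (2j-1)`, as a power series in `λ` over `ℂ[z]`. -/
def genExponent (k : ℕ → ℂ) : PowerSeries ℂ[X] :=
  PowerSeries.mk fun m =>
    if m = 1 then X else if Odd m then -C (k ((m + 1) / 2) / (m : ℂ)) else 0

/-- `θ_n(z; K)`: the coefficient of `λ^n` in `exp (z λ - ∑_{j ≥ 2} k_j λ^(2j-1) / (2j-1))`. -/
def theta (k : ℕ → ℂ) (n : ℕ) : ℂ[X] :=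
  PowerSeries.coeff n ((PowerSeries.exp ℂ[X]).subst (genExponent k))

/-- The normalizing constant `c_n = ∏_{j=1}^n (2j+1)^(n-j)`. -/
def normConst (n : ℕ) : ℂ :=
  ∏ j ∈ Finset.Icc 1 n, (2 * (j : ℂ) + 1) ^ (n - j)

/-- The Adler-Moser polynomial `Θ_n(z, K) = c_n W(θ_1, θ_3, …, θ_{2n-1})`. -/
def Theta (k : ℕ → ℂ) (n : ℕ) : ℂ[X] :=
  C (normConst n) *
    Matrix.det (Matrix.of fun i j : Fin n => derivative^[(i : ℕ)] (theta k (2 * (j : ℕ) + 1)))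

/-- `A_n(z) = Θ_n(z + 1/2, K)` with `k_j = -1/2` for all `j` (the case `μ = 1`, `t = -1/2`). -/
def A (n : ℕ) : ℂ[X] :=
  (Theta (fun _ => -1 / 2) n).comp (X + C (1 / 2))

/-- `B_n(z) = ± A_n(-z)`, the sign `(-1)^(n(n+3)/2)` being the one for which
`ψ_n = (B_n / A_n) e^z` satisfies the Darboux relation `ψ_{n+1} = ψ_n (ln φ_n)' - ψ_n'`. -/
def B (n : ℕ) : ℂ[X] :=
  C ((-1) ^ (n * (n + 3) / 2)) * (A n).comp (-X)

/-- `φ_n = A_{n+1} / A_n`. -/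
def phi (n : ℕ) (z : ℂ) : ℂ :=
  (A (n + 1)).eval z / (A n).eval z

/-- `ψ_n = (B_n / A_n) e^z`. -/
def psi (n : ℕ) (z : ℂ) : ℂ :=
  (B n).eval z / (A n).eval z * Complex.exp z

/-- The linearization at `(A_n, B_n)`, in the direction `(ξ, η)`, of the equation
`P'' Q - 2 P' Q' + P Q'' = 2 (P' Q - P Q')`. -/
def LinearizedTkachenko (n : ℕ) (ξ η : ℂ[X]) : Prop :=
  derivative (derivative ξ) * B n - 2 * derivative ξ * derivative (B n)
      + ξ * derivative (derivative (B n))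
      - 2 * (derivative ξ * B n - ξ * derivative (B n))
    + (derivative (derivative (A n)) * η - 2 * derivative (A n) * derivative η
      + A n * derivative (derivative η)
      - 2 * (derivative (A n) * η - A n * derivative η)) = 0

/-- The complex plane without the horizontal half-lines that run to the right from the roots of
`A_0, …, A_N`: the points `z` such that `A_0, …, A_N` do not vanish on `z + (-∞, 0]`. -/
def slitPlane (N : ℕ) : Set ℂ :=
  {z | ∀ n ≤ N, ∀ t : ℝ, t ≤ 0 → (A n).eval (z + (t : ℂ)) ≠ 0}

/-- `∫_{-∞}^z h(s) ds`, along the horizontal half-line that ends at `z`. -/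
def rayIntegral (h : ℂ → ℂ) (z : ℂ) : ℂ :=
  ∫ t in Set.Iic (0 : ℝ), h (z + (t : ℂ))

/-- Convergence of the integral `∫_{-∞}^z h(s) ds`. -/
def RayIntegrable (h : ℂ → ℂ) (z : ℂ) : Prop :=
  MeasureTheory.IntegrableOn (fun t : ℝ => h (z + (t : ℂ))) (Set.Iic (0 : ℝ))

/-- `φ_n^{-2} (f_{n+1}' + 2 (ln φ_n)' f_{n+1})`. -/
def integrandF (n : ℕ) (fnext : ℂ → ℂ) (s : ℂ) : ℂ :=
  (phi n s ^ 2)⁻¹ * (deriv fnext s + 2 * logDeriv (phi n) s * fnext s)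

/-- The solution `f_n = -φ_n² ∫_{-∞}^z φ_n^{-2} (f_{n+1}' + 2 (ln φ_n)' f_{n+1}) ds` of
`f_n' - 2 (ln φ_n)' f_n + f_{n+1}' + 2 (ln φ_n)' f_{n+1} = 0`. -/
def backF (n : ℕ) (fnext : ℂ → ℂ) (z : ℂ) : ℂ :=
  -phi n z ^ 2 * rayIntegral (integrandF n fnext) z

/-- `φ_n^{-1} (ψ_n (f_{n+1} - f_n) - σ_{n+1})`. -/
def integrandSigma (n : ℕ) (fnext f σnext : ℂ → ℂ) (s : ℂ) : ℂ :=
  (phi n s)⁻¹ * (psi n s * (fnext s - f s) - σnext s)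

/-- The solution `σ_n = φ_n ∫_{-∞}^z φ_n^{-1} (ψ_n (f_{n+1} - f_n) - σ_{n+1}) ds` of
`σ_n' - σ_n (ln φ_n)' = ψ_n (f_{n+1} - f_n) - σ_{n+1}`. -/
def backSigma (n : ℕ) (fnext f σnext : ℂ → ℂ) (z : ℂ) : ℂ :=
  phi n z * rayIntegral (integrandSigma n fnext f σnext) z

/-- The pair `(f_{N-j}, σ_{N-j})` obtained from `(ξ_N, η_N)` by `j` backward steps of the
linearized Darboux transformation, starting at `f_N = (ξ_N / A_N)'` and
`σ_N = e^z (-B_N ξ_N / A_N² + η_N / A_N)`. -/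
def backChain (N : ℕ) (ξ η : ℂ[X]) : ℕ → (ℂ → ℂ) × (ℂ → ℂ)
  | 0 =>
    (deriv fun z => ξ.eval z / (A N).eval z,
     fun z => Complex.exp z *
      (-((B N).eval z * ξ.eval z) / (A N).eval z ^ 2 + η.eval z / (A N).eval z))
  | j + 1 =>
    (backF (N - (j + 1)) (backChain N ξ η j).1,
     backSigma (N - (j + 1)) (backChain N ξ η j).1
      (backF (N - (j + 1)) (backChain N ξ η j).1) (backChain N ξ η j).2)

/-- `f_n`, for `n ≤ N`. -/
def fLevel (N : ℕ) (ξ η : ℂ[X]) (n : ℕ) : ℂ → ℂ :=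
  (backChain N ξ η (N - n)).1

/-- `σ_n`, for `n ≤ N`. -/
def sigmaLevel (N : ℕ) (ξ η : ℂ[X]) (n : ℕ) : ℂ → ℂ :=
  (backChain N ξ η (N - n)).2

/-- `ξ_n`, for `n ≤ N`, recovered from `(ξ_n / A_n)' = f_n`: `ξ_n = A_n ∫_{-∞}^z f_n ds`. -/
def xiLevel (N : ℕ) (ξ η : ℂ[X]) (n : ℕ) (z : ℂ) : ℂ :=
  (A n).eval z * rayIntegral (fLevel N ξ η n) z

/-- `η_n = A_n σ_n e^{-z} + (B_n / A_n) ξ_n`, for `n ≤ N`. -/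
def etaLevel (N : ℕ) (ξ η : ℂ[X]) (n : ℕ) (z : ℂ) : ℂ :=
  (A n).eval z * sigmaLevel N ξ η n z * Complex.exp (-z)
    + (B n).eval z / (A n).eval z * xiLevel N ξ η n z

end AdlerMoser

end

noncomputable section

namespace AdlerMoser

open Polynomial
open scoped Differential

/-! The analysis reduces to algebra in the field of rational functions. Up to constants, `φ_n` is
the `n`-th seed of a chain of Darboux transformations that starts from the zero potential and has
potentials `u_n = -2 (log A_n)''`. The chain also carries wave functions `e^{kz} P_n(k)`, with `P_n`
a polynomial in the spectral parameter `k` over the rational functions of `z`. Two values of `k`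
matter. At `k = 1`, a comparison of generating functions gives `P_n(1) = B_n / A_n`
(`one_sub_mul_aSeries`, `waveR_eval_one`). At `k = 0`, `P_{n+1}(0)` is a constant multiple of
`φ_n⁻¹` (`exists_waveR_coeff_zero`).

A backward step stays rational if `φ_n⁻² f_{n+1}'` has a rational primitive, which is a condition on
`f_{n+1}' P_{n+1}(k)² e^{2kz}` at `k = 0`. The property carried down the chain is its version for
formal `k`, called `Exact`: the expression is a `z`-derivative up to `e^{2kz}` times a polynomial.
By `twist_step`, the obstruction at level `n + 1` plus `k²` times the one at level `n` is exact, so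
exactness descends (`exact_step`).

At the top, the linearized equation yields only the case `k = 1` (`exists_antideriv_top`).
Hypothesis (A) makes the roots of `A_N` simple. An infinitesimal change of variable that moves these
roots then turns the variation of the potential into a polynomial expression `G`, and the poles left
in `G P_N²` are governed by `G'`. Their vanishing at `k = 1` is a divisibility by `A_N` that does
not involve `k`, so they vanish for all `k` (`exact_top`).

At the bottom `P_0 = 1`, and an exact expression that is constant in `k` is a polynomial. As `f_0`
decays at infinity, it is zero, and `σ_0` then solves an equation with constant coefficients that
forces it to vanish too (`Admissible.eq_zero`).

The degree at infinity selects the primitive that tends to zero at `-∞`, so the rational chain is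
the one produced by the integrals (`backF_eq`, `backSigma_eq`). -/

/-! ### Calculus of rational functions -/

/-- The numerator of the derivative of `p / q`. -/
def quotNum (p q : ℂ[X]) : ℂ[X] := derivative p * q - p * derivative q

/-- The inclusion of polynomials into rational functions. -/
abbrev toRat : ℂ[X] →+* RatFunc ℂ := algebraMap ℂ[X] (RatFunc ℂ)

theorem toRat_ne_zero {q : ℂ[X]} (hq : q ≠ 0) : toRat q ≠ 0 :=
  RatFunc.algebraMap_ne_zero hq

theorem toRat_injective : Function.Injective toRat := RatFunc.algebraMap_injective ℂ

/-- The derivative of a rational function, through its reduced form. -/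
def ratDerivFun (R : RatFunc ℂ) : RatFunc ℂ :=
  toRat (quotNum R.num R.denom) / toRat R.denom ^ 2

/-- The quotient rule is independent of the representing fraction; this comes from differentiating
the cross-multiplied equality. -/
theorem quotNum_mul_sq {n d p q : ℂ[X]} (h : n * q = p * d) :
    quotNum n d * q ^ 2 = quotNum p q * d ^ 2 := by
  have h1 := congrArg derivative h
  simp only [derivative_mul] at h1
  simp only [quotNum]
  linear_combination (d * q) * h1 - (q * derivative d + derivative q * d) * h

theorem ratDerivFun_eq {R : RatFunc ℂ} {p q : ℂ[X]} (hq : q ≠ 0) (hR : R * toRat q = toRat p) :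
    ratDerivFun R = toRat (quotNum p q) / toRat q ^ 2 := by
  have hd := toRat_ne_zero R.denom_ne_zero
  have h : toRat R.num = R * toRat R.denom :=
    (div_eq_iff hd).1 (RatFunc.num_div_denom R)
  have h0 : R.num * q = p * R.denom := by
    apply toRat_injective
    rw [map_mul, map_mul, h, ← hR, mul_right_comm]
  have h1 := congrArg toRat (quotNum_mul_sq h0)
  rw [map_mul, map_mul, map_pow, map_pow] at h1
  exact (div_eq_div_iff (pow_ne_zero _ hd) (pow_ne_zero _ (toRat_ne_zero hq))).2 h1

theorem ratDerivFun_div (p : ℂ[X]) {q : ℂ[X]} (hq : q ≠ 0) :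
    ratDerivFun (toRat p / toRat q) = toRat (quotNum p q) / toRat q ^ 2 :=
  ratDerivFun_eq hq (div_mul_cancel₀ _ (toRat_ne_zero hq))

theorem exists_rep (R : RatFunc ℂ) : ∃ p q : ℂ[X], q ≠ 0 ∧ R = toRat p / toRat q :=
  ⟨R.num, R.denom, R.denom_ne_zero, (RatFunc.num_div_denom R).symm⟩

theorem ratDerivFun_add (R S : RatFunc ℂ) :
    ratDerivFun (R + S) = ratDerivFun R + ratDerivFun S := by
  obtain ⟨p, q, hq, rfl⟩ := exists_rep R
  obtain ⟨r, s, hs, rfl⟩ := exists_rep S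
  have hq0 := toRat_ne_zero hq
  have hs0 := toRat_ne_zero hs
  rw [div_add_div _ _ hq0 hs0, ← map_mul, ← map_mul, ← map_mul, ← map_add,
    ratDerivFun_div _ (mul_ne_zero hq hs), ratDerivFun_div _ hq, ratDerivFun_div _ hs, map_mul]
  field_simp
  simp only [quotNum, derivative_mul, map_add, map_mul, map_sub]
  ring

theorem ratDerivFun_mul (R S : RatFunc ℂ) :
    ratDerivFun (R * S) = R * ratDerivFun S + S * ratDerivFun R := by
  obtain ⟨p, q, hq, rfl⟩ := exists_rep R
  obtain ⟨r, s, hs, rfl⟩ := exists_rep S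
  have hq0 := toRat_ne_zero hq
  have hs0 := toRat_ne_zero hs
  rw [div_mul_div_comm, ← map_mul, ← map_mul,
    ratDerivFun_div _ (mul_ne_zero hq hs), ratDerivFun_div _ hq, ratDerivFun_div _ hs, map_mul]
  field_simp
  simp only [quotNum, derivative_mul, map_add, map_mul, map_sub]
  ring

/-- A differential ring from an additive map that satisfies the Leibniz rule. -/
abbrev differentialOf {R : Type*} [CommRing R] (f : R → R) (hadd : ∀ a b, f (a + b) = f a + f b)
    (hmul : ∀ a b, f (a * b) = a * f b + b * f a) : Differential R :=
  ⟨Derivation.mk' (AddMonoidHom.mk' f hadd).toIntLinearMap hmul⟩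

/-- The field of rational functions with the derivation `d/dz`. -/
instance : Differential (RatFunc ℂ) := differentialOf ratDerivFun ratDerivFun_add ratDerivFun_mul

theorem deriv_div (p : ℂ[X]) {q : ℂ[X]} (hq : q ≠ 0) :
    (toRat p / toRat q)′ = toRat (quotNum p q) / toRat q ^ 2 :=
  ratDerivFun_div p hq

theorem deriv_toRat (p : ℂ[X]) : (toRat p)′ = toRat (derivative p) := by
  have := deriv_div p one_ne_zero
  simpa [quotNum] using this

theorem deriv_const (c : ℂ) : (toRat (C c))′ = 0 := by
  rw [deriv_toRat, derivative_C, map_zero]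

section Field

variable {K : Type*} [Field K] [Differential K]

theorem leib (a b : K) : (a * b)′ = a * b′ + b * a′ := by
  simp

theorem deriv_inv_mul {a : K} (ha : a ≠ 0) : (a⁻¹)′ * a ^ 2 = -a′ := by
  have h : (a * a⁻¹)′ = 0 := by rw [mul_inv_cancel₀ ha]; simp
  rw [leib] at h
  linear_combination a * h - a′ * mul_inv_cancel₀ ha

theorem deriv_inv' {a : K} (ha : a ≠ 0) : (a⁻¹)′ = -a′ / a ^ 2 := by
  rw [eq_div_iff (pow_ne_zero _ ha), deriv_inv_mul ha]

theorem deriv_quot {a b : K} (hb : b ≠ 0) : (a / b)′ = (a′ * b - a * b′) / b ^ 2 := by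
  rw [div_eq_mul_inv, leib, deriv_inv' hb]
  field_simp
  ring

end Field

/-! ### Degree at infinity -/

/-- The degree of the rational function at infinity is at most `d`. -/
def DegLE (R : RatFunc ℂ) (d : ℤ) : Prop := R = 0 ∨ R.intDegree ≤ d

theorem intDegree_div_toRat {p q : ℂ[X]} (hp : p ≠ 0) (hq : q ≠ 0) :
    (toRat p / toRat q).intDegree = p.natDegree - q.natDegree := by
  rw [RatFunc.intDegree_div (toRat_ne_zero hp) (toRat_ne_zero hq), RatFunc.intDegree_polynomial,
    RatFunc.intDegree_polynomial]

/-- `RatFunc.intDegree 0` is `0`, so zero needs its own case to lie below every bound, negative ones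
included. -/
theorem degLE_zero (d : ℤ) : DegLE 0 d := Or.inl rfl

theorem DegLE.mono {R : RatFunc ℂ} {d e : ℤ} (h : DegLE R d) (hde : d ≤ e) : DegLE R e :=
  h.imp id fun h => h.trans hde

theorem DegLE.neg {R : RatFunc ℂ} {d : ℤ} (h : DegLE R d) : DegLE (-R) d := by
  rcases h with rfl | h
  · simp [degLE_zero]
  · exact Or.inr (by rwa [RatFunc.intDegree_neg])

theorem DegLE.add {R S : RatFunc ℂ} {d : ℤ} (hR : DegLE R d) (hS : DegLE S d) :
    DegLE (R + S) d := by
  by_cases hRS : R + S = 0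
  · exact Or.inl hRS
  rcases hR with rfl | hR
  · simpa using hS
  by_cases hS0 : S = 0
  · subst hS0; exact Or.inr (by simpa using hR)
  rcases hS with rfl | hS
  · exact absurd rfl hS0
  · exact Or.inr ((RatFunc.intDegree_add_le hS0 hRS).trans (max_le hR hS))

theorem DegLE.sub {R S : RatFunc ℂ} {d : ℤ} (hR : DegLE R d) (hS : DegLE S d) :
    DegLE (R - S) d := by
  rw [sub_eq_add_neg]; exact hR.add hS.neg

theorem DegLE.mul {R S : RatFunc ℂ} {d e : ℤ} (hR : DegLE R d) (hS : DegLE S e) :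
    DegLE (R * S) (d + e) := by
  rcases hR with rfl | hR
  · simp [degLE_zero]
  rcases hS with rfl | hS
  · simp [degLE_zero]
  by_cases hR0 : R = 0
  · simp [hR0, degLE_zero]
  by_cases hS0 : S = 0
  · simp [hS0, degLE_zero]
  exact Or.inr (by rw [RatFunc.intDegree_mul hR0 hS0]; omega)

theorem degLE_self (R : RatFunc ℂ) : DegLE R R.intDegree := Or.inr le_rfl

theorem degLE_toRat (p : ℂ[X]) : DegLE (toRat p) p.natDegree :=
  Or.inr (by rw [RatFunc.intDegree_polynomial])

/-- The Euler operator `X * derivative` is diagonal on monomials and never raises the degree.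
Multiplying by `X` avoids truncated subtraction in the degree counts below. -/
theorem coeff_X_mul_derivative (p : ℂ[X]) (n : ℕ) :
    (X * derivative p).coeff n = n * p.coeff n := by
  cases n with
  | zero => simp
  | succ n => rw [coeff_X_mul, coeff_derivative]; push_cast; ring

theorem natDegree_X_mul_derivative_le (p : ℂ[X]) :
    (X * derivative p).natDegree ≤ p.natDegree := by
  rw [natDegree_le_iff_coeff_eq_zero]
  intro n hn
  rw [coeff_X_mul_derivative, coeff_eq_zero_of_natDegree_lt hn, mul_zero]

theorem X_mul_quotNum (p q : ℂ[X]) :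
    X * quotNum p q = (X * derivative p) * q - p * (X * derivative q) := by
  simp only [quotNum]; ring

theorem natDegree_X_mul_quotNum_le (p q : ℂ[X]) :
    (X * quotNum p q).natDegree ≤ p.natDegree + q.natDegree := by
  rw [X_mul_quotNum]
  refine (natDegree_sub_le _ _).trans (max_le ?_ ?_)
  · exact natDegree_mul_le_of_le (natDegree_X_mul_derivative_le p) le_rfl
  · exact natDegree_mul_le_of_le le_rfl (natDegree_X_mul_derivative_le q)

theorem DegLE.deriv {R : RatFunc ℂ} {d : ℤ} (hR : DegLE R d) : DegLE R′ (d - 1) := by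
  rcases hR with rfl | hR
  · simp [degLE_zero]
  obtain ⟨p, q, hq, rfl⟩ := exists_rep R
  by_cases hp : p = 0
  · simp [hp, degLE_zero]
  rw [intDegree_div_toRat hp hq] at hR
  rw [deriv_div p hq, ← map_pow]
  by_cases hn : quotNum p q = 0
  · simp [hn, degLE_zero]
  refine Or.inr ?_
  rw [intDegree_div_toRat hn (pow_ne_zero _ hq), natDegree_pow]
  have := natDegree_X_mul_quotNum_le p q
  rw [natDegree_X_mul hn] at this
  push_cast
  omega

/-- The top coefficient of `X * quotNum p q` is `deg p - deg q` times the product of the leading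
coefficients, so only degree zero can drop by more than one. -/
theorem intDegree_deriv {R : RatFunc ℂ} (hR : R ≠ 0) (hd : R.intDegree ≠ 0) :
    R′ ≠ 0 ∧ (R′).intDegree = R.intDegree - 1 := by
  obtain ⟨p, q, hq, rfl⟩ := exists_rep R
  have hp : p ≠ 0 := by rintro rfl; simp at hR
  rw [intDegree_div_toRat hp hq] at hd ⊢
  have hc : (X * quotNum p q).coeff (p.natDegree + q.natDegree) ≠ 0 := by
    rw [X_mul_quotNum, coeff_sub,
      coeff_mul_add_eq_of_natDegree_le (natDegree_X_mul_derivative_le p) le_rfl,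
      coeff_mul_add_eq_of_natDegree_le le_rfl (natDegree_X_mul_derivative_le q),
      coeff_X_mul_derivative, coeff_X_mul_derivative]
    have : ((p.natDegree : ℂ) - q.natDegree) * (p.leadingCoeff * q.leadingCoeff) ≠ 0 := by
      refine mul_ne_zero ?_ (mul_ne_zero (leadingCoeff_ne_zero.2 hp) (leadingCoeff_ne_zero.2 hq))
      exact_mod_cast hd
    convert this using 1
    simp only [leadingCoeff]; ring
  have hn : quotNum p q ≠ 0 := by rintro h; simp [h] at hc
  have hdeg : (X * quotNum p q).natDegree = p.natDegree + q.natDegree :=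
    le_antisymm (natDegree_X_mul_quotNum_le p q) (le_natDegree_of_ne_zero hc)
  rw [natDegree_X_mul hn] at hdeg
  rw [deriv_div p hq, ← map_pow]
  refine ⟨div_ne_zero (toRat_ne_zero hn) (toRat_ne_zero (pow_ne_zero _ hq)), ?_⟩
  rw [intDegree_div_toRat hn (pow_ne_zero _ hq), natDegree_pow]
  push_cast
  omega

theorem exists_const_sub {R : RatFunc ℂ} (hR : DegLE R 0) :
    ∃ c : ℂ, DegLE (R - toRat (C c)) (-1) := by
  rcases hR with rfl | hR
  · exact ⟨0, by simp [degLE_zero]⟩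
  rcases hR.lt_or_eq with hR | hR
  · refine ⟨0, ?_⟩
    rw [map_zero, map_zero, sub_zero]
    exact Or.inr (by omega)
  obtain ⟨p, q, hq, rfl⟩ := exists_rep R
  by_cases hp : p = 0
  · exact ⟨0, by simp [hp, degLE_zero]⟩
  rw [intDegree_div_toRat hp hq] at hR
  have hlq := leadingCoeff_ne_zero.2 hq
  have hlp := leadingCoeff_ne_zero.2 hp
  have hc : p.leadingCoeff / q.leadingCoeff ≠ 0 := div_ne_zero hlp hlq
  refine ⟨p.leadingCoeff / q.leadingCoeff, ?_⟩
  rw [div_sub' (toRat_ne_zero hq), ← map_mul, ← map_sub]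
  by_cases hn : p - q * C (p.leadingCoeff / q.leadingCoeff) = 0
  · simp [hn, degLE_zero]
  refine Or.inr ?_
  rw [intDegree_div_toRat hn hq]
  have hdeg : p.degree = (q * C (p.leadingCoeff / q.leadingCoeff)).degree := by
    rw [degree_mul_C hc, degree_eq_natDegree hp, degree_eq_natDegree hq]
    congr 1; omega
  have := degree_sub_lt_left hdeg hp (by
    rw [leadingCoeff_mul, leadingCoeff_C]; field_simp)
  have := natDegree_lt_natDegree hn this
  omega

/-- An antiderivative of a rational function of degree at most `d - 1 < -1` can be chosen to have
degree at most `d`. -/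
theorem exists_degLE_antideriv {R : RatFunc ℂ} {d : ℤ} (hd : d < 0) (hR : DegLE R′ (d - 1)) :
    ∃ S : RatFunc ℂ, S′ = R′ ∧ DegLE S d := by
  -- A positive degree would drop by exactly one under differentiation and stay above `d - 1`.
  have h0 : DegLE R 0 := by
    by_contra h
    simp only [DegLE, not_or, not_le] at h
    obtain ⟨h1, h2⟩ := intDegree_deriv h.1 h.2.ne'
    rcases hR with hR | hR
    · exact h1 hR
    · omega
  -- Subtracting the value at infinity removes degree zero, the one degree that `intDegree_deriv`
  -- does not control.
  obtain ⟨c, hc⟩ := exists_const_sub h0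
  have hS : (R - toRat (C c))′ = R′ := by rw [map_sub, deriv_const, sub_zero]
  refine ⟨R - toRat (C c), hS, ?_⟩
  by_contra h
  simp only [DegLE, not_or, not_le] at h
  have hneg : (R - toRat (C c)).intDegree ≤ -1 := hc.resolve_left h.1
  obtain ⟨h1, h2⟩ := intDegree_deriv h.1 (by omega)
  rw [hS] at h1 h2
  rcases hR with hR | hR
  · exact h1 hR
  · omega

/-! ### Regular points and values -/

/-- The rational function `R` has no pole at `a`. -/
def RegAt (a : ℂ) (R : RatFunc ℂ) : Prop :=
  ∃ p q : ℂ[X], q.eval a ≠ 0 ∧ R = toRat p / toRat q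

/-- The value of a rational function. -/
def val (R : RatFunc ℂ) (a : ℂ) : ℂ := RatFunc.eval (RingHom.id ℂ) a R

theorem ne_zero_of_eval {q : ℂ[X]} {a : ℂ} (h : q.eval a ≠ 0) : q ≠ 0 := by
  rintro rfl; simp at h

theorem val_div {p q : ℂ[X]} {a : ℂ} (hq : q.eval a ≠ 0) :
    val (toRat p / toRat q) a = p.eval a / q.eval a := by
  set R := toRat p / toRat q with hR
  have hq0 := ne_zero_of_eval hq
  have hdvd : R.denom ∣ q := (RatFunc.denom_dvd hq0).2 ⟨p, hR⟩
  have hd : R.denom.eval a ≠ 0 := fun h => hq (eval_eq_zero_of_dvd_of_eval_eq_zero hdvd h)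
  have h0 : R.num * q = p * R.denom := by
    apply toRat_injective
    have h : toRat R.num = R * toRat R.denom :=
      (div_eq_iff (toRat_ne_zero R.denom_ne_zero)).1 (RatFunc.num_div_denom R)
    rw [map_mul, map_mul, h, mul_right_comm, hR, div_mul_cancel₀ _ (toRat_ne_zero hq0)]
  have h1 := congrArg (Polynomial.eval a) h0
  rw [eval_mul, eval_mul] at h1
  simp only [val, RatFunc.eval, eval₂_id]
  rw [div_eq_div_iff hd hq, h1]

theorem val_toRat (p : ℂ[X]) (a : ℂ) : val (toRat p) a = p.eval a := by
  have := val_div (p := p) (q := 1) (a := a) (by simp)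
  simpa using this

theorem regAt_toRat (p : ℂ[X]) (a : ℂ) : RegAt a (toRat p) := ⟨p, 1, by simp, by simp⟩

section
variable {a : ℂ} {R S : RatFunc ℂ}

theorem add_rep {p q r s : ℂ[X]} (hq : q.eval a ≠ 0) (hs : s.eval a ≠ 0) :
    toRat p / toRat q + toRat r / toRat s = toRat (p * s + q * r) / toRat (q * s) := by
  rw [div_add_div _ _ (toRat_ne_zero (ne_zero_of_eval hq)) (toRat_ne_zero (ne_zero_of_eval hs))]
  simp only [map_add, map_mul]

theorem mul_rep (p q r s : ℂ[X]) :
    toRat p / toRat q * (toRat r / toRat s) = toRat (p * r) / toRat (q * s) := by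
  rw [div_mul_div_comm]
  simp only [map_mul]

theorem RegAt.add (hR : RegAt a R) (hS : RegAt a S) : RegAt a (R + S) := by
  obtain ⟨p, q, hq, rfl⟩ := hR
  obtain ⟨r, s, hs, rfl⟩ := hS
  exact ⟨_, _, by rw [eval_mul]; exact mul_ne_zero hq hs, add_rep hq hs⟩

theorem RegAt.mul (hR : RegAt a R) (hS : RegAt a S) : RegAt a (R * S) := by
  obtain ⟨p, q, hq, rfl⟩ := hR
  obtain ⟨r, s, hs, rfl⟩ := hS
  exact ⟨_, _, by rw [eval_mul]; exact mul_ne_zero hq hs, mul_rep _ _ _ _⟩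

theorem RegAt.neg (hR : RegAt a R) : RegAt a (-R) := by
  obtain ⟨p, q, hq, rfl⟩ := hR
  exact ⟨-p, q, hq, by rw [← neg_div, ← map_neg]⟩

theorem RegAt.sub (hR : RegAt a R) (hS : RegAt a S) : RegAt a (R - S) := by
  rw [sub_eq_add_neg]; exact hR.add hS.neg

theorem RegAt.deriv (hR : RegAt a R) : RegAt a R′ := by
  obtain ⟨p, q, hq, rfl⟩ := hR
  exact ⟨quotNum p q, q ^ 2, by rw [eval_pow]; exact pow_ne_zero _ hq,
    by rw [deriv_div p (ne_zero_of_eval hq), map_pow]⟩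

theorem val_add (hR : RegAt a R) (hS : RegAt a S) : val (R + S) a = val R a + val S a := by
  obtain ⟨p, q, hq, rfl⟩ := hR
  obtain ⟨r, s, hs, rfl⟩ := hS
  rw [add_rep hq hs, val_div hq, val_div hs, val_div (by rw [eval_mul]; exact mul_ne_zero hq hs)]
  simp only [eval_add, eval_mul]
  rw [div_add_div _ _ hq hs]

theorem val_mul (hR : RegAt a R) (hS : RegAt a S) : val (R * S) a = val R a * val S a := by
  obtain ⟨p, q, hq, rfl⟩ := hR
  obtain ⟨r, s, hs, rfl⟩ := hS
  rw [mul_rep, val_div hq, val_div hs, val_div (by rw [eval_mul]; exact mul_ne_zero hq hs)]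
  simp only [eval_mul]
  rw [div_mul_div_comm]

theorem val_neg (hR : RegAt a R) : val (-R) a = -val R a := by
  obtain ⟨p, q, hq, rfl⟩ := hR
  rw [← neg_div, ← map_neg, val_div hq, val_div hq, eval_neg, neg_div]

theorem val_sub (hR : RegAt a R) (hS : RegAt a S) : val (R - S) a = val R a - val S a := by
  rw [sub_eq_add_neg, val_add hR hS.neg, val_neg hS, sub_eq_add_neg]

theorem RegAt.hasDerivAt (hR : RegAt a R) : HasDerivAt (val R) (val R′ a) a := by
  obtain ⟨p, q, hq, rfl⟩ := hR
  have h := (p.hasDerivAt a).div (q.hasDerivAt a) hq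
  rw [deriv_div p (ne_zero_of_eval hq), ← map_pow,
    val_div (by rw [eval_pow]; exact pow_ne_zero _ hq)]
  simp only [quotNum, eval_sub, eval_mul, eval_pow]
  refine h.congr_of_eventuallyEq ?_
  filter_upwards [(q.continuous.continuousAt (x := a)).eventually_ne hq] with z hz
  rw [val_div hz]; rfl

end

/-- A pole of `R` of order `m ≥ 1` is a pole of `R′ + κ R` of order `m + 1`. -/
theorem regAt_of_mul_deriv {a : ℂ} {R : RatFunc ℂ} (κ : ℂ)
    (h : RegAt a (toRat (X - C a) * (R′ + toRat (C κ) * R))) : RegAt a R := by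
  by_cases hd : R.denom.eval a = 0
  swap
  · exact ⟨R.num, R.denom, hd, (RatFunc.num_div_denom R).symm⟩
  exfalso
  have hq0 := R.denom_ne_zero
  have hp : R.num.eval a ≠ 0 := by
    intro hp
    obtain ⟨u, v, huv⟩ := RatFunc.isCoprime_num_denom R
    have := congrArg (eval a) huv
    simp [hp, hd] at this
  have hRR := (RatFunc.num_div_denom R).symm
  obtain ⟨s, t, ht, hst⟩ := h
  have ht0 := ne_zero_of_eval ht
  generalize R.num = p at *
  generalize R.denom = q at *
  obtain ⟨r, hr, hra⟩ := exists_eq_pow_rootMultiplicity_mul_and_not_dvd q hq0 a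
  have hm : 0 < q.rootMultiplicity a := (rootMultiplicity_pos hq0).2 hd
  obtain ⟨m, hm⟩ := Nat.exists_eq_succ_of_ne_zero hm.ne'
  rw [hm] at hr
  rw [dvd_iff_isRoot, IsRoot.def] at hra
  have hqd := toRat_ne_zero hq0
  have htd := toRat_ne_zero ht0
  have key : (X - C a) * (quotNum p q + C κ * p * q) * t = s * q ^ 2 := by
    apply toRat_injective
    subst hRR
    rw [deriv_div p hq0] at hst
    simp only [map_mul, map_add, map_pow] at hst ⊢
    field_simp at hst
    linear_combination hst
  have key2 : ((X - C a) * (derivative p * r + C κ * p * r - p * derivative r)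
      - (m + 1 : ℂ[X]) * p * r) * t = s * (X - C a) ^ (m + 1) * r ^ 2 := by
    have hx : (X - C a) ^ (m + 1) ≠ 0 := pow_ne_zero _ (X_sub_C_ne_zero a)
    apply mul_left_cancel₀ hx
    rw [hr] at key
    simp only [quotNum, derivative_mul, derivative_X_sub_C_pow] at key
    simp only [Nat.succ_eq_add_one, Nat.add_sub_cancel, map_natCast] at key
    push_cast at key
    linear_combination key
  -- Here `m + 1` is the order of the pole. At `a` only the term `(m + 1) p r t` survives, and none
  -- of its factors vanishes there.
  have h3 := congrArg (eval a) key2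
  simp at h3
  rcases h3 with (h3 | h3) | h3
  · rcases h3 with h3 | h3
    · exact absurd h3 (by exact_mod_cast Nat.succ_ne_zero m)
    · exact hp h3
  · exact hra h3
  · exact ht h3

theorem exists_toRat_of_regAt {R : RatFunc ℂ} (h : ∀ a, RegAt a R) : ∃ p, R = toRat p := by
  have hd : R.denom.natDegree = 0 := by
    by_contra hne
    obtain ⟨a, ha⟩ := IsAlgClosed.exists_root R.denom
      (fun h => hne (natDegree_eq_of_degree_eq_some h))
    obtain ⟨p, q, hq, hR⟩ := h a
    exact hq (eval_eq_zero_of_dvd_of_eval_eq_zero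
      ((RatFunc.denom_dvd (ne_zero_of_eval hq)).2 ⟨p, hR⟩) ha)
  refine ⟨R.num, ?_⟩
  have h1 := (RatFunc.num_div_denom R).symm
  rw [(RatFunc.monic_denom R).natDegree_eq_zero.1 hd] at h1
  simpa using h1

theorem regAt_of_deriv {a : ℂ} {R : RatFunc ℂ} (h : RegAt a R′) : RegAt a R := by
  refine regAt_of_mul_deriv 0 ?_
  rw [map_zero, map_zero, zero_mul, add_zero]
  exact (regAt_toRat (X - C a) a).mul h

/-- A rational function with polynomial derivative is a polynomial. -/
theorem exists_toRat_of_deriv {R : RatFunc ℂ} {p : ℂ[X]} (h : R′ = toRat p) :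
    ∃ q, R = toRat q :=
  exists_toRat_of_regAt fun a => regAt_of_deriv (h ▸ regAt_toRat p a)

theorem exists_antideriv (p : ℂ[X]) : ∃ q : ℂ[X], derivative q = p := by
  induction p using Polynomial.induction_on' with
  | add p q hp hq =>
    obtain ⟨r, rfl⟩ := hp
    obtain ⟨s, rfl⟩ := hq
    exact ⟨r + s, derivative_add⟩
  | monomial n c =>
    refine ⟨monomial (n + 1) (c / (n + 1)), ?_⟩
    rw [derivative_monomial]
    have : (n + 1 : ℂ) ≠ 0 := by exact_mod_cast Nat.succ_ne_zero n
    simp [this]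

theorem exists_const_of_deriv_eq_zero {R : RatFunc ℂ} (h : R′ = 0) : ∃ c, R = toRat (C c) := by
  obtain ⟨q, rfl⟩ := exists_toRat_of_deriv (p := 0) (by rw [h, map_zero])
  rw [deriv_toRat] at h
  have h0 : derivative q = 0 := toRat_injective (by rw [h, map_zero])
  exact ⟨q.coeff 0, by rw [← eq_C_of_natDegree_eq_zero (derivative_eq_zero.1 h0)]⟩

/-- The homogeneous equation `R′ + κ R = 0` with `κ ≠ 0` has no nonzero rational solution. -/
theorem eq_zero_of_deriv_add_mul {R : RatFunc ℂ} {κ : ℂ} (hκ : κ ≠ 0)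
    (h : R′ + toRat (C κ) * R = 0) : R = 0 := by
  by_contra hR
  -- The equation writes `R` as a constant times `R′`, whose degree is strictly smaller.
  have h1 : DegLE R (R.intDegree - 1) := by
    have h2 : R = toRat (C (-κ⁻¹)) * R′ := by
      have h3 : toRat (C (-κ⁻¹)) * toRat (C κ) = -1 := by
        rw [← map_mul, ← C_mul, neg_mul, inv_mul_cancel₀ hκ]; simp
      linear_combination (-toRat (C (-κ⁻¹))) * h + R * h3
    have h4 := (degLE_toRat (C (-κ⁻¹))).mul (degLE_self R).deriv
    rw [← h2, natDegree_C] at h4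
    simpa using h4
  rcases h1 with h1 | h1
  · exact hR h1
  · omega

/-! ### Iterated Darboux transformations and Wronskians -/

section Iterate

variable {K S : Type*} [Field K] [Differential K] [CommRing S]

/-- The composition `(Δ - w_{n-1}) ⋯ (Δ - w_0)`. -/
def darbouxIter (ι : K →+* S) (w : ℕ → K) (Δ : S → S) : ℕ → S → S
  | 0, s => s
  | n + 1, s => Δ (darbouxIter ι w Δ n s) - ι (w n) * darbouxIter ι w Δ n s

/-- The coefficients of `Δ^i` in terms of the operators `(Δ - w_{j-1}) ⋯ (Δ - w_0)`. -/
def powerCoeff (w : ℕ → K) : ℕ → ℕ → K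
  | 0, 0 => 1
  | 0, _ + 1 => 0
  | i + 1, 0 => (powerCoeff w i 0)′ + w 0 * powerCoeff w i 0
  | i + 1, j + 1 => (powerCoeff w i (j + 1))′ + w (j + 1) * powerCoeff w i (j + 1)
      + powerCoeff w i j

theorem powerCoeff_of_lt (w : ℕ → K) : ∀ {i j : ℕ}, i < j → powerCoeff w i j = 0
  | 0, _ + 1, _ => by simp [powerCoeff]
  | i + 1, j + 1, h => by
    have h' : i < j := Nat.lt_of_succ_lt_succ h
    simp [powerCoeff, powerCoeff_of_lt w h', powerCoeff_of_lt w (Nat.lt_succ_of_lt h')]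

theorem powerCoeff_self (w : ℕ → K) : ∀ i : ℕ, powerCoeff w i i = 1
  | 0 => by simp [powerCoeff]
  | i + 1 => by
    simp [powerCoeff, powerCoeff_of_lt w (Nat.lt_succ_self i), powerCoeff_self w i]

/-- `Δ` is a connection over the derivation of `K`. -/
structure IsConnection (ι : K →+* S) (Δ : S → S) : Prop where
  add : ∀ s t, Δ (s + t) = Δ s + Δ t
  leibniz : ∀ c s, Δ (ι c * s) = ι c′ * s + ι c * Δ s

theorem IsConnection.sum {ι : K →+* S} {Δ : S → S} (h : IsConnection ι Δ) (f : ℕ → S) (n : ℕ) :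
    Δ (∑ j ∈ Finset.range n, f j) = ∑ j ∈ Finset.range n, Δ (f j) := by
  induction n with
  | zero =>
    have := h.add 0 0
    simpa using this
  | succ n ih => rw [Finset.sum_range_succ, Finset.sum_range_succ, h.add, ih]

/-- The coefficients depend on `w` alone and not on `Δ`. Different columns of a generalized
Wronskian may therefore use different connections and still share one change of basis. -/
theorem iterate_eq_sum (ι : K →+* S) (w : ℕ → K) {Δ : S → S} (h : IsConnection ι Δ)
    (s : S) (i : ℕ) :
    Δ^[i] s = ∑ j ∈ Finset.range (i + 1), ι (powerCoeff w i j) * darbouxIter ι w Δ j s := by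
  induction i with
  | zero => simp [powerCoeff, darbouxIter]
  | succ i ih =>
    have hstep : ∀ j, Δ (darbouxIter ι w Δ j s)
        = darbouxIter ι w Δ (j + 1) s + ι (w j) * darbouxIter ι w Δ j s := fun j => by
      simp [darbouxIter]
    have hlast : Δ^[i + 1] s = ∑ j ∈ Finset.range (i + 2),
        (ι ((powerCoeff w i j)′ + w j * powerCoeff w i j)) * darbouxIter ι w Δ j s
        + ∑ j ∈ Finset.range (i + 1), ι (powerCoeff w i j) * darbouxIter ι w Δ (j + 1) s := by
      rw [Function.iterate_succ_apply', ih, h.sum, Finset.sum_range_succ _ (i + 1),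
        powerCoeff_of_lt w (Nat.lt_succ_self i)]
      simp only [map_zero, mul_zero, add_zero, zero_mul, ← Finset.sum_add_distrib]
      refine Finset.sum_congr rfl fun j _ => ?_
      rw [h.leibniz, hstep]
      simp only [map_add, map_mul]
      ring
    rw [hlast, Finset.sum_range_succ', Finset.sum_range_succ' _ (i + 1), add_right_comm,
      ← Finset.sum_add_distrib]
    simp only [powerCoeff, map_add, map_mul, add_mul]

/-- A generalized Wronskian whose columns are killed by the Darboux operators below the diagonal
is the product of the diagonal values of the Darboux operators. -/
theorem det_iterate (ι : K →+* S) (w : ℕ → K) {n : ℕ} (Δ : Fin n → S → S)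
    (h : ∀ j, IsConnection ι (Δ j)) (col : Fin n → S)
    (hz : ∀ i j : Fin n, j < i → darbouxIter ι w (Δ j) i (col j) = 0) :
    Matrix.det (Matrix.of fun i j : Fin n => (Δ j)^[(i : ℕ)] (col j))
      = ∏ i : Fin n, darbouxIter ι w (Δ i) i (col i) := by
  -- The matrix factors as a lower unitriangular matrix times an upper triangular one.
  have hmul : (Matrix.of fun i j : Fin n => (Δ j)^[(i : ℕ)] (col j))
      = (Matrix.of fun i j : Fin n => ι (powerCoeff w i j))
        * (Matrix.of fun i j : Fin n => darbouxIter ι w (Δ j) i (col j)) := by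
    ext i j
    simp only [Matrix.of_apply, Matrix.mul_apply]
    rw [Fin.sum_univ_eq_sum_range
      (fun l => ι (powerCoeff w i l) * darbouxIter ι w (Δ j) l (col j)) n,
      iterate_eq_sum ι w (h j)]
    refine Finset.sum_subset (Finset.range_subset_range.2 i.2) fun l _ hl => ?_
    rw [powerCoeff_of_lt w (by simpa using hl), map_zero, zero_mul]
  rw [hmul, Matrix.det_mul, Matrix.det_of_isLowerTriangular, Matrix.det_of_isUpperTriangular]
  · simp [powerCoeff_self]
  · intro i j hij
    exact hz i j hij
  · intro i j hij
    simp only [Matrix.of_apply]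
    rw [powerCoeff_of_lt w (by simpa using hij), map_zero]

end Iterate

section Crum

variable {K : Type*} [Field K] [Differential K]

/-- `(∂ - w_{n-1}) ⋯ (∂ - w_0) h`, where `w_j` is the logarithmic derivative of the value of the
`j`-th operator at `a_j`. -/
def crum (a : ℕ → K) : ℕ → K → K
  | 0, h => h
  | n + 1, h => (crum a n h)′ - (crum a n (a n))′ / crum a n (a n) * crum a n h

/-- The logarithmic derivative of the `n`-th seed function. -/
def crumW (a : ℕ → K) (n : ℕ) : K := (crum a n (a n))′ / crum a n (a n)

/-- The potential after `n` Darboux transformations of the zero potential. -/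
def crumU (a : ℕ → K) : ℕ → K
  | 0 => 0
  | n + 1 => crumW a n ^ 2 - (crumW a n)′

theorem crum_succ (a : ℕ → K) (n : ℕ) (h : K) :
    crum a (n + 1) h = (crum a n h)′ - crumW a n * crum a n h := rfl

theorem crumU_succ (a : ℕ → K) (n : ℕ) : crumU a (n + 1) = crumW a n ^ 2 - (crumW a n)′ := rfl

theorem crum_zero_right (a : ℕ → K) (n : ℕ) : crum a n 0 = 0 := by
  induction n with
  | zero => rfl
  | succ n ih => rw [crum_succ, ih]; simp

theorem crum_eq_darbouxIter (a : ℕ → K) (n : ℕ) (h : K) :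
    crum a n h = darbouxIter (RingHom.id K) (crumW a) (fun s => s′) n h := by
  induction n with
  | zero => rfl
  | succ n ih => rw [crum_succ, ih]; rfl

theorem deriv_seed {a : ℕ → K} {n : ℕ} (hφ : crum a n (a n) ≠ 0) :
    (crum a n (a n))′ = crumW a n * crum a n (a n) := by
  rw [crumW, div_mul_cancel₀ _ hφ]

theorem crum_eq_zero {a : ℕ → K} (hφ : ∀ n, crum a n (a n) ≠ 0) {i j : ℕ} (h : j < i) :
    crum a i (a j) = 0 := by
  induction i, h using Nat.le_induction with
  | base => rw [crum_succ, deriv_seed (hφ j), sub_self]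
  | succ i _ ih => rw [crum_succ, ih]; simp

theorem isConnection_deriv : IsConnection (RingHom.id K) (fun s : K => s′) :=
  ⟨fun s t => map_add _ s t, fun c s => by simp; ring⟩

theorem wronskian_eq_prod {a : ℕ → K} (hφ : ∀ n, crum a n (a n) ≠ 0) (n : ℕ) :
    Matrix.det (Matrix.of fun i j : Fin n => (fun s : K => s′)^[(i : ℕ)] (a j))
      = ∏ i ∈ Finset.range n, crum a i (a i) := by
  rw [det_iterate (RingHom.id K) (crumW a) (fun _ => fun s : K => s′)
    (fun _ => isConnection_deriv) (fun j => a j), Finset.prod_range]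
  · simp only [← crum_eq_darbouxIter]
  · intro i j hij
    rw [← crum_eq_darbouxIter, crum_eq_zero hφ hij]

section Schrodinger

variable {a : ℕ → K} (hφ : ∀ n, crum a n (a n) ≠ 0) (h0 : (a 0)′′ = 0)
  (h1 : ∀ n, (a (n + 1))′′ = a n)

include hφ h0 h1

/-- The intertwining relation and the Riccati equation need a joint induction: intertwining at `n +
1` uses Riccati at `n`, while Riccati at `n + 1` is intertwining at `n + 1` applied to the next
seed. -/
theorem crum_deriv_deriv (n : ℕ) (h : K) :
    crum a n h′′ = (crum a n h)′′ - crumU a n * crum a n h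
      ∧ (crumW a n)′ + crumW a n ^ 2 = crumU a n := by
  induction n generalizing h with
  | zero =>
    have hA := deriv_seed (hφ 0)
    have hφ0 := hφ 0
    simp only [crum] at hA hφ0
    refine ⟨by simp [crum, crumU], ?_⟩
    have hB : (a 0)′′ = crumW a 0 * (crumW a 0 * a 0) + a 0 * (crumW a 0)′ := by
      rw [hA, leib, hA]
    rw [h0] at hB
    have : a 0 * ((crumW a 0)′ + crumW a 0 ^ 2) = 0 := by linear_combination -hB
    simpa [crumU, hφ0] using this
  | succ n ih =>
    have key : ∀ h, crum a (n + 1) h′′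
        = (crum a (n + 1) h)′′ - crumU a (n + 1) * crum a (n + 1) h := by
      intro h
      rw [crum_succ, (ih h).1, crum_succ]
      simp only [crumU_succ, map_sub, leib, map_add]
      have h2 := (ih h).2
      have h3 := congrArg (fun x => x′) h2
      simp only [map_add, pow_two, leib] at h3 h2
      linear_combination ((crum a n h)′ - crumW a n * crum a n h) * h2 + crum a n h * h3
    refine ⟨key h, ?_⟩
    have hA := deriv_seed (hφ (n + 1))
    have hB : (crum a (n + 1) (a (n + 1)))′′
        = crumW a (n + 1) * (crumW a (n + 1) * crum a (n + 1) (a (n + 1)))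
          + crum a (n + 1) (a (n + 1)) * (crumW a (n + 1))′ := by
      rw [hA, leib, hA]
    -- The second derivative of the seed `a (n + 1)` is `a n`, which the operator of order `n + 1`
    -- kills.
    have hk := key (a (n + 1))
    rw [h1, crum_eq_zero hφ (Nat.lt_succ_self n)] at hk
    have : crum a (n + 1) (a (n + 1)) * ((crumW a (n + 1))′ + crumW a (n + 1) ^ 2
        - crumU a (n + 1)) = 0 := by
      linear_combination -hB - hk
    have := (mul_eq_zero.1 this).resolve_left (hφ (n + 1))
    linear_combination this

theorem riccati (n : ℕ) : (crumW a n)′ + crumW a n ^ 2 = crumU a n :=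
  (crum_deriv_deriv hφ h0 h1 n 0).2

/-- The potential is `-2 (log τ_n)''`. -/
theorem crumU_eq (n : ℕ) : crumU a n = -2 * (∑ i ∈ Finset.range n, crumW a i)′ := by
  induction n with
  | zero => simp [crumU]
  | succ n ih =>
    rw [Finset.sum_range_succ, map_add, mul_add, ← ih, crumU, ← riccati hφ h0 h1 n]
    ring

/-- Up to a constant, the Darboux image of `1` is the inverse of the last seed function. -/
theorem deriv_seed_mul_crum_one (n : ℕ) : (crum a n (a n) * crum a (n + 1) 1)′ = 0 := by
  have hA := deriv_seed (hφ n)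
  -- As `1′′ = 0`, the image of `1` solves the same Schrödinger equation as the seed. The product in
  -- question is the Wronskian of these two solutions, hence constant.
  have hy := (crum_deriv_deriv hφ h0 h1 n 1).1
  have h2 := riccati hφ h0 h1 n
  simp only [Derivation.map_one_eq_zero, map_zero, crum_zero_right] at hy
  rw [crum_succ]
  simp only [leib, map_sub, hA]
  linear_combination -crum a n (a n) * hy - crum a n (a n) * crum a n 1 * h2

end Schrodinger

/-! ### Wave functions with a formal spectral parameter -/

/-- The wave function `e^{kz} P_n(k)` of `n` Darboux transformations, as a polynomial in `k`. -/
def wave (w : ℕ → K) : ℕ → K[X]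
  | 0 => 1
  | n + 1 => C (w n) * wave w n - Differential.mapCoeffs (wave w n) - X * wave w n

theorem leibP (p q : K[X]) : Differential.mapCoeffs (p * q)
    = p * Differential.mapCoeffs q + q * Differential.mapCoeffs p := by
  simp

/-- With the factor `e^{kz}` restored, this is `ψ'' = (u_n + k²) ψ`. The Riccati equation and its
derivative carry it from one level to the next. -/
theorem wave_schrodinger {a : ℕ → K} (hφ : ∀ n, crum a n (a n) ≠ 0) (h0 : (a 0)′′ = 0)
    (h1 : ∀ n, (a (n + 1))′′ = a n) (n : ℕ) :
    Differential.mapCoeffs (Differential.mapCoeffs (wave (crumW a) n))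
      + 2 * X * Differential.mapCoeffs (wave (crumW a) n)
      = C (crumU a n) * wave (crumW a) n := by
  induction n with
  | zero => simp [wave, crumU]
  | succ n ih =>
    have h2 := congrArg C (riccati hφ h0 h1 n)
    have h3 := congrArg (fun x => C x′) (riccati hφ h0 h1 n)
    have h4 := congrArg (fun x => Differential.mapCoeffs x) ih
    have h5 : Differential.mapCoeffs (2 : K[X]) = 0 := by
      have := Differential.mapCoeffs.map_natCast (A := K[X]) 2
      simpa using this
    simp only [wave, crumU_succ]
    simp only [map_sub, map_add, leibP, Differential.mapCoeffs_C, Differential.mapCoeffs_X,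
      pow_two, leib, h5, C_mul, mul_zero, add_zero] at h2 h3 h4 ⊢
    linear_combination (C (crumW a n) - X) * ih - h4
      + (Differential.mapCoeffs (wave (crumW a) n)
        + (X - C (crumW a n)) * wave (crumW a) n) * h2 + wave (crumW a) n * h3

theorem wave_eval_zero (a : ℕ → K) (n : ℕ) :
    (wave (crumW a) n).coeff 0 = (-1) ^ n * crum a n 1 := by
  induction n with
  | zero => simp [wave, crum]
  | succ n ih =>
    have h := leib ((-1) ^ n) (crum a n 1)
    have h5 : ((-1 : K) ^ n)′ = 0 := by
      rw [Derivation.leibniz_pow]; simp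
    rw [h5, mul_zero, add_zero] at h
    simp only [wave, coeff_sub, coeff_C_zero, Differential.coeff_mapCoeffs, mul_coeff_zero,
      coeff_X_zero, zero_mul, sub_zero, ih, h, crum_succ]
    ring

theorem isConnection_mapCoeffs : IsConnection (C : K →+* K[X])
    (fun s => Differential.mapCoeffs s) :=
  ⟨fun s t => map_add _ s t, fun c s => by rw [leibP, Differential.mapCoeffs_C]; ring⟩

/-- This is `d/dz` conjugated by `e^{kz}`, which lets the exponential column of a Wronskian be
handled algebraically. -/
theorem isConnection_mapCoeffs_add : IsConnection (C : K →+* K[X])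
    (fun s => Differential.mapCoeffs s + X * s) :=
  ⟨fun s t => by rw [map_add]; ring,
    fun c s => by rw [leibP, Differential.mapCoeffs_C]; ring⟩

theorem darbouxIter_C (a : ℕ → K) (n : ℕ) (h : K) :
    darbouxIter (C : K →+* K[X]) (crumW a) (fun s => Differential.mapCoeffs s) n (C h)
      = C (crum a n h) := by
  induction n with
  | zero => rfl
  | succ n ih => rw [darbouxIter, ih, crum_succ]; simp

theorem darbouxIter_one (w : ℕ → K) (n : ℕ) :
    darbouxIter (C : K →+* K[X]) w (fun s => Differential.mapCoeffs s + X * s) n 1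
      = (-1) ^ n * wave w n := by
  induction n with
  | zero => simp [darbouxIter, wave]
  | succ n ih =>
    have h5 : Differential.mapCoeffs ((-1 : K[X]) ^ n) = 0 := by
      rw [Derivation.leibniz_pow]; simp
    rw [darbouxIter, ih, wave, leibP, h5]
    ring

/-- The product of the Wronskian of `a_0, …, a_{n-1}` with the wave function is, up to a sign, the
Wronskian of `a_0, …, a_{n-1}, e^{kz}` without its exponential factor. -/
theorem det_wave {a : ℕ → K} (hφ : ∀ n, crum a n (a n) ≠ 0) (n : ℕ) :
    Matrix.det (Matrix.of fun i j : Fin (n + 1) =>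
        if (j : ℕ) < n then C ((fun s : K => s′)^[(i : ℕ)] (a j)) else X ^ (i : ℕ))
      = (-1) ^ n * C (∏ i ∈ Finset.range n, crum a i (a i)) * wave (crumW a) n := by
  have hC : ∀ (i : ℕ) (h : K), (fun s : K[X] => Differential.mapCoeffs s)^[i] (C h)
      = C ((fun s : K => s′)^[i] h) := by
    intro i h
    induction i with
    | zero => rfl
    | succ i ih => rw [Function.iterate_succ_apply', Function.iterate_succ_apply', ih]; simp
  have hX : ∀ i : ℕ, (fun s : K[X] => Differential.mapCoeffs s + X * s)^[i] 1 = X ^ i := by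
    intro i
    induction i with
    | zero => rfl
    | succ i ih =>
      rw [Function.iterate_succ_apply', ih, Derivation.leibniz_pow]
      simp [pow_succ, mul_comm]
  have := det_iterate (C : K →+* K[X]) (crumW a) (n := n + 1)
    (fun j => if (j : ℕ) < n then (fun s => Differential.mapCoeffs s)
      else (fun s => Differential.mapCoeffs s + X * s))
    (fun j => by
      split_ifs
      · exact isConnection_mapCoeffs
      · exact isConnection_mapCoeffs_add)
    (fun j => if (j : ℕ) < n then C (a j) else 1)
    (fun i j hij => by
      have h2 : (j : ℕ) < n := by have := i.2; have : (j : ℕ) < i := hij; omega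
      simp only [h2, if_true]
      rw [darbouxIter_C, crum_eq_zero hφ hij, C_0])
  rw [Fin.prod_univ_castSucc] at this
  simp only [Fin.val_castSucc, Fin.is_lt, if_true, Fin.val_last, lt_irrefl, if_false,
    darbouxIter_C, darbouxIter_one] at this
  rw [map_prod, Finset.prod_range, mul_comm ((-1) ^ n), mul_assoc, ← this]
  congr 1
  ext1 i j
  simp only [Matrix.of_apply]
  split_ifs
  · rw [hC]
  · rw [hX]

end Crum

/-! ### The generating function -/

section Series

variable {R : Type*} [CommRing R]

/-- The differential equation `(1 - λ²) H' = (α + γ λ + β λ²) H`, in terms of coefficients. -/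
theorem series_ode_iff (H : PowerSeries R) (α γ β : R) :
    (1 - PowerSeries.X ^ 2) * PowerSeries.derivative R H
        = (PowerSeries.C α + PowerSeries.C γ * PowerSeries.X
          + PowerSeries.C β * PowerSeries.X ^ 2) * H ↔
      (PowerSeries.coeff 1 H = α * PowerSeries.coeff 0 H ∧
        2 * PowerSeries.coeff 2 H = α * PowerSeries.coeff 1 H + γ * PowerSeries.coeff 0 H ∧
        ∀ j : ℕ, (j + 3) * PowerSeries.coeff (j + 3) H - (j + 1) * PowerSeries.coeff (j + 1) H
          = α * PowerSeries.coeff (j + 2) H + γ * PowerSeries.coeff (j + 1) H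
            + β * PowerSeries.coeff j H) := by
  have hL : ∀ m, PowerSeries.coeff m ((1 - PowerSeries.X ^ 2) * PowerSeries.derivative R H)
      = PowerSeries.coeff m (PowerSeries.derivative R H)
        - PowerSeries.coeff m (PowerSeries.X ^ 2 * PowerSeries.derivative R H) := fun m => by
    rw [sub_mul, one_mul, map_sub]
  have hR : ∀ m, PowerSeries.coeff m ((PowerSeries.C α + PowerSeries.C γ * PowerSeries.X
          + PowerSeries.C β * PowerSeries.X ^ 2) * H)
      = α * PowerSeries.coeff m H + γ * PowerSeries.coeff m (PowerSeries.X * H)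
        + β * PowerSeries.coeff m (PowerSeries.X ^ 2 * H) := fun m => by
    rw [add_mul, add_mul, map_add, map_add, mul_assoc, mul_assoc, PowerSeries.coeff_C_mul,
      PowerSeries.coeff_C_mul, PowerSeries.coeff_C_mul]
  have hx0 : ∀ G : PowerSeries R, PowerSeries.coeff 0 (PowerSeries.X * G) = 0 := fun G => by simp
  have hx1 : ∀ G : PowerSeries R, PowerSeries.coeff 0 (PowerSeries.X ^ 2 * G) = 0 := fun G => by
    simp
  have hx2 : ∀ G : PowerSeries R, PowerSeries.coeff 1 (PowerSeries.X ^ 2 * G) = 0 := fun G => by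
    rw [PowerSeries.coeff_X_pow_mul']; simp
  have hx3 : ∀ (G : PowerSeries R) j,
      PowerSeries.coeff (j + 2) (PowerSeries.X ^ 2 * G) = PowerSeries.coeff j G := fun G j =>
    PowerSeries.coeff_X_pow_mul _ _ _
  rw [PowerSeries.ext_iff]
  constructor
  · intro h
    refine ⟨?_, ?_, fun j => ?_⟩
    · have := h 0
      rw [hL, hR, hx0, hx1, hx1, PowerSeries.coeff_derivative] at this
      linear_combination this
    · have := h 1
      rw [hL, hR, hx2, hx2, PowerSeries.coeff_derivative, PowerSeries.coeff_succ_X_mul] at this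
      push_cast at this
      linear_combination this
    · have := h (j + 2)
      rw [hL, hR, hx3, hx3, PowerSeries.coeff_derivative, PowerSeries.coeff_derivative,
        PowerSeries.coeff_succ_X_mul] at this
      push_cast at this
      linear_combination this
  · rintro ⟨h0, h1, h2⟩ m
    rw [hL, hR]
    match m with
    | 0 =>
      rw [hx0, hx1, hx1, PowerSeries.coeff_derivative]
      push_cast
      linear_combination h0
    | 1 =>
      rw [hx2, hx2, PowerSeries.coeff_derivative, PowerSeries.coeff_succ_X_mul]
      push_cast
      linear_combination h1
    | j + 2 =>
      rw [hx3, hx3, PowerSeries.coeff_derivative, PowerSeries.coeff_derivative,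
        PowerSeries.coeff_succ_X_mul]
      push_cast
      linear_combination h2 j

theorem series_ode_unique [IsDomain R] [CharZero R] {H : PowerSeries R} {α γ β : R}
    (h : (1 - PowerSeries.X ^ 2) * PowerSeries.derivative R H
        = (PowerSeries.C α + PowerSeries.C γ * PowerSeries.X
          + PowerSeries.C β * PowerSeries.X ^ 2) * H)
    (h0 : PowerSeries.coeff 0 H = 0) : H = 0 := by
  obtain ⟨h1, h2, h3⟩ := (series_ode_iff H α γ β).1 h
  rw [h0, mul_zero] at h1
  rw [h0, h1, mul_zero, mul_zero, add_zero] at h2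
  have h2' : PowerSeries.coeff 2 H = 0 := (mul_eq_zero.1 h2).resolve_left two_ne_zero
  have key : ∀ j, PowerSeries.coeff j H = 0 ∧ PowerSeries.coeff (j + 1) H = 0
      ∧ PowerSeries.coeff (j + 2) H = 0 := by
    intro j
    induction j with
    | zero => exact ⟨h0, h1, h2'⟩
    | succ j ih =>
      refine ⟨ih.2.1, ih.2.2, ?_⟩
      have := h3 j
      rw [ih.1, ih.2.1, ih.2.2] at this
      simp only [mul_zero, sub_zero, add_zero] at this
      exact (mul_eq_zero.1 this).resolve_left (by exact_mod_cast Nat.succ_ne_zero (j + 2))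
  ext j
  simpa using (key j).1

end Series

/-- The exponent parameters of the polynomials `A_n`. -/
abbrev halfK : ℕ → ℂ := fun _ => -1 / 2

theorem theta_zero (k : ℕ → ℂ) : theta k 0 = 1 := by
  have hx : PowerSeries.constantCoeff (genExponent k) = 0 := by
    rw [← PowerSeries.coeff_zero_eq_constantCoeff_apply, genExponent, PowerSeries.coeff_mk]
    simp
  rw [theta, PowerSeries.coeff_subst' (PowerSeries.HasSubst.of_constantCoeff_zero' hx),
    finsum_eq_single _ 0]
  · simp
  · intro d hd
    rw [PowerSeries.coeff_zero_eq_constantCoeff_apply, map_pow, hx, zero_pow hd, smul_zero]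

/-- For these parameters the `λ`-derivative of the exponent is `z + (λ² + λ⁴ + ⋯) / 2`, which `1 -
λ²` turns into a polynomial in `λ`. -/
theorem theta_ode :
    (1 - PowerSeries.X ^ 2) * PowerSeries.derivative ℂ[X] (PowerSeries.mk (theta halfK))
      = (PowerSeries.C X + PowerSeries.C 0 * PowerSeries.X
          + PowerSeries.C (C (1 / 2) - X) * PowerSeries.X ^ 2) * PowerSeries.mk (theta halfK) := by
  have hx : PowerSeries.constantCoeff (genExponent halfK) = 0 := by
    rw [← PowerSeries.coeff_zero_eq_constantCoeff_apply, genExponent, PowerSeries.coeff_mk]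
    simp
  have hG : PowerSeries.mk (theta halfK)
      = (PowerSeries.exp ℂ[X]).subst (genExponent halfK) := by
    ext1 n
    rw [PowerSeries.coeff_mk, theta]
  have hd := PowerSeries.derivative_subst (f := PowerSeries.exp ℂ[X])
    (PowerSeries.HasSubst.of_constantCoeff_zero' hx)
  rw [PowerSeries.derivative_exp, ← hG] at hd
  have hdx : ∀ m, PowerSeries.coeff m (PowerSeries.derivative ℂ[X] (genExponent halfK))
      = if m = 0 then X else if Even m then C (1 / 2) else 0 := by
    intro m
    rw [PowerSeries.coeff_derivative, genExponent, PowerSeries.coeff_mk]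
    rcases Nat.eq_zero_or_pos m with rfl | hm
    · simp
    · rw [if_neg (by omega), if_neg hm.ne']
      by_cases he : Even m
      · rw [if_pos he.add_one, if_pos he, ← C_neg]
        have : ((m : ℂ[X]) + 1) = C ((m : ℂ) + 1) := by simp
        rw [this, ← C_mul]
        congr 1
        have : (m : ℂ) + 1 ≠ 0 := by exact_mod_cast Nat.succ_ne_zero m
        push_cast
        field_simp
      · rw [if_neg he, if_neg, zero_mul]
        rwa [Nat.odd_add_one, Nat.not_odd_iff_even]
  have hode : (1 - PowerSeries.X ^ 2) * PowerSeries.derivative ℂ[X] (genExponent halfK)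
      = PowerSeries.C X + PowerSeries.C 0 * PowerSeries.X
          + PowerSeries.C (C (1 / 2) - X) * PowerSeries.X ^ 2 := by
    ext1 m
    rw [sub_mul, one_mul, map_sub, map_add, map_add, PowerSeries.coeff_C_mul,
      PowerSeries.coeff_C_mul, hdx, PowerSeries.coeff_X_pow, PowerSeries.coeff_C, zero_mul,
      PowerSeries.coeff_X_pow_mul', hdx]
    match m with
    | 0 => simp
    | 1 => simp
    | 2 => simp
    | j + 3 =>
      have : Even (j + 3) ↔ Even (j + 1) := by
        rw [show j + 3 = j + 1 + 2 by ring, Nat.even_add]; simp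
      simp [this]
  rw [hd, mul_left_comm, hode, mul_comm]

/-- The shifted polynomials `θ_m(z + 1/2)`. -/
def aSeq (m : ℕ) : ℂ[X] := (theta halfK m).comp (X + C (1 / 2))

/-- The reflected polynomials `(-1)^m θ_m(-z + 1/2)`. -/
def bSeq (m : ℕ) : ℂ[X] := (-1) ^ m * (aSeq m).comp (-X)

theorem aSeq_zero : aSeq 0 = 1 := by simp [aSeq, theta_zero]

theorem bSeq_zero : bSeq 0 = 1 := by simp [bSeq, aSeq_zero]

theorem aSeq_rec : aSeq 1 = (X + C (1 / 2)) * aSeq 0 ∧ 2 * aSeq 2 = (X + C (1 / 2)) * aSeq 1 ∧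
    ∀ j : ℕ, ((j : ℂ[X]) + 3) * aSeq (j + 3) - ((j : ℂ[X]) + 1) * aSeq (j + 1)
      = (X + C (1 / 2)) * aSeq (j + 2) - X * aSeq j := by
  obtain ⟨h0, h1, h2⟩ := (series_ode_iff _ _ _ _).1 theta_ode
  simp only [PowerSeries.coeff_mk] at h0 h1 h2
  refine ⟨?_, ?_, fun j => ?_⟩
  · have := congrArg (fun p => p.comp (X + C (1 / 2) : ℂ[X])) h0
    simpa [aSeq] using this
  · have := congrArg (fun p => p.comp (X + C (1 / 2) : ℂ[X])) h1
    simpa [aSeq] using this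
  · have := congrArg (fun p => p.comp (X + C (1 / 2) : ℂ[X])) (h2 j)
    simp only [sub_comp, mul_comp, add_comp, natCast_comp, X_comp, C_comp, ofNat_comp, one_comp,
      zero_mul, add_zero] at this
    push_cast at this
    simp only [aSeq]
    linear_combination this

theorem bSeq_rec : bSeq 1 = (X - C (1 / 2)) * bSeq 0 ∧ 2 * bSeq 2 = (X - C (1 / 2)) * bSeq 1 ∧
    ∀ j : ℕ, ((j : ℂ[X]) + 3) * bSeq (j + 3) - ((j : ℂ[X]) + 1) * bSeq (j + 1)
      = (X - C (1 / 2)) * bSeq (j + 2) - X * bSeq j := by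
  obtain ⟨h0, h1, h2⟩ := aSeq_rec
  refine ⟨?_, ?_, fun j => ?_⟩
  · have := congrArg (fun p => p.comp (-X : ℂ[X])) h0
    simp only [mul_comp, add_comp, X_comp, C_comp] at this
    simp only [bSeq, this]
    ring
  · have := congrArg (fun p => p.comp (-X : ℂ[X])) h1
    simp only [mul_comp, add_comp, X_comp, C_comp, ofNat_comp] at this
    push_cast at this
    simp only [bSeq]
    linear_combination this
  · have := congrArg (fun p => p.comp (-X : ℂ[X])) (h2 j)
    simp only [sub_comp, mul_comp, add_comp, natCast_comp, X_comp, C_comp, ofNat_comp,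
      one_comp] at this
    push_cast at this
    simp only [bSeq, pow_add]
    linear_combination -(-1) ^ j * this

/-- The generating function depends on `z` through `e^{zλ}`. The proof reads this off the recursion,
carrying three consecutive indices through the induction. -/
theorem derivative_aSeq (m : ℕ) : derivative (aSeq (m + 1)) = aSeq m := by
  obtain ⟨h0, h1, h2⟩ := aSeq_rec
  have d0 : derivative (aSeq 0) = 0 := by rw [aSeq_zero, derivative_one]
  have d1 : derivative (aSeq 1) = aSeq 0 := by
    rw [h0, derivative_mul, d0]; simp
  have d2 : derivative (aSeq 2) = aSeq 1 := by
    have := congrArg derivative h1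
    simp only [derivative_mul, d1, derivative_add, derivative_X, derivative_C,
      derivative_ofNat] at this
    have h : (2 : ℂ[X]) * (derivative (aSeq 2) - aSeq 1) = 0 := by
      linear_combination this - h0
    linear_combination (mul_eq_zero.1 h).resolve_left two_ne_zero
  have step : ∀ j : ℕ, ((j : ℂ[X]) + 3) * derivative (aSeq (j + 3))
      - ((j : ℂ[X]) + 1) * derivative (aSeq (j + 1)) = aSeq (j + 2) - aSeq j
        + (X + C (1 / 2)) * derivative (aSeq (j + 2)) - X * derivative (aSeq j) := by
    intro j
    have := congrArg derivative (h2 j)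
    simp only [derivative_sub, derivative_mul, derivative_add, derivative_X, derivative_C,
      derivative_natCast, derivative_ofNat, derivative_one] at this
    linear_combination this
  have key : ∀ j, derivative (aSeq (j + 1)) = aSeq j ∧ derivative (aSeq (j + 2)) = aSeq (j + 1)
      ∧ derivative (aSeq (j + 3)) = aSeq (j + 2) := by
    intro j
    induction j with
    | zero =>
      refine ⟨d1, d2, ?_⟩
      have := step 0
      simp only [zero_add, d1, d2, d0, Nat.cast_zero] at this
      have h : (3 : ℂ[X]) * (derivative (aSeq 3) - aSeq 2) = 0 := by
        linear_combination this - h1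
      linear_combination (mul_eq_zero.1 h).resolve_left (by exact_mod_cast Nat.succ_ne_zero 2)
    | succ j ih =>
      refine ⟨ih.2.1, ih.2.2, ?_⟩
      have := step (j + 1)
      have hr := h2 j
      simp only [add_assoc, Nat.reduceAdd] at this hr ih ⊢
      rw [ih.1, ih.2.1, ih.2.2] at this
      push_cast at this
      have h : ((j : ℂ[X]) + 4) * (derivative (aSeq (j + 4)) - aSeq (j + 3)) = 0 := by
        linear_combination this - hr
      have h4 : ((j : ℂ[X]) + 4) ≠ 0 := by exact_mod_cast Nat.succ_ne_zero (j + 3)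
      linear_combination (mul_eq_zero.1 h).resolve_left h4
  exact (key m).1

/-! ### Comparison of the shifted and the reflected sequences -/

/-- The coefficients of `√(1 - λ²)`. -/
def sqrtCoeff : ℕ → ℂ
  | 0 => 1
  | 1 => 0
  | j + 2 => (j - 1) / (j + 2) * sqrtCoeff j

theorem sqrtCoeff_odd (j : ℕ) : sqrtCoeff (2 * j + 1) = 0 := by
  induction j with
  | zero => rfl
  | succ j ih => rw [show 2 * (j + 1) + 1 = 2 * j + 1 + 2 by ring, sqrtCoeff, ih, mul_zero]

theorem sqrtCoeff_ode : (1 - PowerSeries.X ^ 2)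
      * PowerSeries.derivative ℂ[X] (PowerSeries.mk fun j => C (sqrtCoeff j))
    = (PowerSeries.C 0 + PowerSeries.C (-1) * PowerSeries.X
      + PowerSeries.C 0 * PowerSeries.X ^ 2) * PowerSeries.mk fun j => C (sqrtCoeff j) := by
  have hc : ∀ j : ℕ, ((j : ℂ) + 2) * sqrtCoeff (j + 2) = (j - 1) * sqrtCoeff j := by
    intro j
    have : (j : ℂ) + 2 ≠ 0 := by exact_mod_cast Nat.succ_ne_zero (j + 1)
    rw [sqrtCoeff]
    field_simp
  rw [series_ode_iff]
  simp only [PowerSeries.coeff_mk]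
  refine ⟨by simp [sqrtCoeff], ?_, fun j => ?_⟩
  · have := congrArg C (hc 0)
    simp only [C_mul, C_add, C_sub, map_natCast, map_ofNat, map_one] at this
    push_cast at this
    linear_combination this
  · have := congrArg C (hc (j + 1))
    simp only [C_mul, C_add, C_sub, map_natCast, map_ofNat, map_one, add_assoc,
      Nat.reduceAdd] at this
    push_cast at this
    linear_combination this

/-- `(1 - λ) ∑ a_m λ^m = √(1 - λ²) ∑ b_m λ^m`. -/
theorem one_sub_mul_aSeries : (1 - PowerSeries.X) * PowerSeries.mk aSeq
    = (PowerSeries.mk fun j => C (sqrtCoeff j)) * PowerSeries.mk bSeq := by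
  have ha : (1 - PowerSeries.X ^ 2) * PowerSeries.derivative ℂ[X] (PowerSeries.mk aSeq)
      = (PowerSeries.C (X + C (1 / 2)) + PowerSeries.C 0 * PowerSeries.X
        + PowerSeries.C (-X) * PowerSeries.X ^ 2) * PowerSeries.mk aSeq := by
    rw [series_ode_iff]
    simp only [PowerSeries.coeff_mk]
    obtain ⟨h0, h1, h2⟩ := aSeq_rec
    exact ⟨h0, by rw [h1]; ring, fun j => by rw [h2]; ring⟩
  have hb : (1 - PowerSeries.X ^ 2) * PowerSeries.derivative ℂ[X] (PowerSeries.mk bSeq)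
      = (PowerSeries.C (X - C (1 / 2)) + PowerSeries.C 0 * PowerSeries.X
        + PowerSeries.C (-X) * PowerSeries.X ^ 2) * PowerSeries.mk bSeq := by
    rw [series_ode_iff]
    simp only [PowerSeries.coeff_mk]
    obtain ⟨h0, h1, h2⟩ := bSeq_rec
    exact ⟨h0, by rw [h1]; ring, fun j => by rw [h2]; ring⟩
  have he := sqrtCoeff_ode
  rw [← sub_eq_zero]
  -- Both sides satisfy `(1 - λ²) H' = (z - 1/2 - λ - z λ²) H` and have constant term `1`.
  refine series_ode_unique (α := X - C (1 / 2)) (γ := -1) (β := -X) ?_ ?_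
  · have hhalf : PowerSeries.C (X + C (1 / 2) : ℂ[X])
        = PowerSeries.C (X - C (1 / 2)) + 1 := by
      rw [← map_one (PowerSeries.C : ℂ[X] →+* PowerSeries ℂ[X]), ← map_add]
      congr 1
      have : (C (1 / 2) : ℂ[X]) + C (1 / 2) = 1 := by rw [← C_add]; norm_num
      linear_combination this
    rw [hhalf] at ha
    generalize PowerSeries.mk aSeq = Ga at *
    generalize PowerSeries.mk bSeq = Gb at *
    generalize (PowerSeries.mk fun j => C (sqrtCoeff j)) = E at *
    generalize PowerSeries.C (X - C (1 / 2) : ℂ[X]) = α at *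
    simp only [map_sub, Derivation.leibniz, smul_eq_mul, PowerSeries.derivative_X,
      PowerSeries.derivative_one, map_zero, map_neg, map_one] at *
    linear_combination (1 - PowerSeries.X) * ha - E * hb - Gb * he
  · simp [aSeq_zero, bSeq_zero, sqrtCoeff]

theorem sum_range_two_mul {M : Type*} [AddCommMonoid M] (f : ℕ → M) (n : ℕ) :
    ∑ i ∈ Finset.range (2 * n), f i = ∑ i ∈ Finset.range n, (f (2 * i) + f (2 * i + 1)) := by
  induction n with
  | zero => simp
  | succ n ih =>
    rw [show 2 * (n + 1) = 2 * n + 1 + 1 by ring, Finset.sum_range_succ, Finset.sum_range_succ, ih,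
      Finset.sum_range_succ _ n, add_assoc]

/-- The unitriangular coefficients of `a_{2j+1} - a_{2j+1}'` in terms of `b_1, b_3, …`. -/
def mixCoeff (l j : ℕ) : ℂ := if l ≤ j then sqrtCoeff (2 * (j - l)) else 0

/-- Since differentiation lowers the index by one, the left side is the odd coefficient of `(1 - λ)
∑ a_m λ^m`. As `√(1 - λ²)` is even, only odd `b` contribute. -/
theorem aSeq_sub_derivative (j : ℕ) : aSeq (2 * j + 1) - derivative (aSeq (2 * j + 1))
    = ∑ l ∈ Finset.range (j + 1), C (mixCoeff l j) * bSeq (2 * l + 1) := by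
  have h := congrArg (PowerSeries.coeff (2 * j + 1)) one_sub_mul_aSeries
  rw [sub_mul, one_mul, map_sub, PowerSeries.coeff_succ_X_mul, PowerSeries.coeff_mul,
    Finset.Nat.sum_antidiagonal_eq_sum_range_succ
      (fun p q => PowerSeries.coeff p (PowerSeries.mk fun j => C (sqrtCoeff j))
        * PowerSeries.coeff q (PowerSeries.mk bSeq)), ← Finset.sum_range_reflect,
    show (2 * j + 1).succ = 2 * (j + 1) by omega, sum_range_two_mul] at h
  simp only [PowerSeries.coeff_mk] at h
  rw [derivative_aSeq, h]
  refine Finset.sum_congr rfl fun l hl => ?_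
  have hl : l ≤ j := Nat.lt_succ_iff.1 (Finset.mem_range.1 hl)
  rw [show 2 * (j + 1) - 1 - 2 * l = 2 * (j - l) + 1 by omega,
    show 2 * (j + 1) - 1 - (2 * l + 1) = 2 * (j - l) by omega, sqrtCoeff_odd,
    show 2 * j + 1 - 2 * (j - l) = 2 * l + 1 by omega, mixCoeff, if_pos hl]
  simp

/-- The Wronskian of the differences `a_{2j+1} - a_{2j+1}'` equals that of the `b_{2j+1}`. -/
theorem det_aSeq_sub (n : ℕ) :
    Matrix.det (Matrix.of fun i j : Fin n =>
        derivative^[(i : ℕ)] (aSeq (2 * (j : ℕ) + 1) - derivative (aSeq (2 * (j : ℕ) + 1))))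
      = Matrix.det (Matrix.of fun i j : Fin n => derivative^[(i : ℕ)] (bSeq (2 * (j : ℕ) + 1))) := by
  have hmul : (Matrix.of fun i j : Fin n =>
        derivative^[(i : ℕ)] (aSeq (2 * (j : ℕ) + 1) - derivative (aSeq (2 * (j : ℕ) + 1))))
      = (Matrix.of fun i j : Fin n => derivative^[(i : ℕ)] (bSeq (2 * (j : ℕ) + 1)))
        * (Matrix.of fun l j : Fin n => C (mixCoeff l j)) := by
    ext1 i j
    simp only [Matrix.of_apply, Matrix.mul_apply]
    rw [Fin.sum_univ_eq_sum_range
      (fun l => derivative^[(i : ℕ)] (bSeq (2 * l + 1)) * C (mixCoeff l j)) n,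
      aSeq_sub_derivative, iterate_derivative_sum]
    simp only [iterate_derivative_C_mul]
    rw [Finset.sum_subset (Finset.range_subset_range.2 (Nat.succ_le_of_lt j.2))]
    · exact Finset.sum_congr rfl fun l _ => mul_comm _ _
    · intro l _ hl
      rw [mixCoeff, if_neg (by simpa using hl)]
      simp
  rw [hmul, Matrix.det_mul, Matrix.det_of_isUpperTriangular
    (M := Matrix.of fun l j : Fin n => C (mixCoeff l j))]
  · simp [mixCoeff, sqrtCoeff]
  · intro i j hij
    have : ¬ (i : ℕ) ≤ j := not_le.2 hij
    rw [Matrix.of_apply, mixCoeff, if_neg this, C_0]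

/-! ### The Adler-Moser polynomials as Darboux transforms -/

theorem normConst_ne_zero (n : ℕ) : normConst n ≠ 0 := by
  refine Finset.prod_ne_zero_iff.2 fun j _ => pow_ne_zero _ ?_
  exact_mod_cast Nat.succ_ne_zero (2 * j)

theorem aSeq_ne_zero_and_natDegree (m : ℕ) : aSeq m ≠ 0 ∧ (aSeq m).natDegree = m := by
  induction m with
  | zero => simp [aSeq_zero]
  | succ m ih =>
    have h := derivative_aSeq m
    have hne : aSeq (m + 1) ≠ 0 := by
      intro h0
      rw [h0, derivative_zero] at h
      exact ih.1 h.symm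
    have hpos : 0 < (aSeq (m + 1)).natDegree := by
      rw [Nat.pos_iff_ne_zero]
      intro h0
      rw [derivative_of_natDegree_zero h0] at h
      exact ih.1 h.symm
    have hd := natDegree_eq_of_degree_eq_some (degree_derivative (p := aSeq (m + 1)) hpos.ne')
    rw [h, ih.2] at hd
    exact ⟨hne, by omega⟩

/-- The seed functions `θ_{2j+1}(z + 1/2)` of the Darboux transformations. -/
def seed (j : ℕ) : RatFunc ℂ := toRat (aSeq (2 * j + 1))

theorem seed_zero_deriv : (seed 0)′′ = 0 := by
  rw [seed, deriv_toRat, deriv_toRat, derivative_aSeq, aSeq_zero, derivative_one, map_zero]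

theorem seed_succ_deriv (n : ℕ) : (seed (n + 1))′′ = seed n := by
  rw [seed, deriv_toRat, deriv_toRat, derivative_aSeq, show 2 * (n + 1) = 2 * n + 1 + 1 by ring,
    derivative_aSeq, seed]

/-- Each step has the form `φ (· / φ)′`. The quotient has degree `m - 2n - 1`, and excluding the
seed indices keeps it away from zero, so differentiation lowers it by exactly one. -/
theorem crum_seed_degree (n : ℕ) : ∀ m : ℕ, (∀ j < n, m ≠ 2 * j + 1) →
    crum seed n (toRat (aSeq m)) ≠ 0 ∧ (crum seed n (toRat (aSeq m))).intDegree = m - n := by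
  induction n with
  | zero =>
    intro m _
    obtain ⟨h1, h2⟩ := aSeq_ne_zero_and_natDegree m
    exact ⟨toRat_ne_zero h1, by
      rw [crum, RatFunc.intDegree_polynomial, h2]; simp⟩
  | succ n ih =>
    intro m hm
    obtain ⟨h1, h2⟩ := ih m fun j hj => hm j (Nat.lt_succ_of_lt hj)
    obtain ⟨h3, h4⟩ := ih (2 * n + 1) fun j hj => by omega
    have hmn := hm n (Nat.lt_succ_self n)
    have h34 : crum seed n (seed n) ≠ 0 := h3
    have key : crum seed (n + 1) (toRat (aSeq m))
        = crum seed n (seed n) * (crum seed n (toRat (aSeq m)) / crum seed n (seed n))′ := by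
      rw [crum, deriv_quot h34]
      field_simp
    have hd : (crum seed n (toRat (aSeq m)) / crum seed n (seed n)).intDegree
        = (m : ℤ) - 2 * n - 1 := by
      rw [RatFunc.intDegree_div h1 h34, h2, seed, h4]
      push_cast; ring
    obtain ⟨h5, h6⟩ := intDegree_deriv (div_ne_zero h1 h34) (by rw [hd]; omega)
    rw [key]
    refine ⟨mul_ne_zero h34 h5, ?_⟩
    rw [RatFunc.intDegree_mul h34 h5, h6, hd, seed, h4]
    push_cast; ring

theorem crum_seed_ne_zero (n : ℕ) : crum seed n (seed n) ≠ 0 :=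
  (crum_seed_degree n (2 * n + 1) fun j hj => by omega).1

theorem intDegree_crum_seed (n : ℕ) : (crum seed n (seed n)).intDegree = n + 1 := by
  rw [seed, (crum_seed_degree n (2 * n + 1) fun j hj => by omega).2]
  push_cast; ring

theorem crum_seed_one_ne_zero (n : ℕ) : crum seed n 1 ≠ 0 := by
  have := (crum_seed_degree n 0 fun j hj => by omega).1
  rwa [aSeq_zero, map_one] at this

/-- The Wronskian of `θ_1(z + 1/2), θ_3(z + 1/2), …`. -/
def rawTau (n : ℕ) : ℂ[X] :=
  Matrix.det (Matrix.of fun i j : Fin n => derivative^[(i : ℕ)] (aSeq (2 * (j : ℕ) + 1)))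

theorem iterate_derivative_comp_shift (p : ℂ[X]) (c : ℂ) (i : ℕ) :
    derivative^[i] (p.comp (X + C c)) = (derivative^[i] p).comp (X + C c) := by
  induction i with
  | zero => rfl
  | succ i ih =>
    rw [Function.iterate_succ_apply', ih, derivative_comp, Function.iterate_succ_apply']
    simp

theorem A_eq (n : ℕ) : A n = C (normConst n) * rawTau n := by
  have h := RingHom.map_det (compRingHom (X + C (1 / 2) : ℂ[X]))
    (Matrix.of fun i j : Fin n => derivative^[(i : ℕ)] (theta halfK (2 * (j : ℕ) + 1)))
  rw [coe_compRingHom_apply] at h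
  rw [A, Theta, mul_comp, C_comp, h, rawTau]
  congr 2
  ext1 i j
  simp only [RingHom.mapMatrix_apply, Matrix.map_apply, Matrix.of_apply, coe_compRingHom_apply,
    aSeq]
  rw [iterate_derivative_comp_shift]

theorem toRat_iterate (p : ℂ[X]) (i : ℕ) :
    toRat (derivative^[i] p) = (fun s : RatFunc ℂ => s′)^[i] (toRat p) := by
  induction i with
  | zero => rfl
  | succ i ih => rw [Function.iterate_succ_apply', Function.iterate_succ_apply', ← ih, deriv_toRat]

theorem toRat_rawTau (n : ℕ) :
    toRat (rawTau n) = ∏ i ∈ Finset.range n, crum seed i (seed i) := by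
  rw [← wronskian_eq_prod crum_seed_ne_zero, rawTau, RingHom.map_det]
  congr 1
  ext1 i j
  simp only [RingHom.mapMatrix_apply, Matrix.map_apply, Matrix.of_apply, toRat_iterate, seed]

theorem toRat_A (n : ℕ) :
    toRat (A n) = toRat (C (normConst n)) * ∏ i ∈ Finset.range n, crum seed i (seed i) := by
  rw [A_eq, map_mul, toRat_rawTau]

theorem toRat_C_ne_zero {c : ℂ} (hc : c ≠ 0) : toRat (C c) ≠ 0 :=
  toRat_ne_zero (C_ne_zero.2 hc)

theorem toRat_A_ne_zero (n : ℕ) : toRat (A n) ≠ 0 := by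
  rw [toRat_A]
  exact mul_ne_zero (toRat_C_ne_zero (normConst_ne_zero n))
    (Finset.prod_ne_zero_iff.2 fun i _ => crum_seed_ne_zero i)

theorem A_ne_zero (n : ℕ) : A n ≠ 0 := by
  intro h
  exact toRat_A_ne_zero n (by rw [h, map_zero])

/-- `φ_n = A_{n+1} / A_n` as a rational function. -/
def phiR (n : ℕ) : RatFunc ℂ := toRat (A (n + 1)) / toRat (A n)

theorem phiR_eq (n : ℕ) :
    phiR n = toRat (C (normConst (n + 1) / normConst n)) * crum seed n (seed n) := by
  have h1 := toRat_C_ne_zero (normConst_ne_zero n)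
  rw [phiR, div_eq_iff (toRat_A_ne_zero n), toRat_A, toRat_A, Finset.prod_range_succ]
  have h2 : toRat (C (normConst (n + 1) / normConst n)) * toRat (C (normConst n))
      = toRat (C (normConst (n + 1))) := by
    rw [← map_mul, ← C_mul, div_mul_cancel₀ _ (normConst_ne_zero n)]
  rw [← h2]
  ring

theorem phiR_ne_zero (n : ℕ) : phiR n ≠ 0 :=
  div_ne_zero (toRat_A_ne_zero _) (toRat_A_ne_zero _)

theorem intDegree_phiR (n : ℕ) : (phiR n).intDegree = n + 1 := by
  have hc : normConst (n + 1) / normConst n ≠ 0 :=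
    div_ne_zero (normConst_ne_zero _) (normConst_ne_zero _)
  rw [phiR_eq, RatFunc.intDegree_mul (toRat_C_ne_zero hc) (crum_seed_ne_zero n),
    intDegree_crum_seed, RatFunc.intDegree_polynomial, natDegree_C]
  simp

theorem A_zero : A 0 = 1 := by simp [A, Theta, normConst]

theorem natDegree_A (n : ℕ) : (A n).natDegree = n * (n + 1) / 2 := by
  induction n with
  | zero => simp [A_zero]
  | succ n ih =>
    have h := intDegree_phiR n
    rw [phiR, intDegree_div_toRat (A_ne_zero _) (A_ne_zero _), ih] at h
    have h2 : (n + 1) * (n + 1 + 1) / 2 = n * (n + 1) / 2 + (n + 1) := by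
      rw [show (n + 1) * (n + 1 + 1) = n * (n + 1) + (n + 1) * 2 by ring,
        Nat.add_mul_div_right _ _ two_pos]
    omega

/-- The logarithmic derivative of `φ_n`. -/
def wR (n : ℕ) : RatFunc ℂ := crumW seed n

/-- The potential `-2 (log A_n)''`. -/
def uR (n : ℕ) : RatFunc ℂ := crumU seed n

theorem deriv_phiR (n : ℕ) : (phiR n)′ = wR n * phiR n := by
  rw [phiR_eq, leib, deriv_const, deriv_seed (crum_seed_ne_zero n), wR]
  ring

theorem riccati_wR (n : ℕ) : (wR n)′ + wR n ^ 2 = uR n :=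
  riccati crum_seed_ne_zero seed_zero_deriv seed_succ_deriv n

theorem uR_succ (n : ℕ) : uR (n + 1) = wR n ^ 2 - (wR n)′ := rfl

theorem deriv_toRat_A (n : ℕ) :
    (toRat (A n))′ = (∑ i ∈ Finset.range n, wR i) * toRat (A n) := by
  induction n with
  | zero => simp [A_zero]
  | succ n ih =>
    have h : toRat (A (n + 1)) = phiR n * toRat (A n) := by
      rw [phiR, div_mul_cancel₀ _ (toRat_A_ne_zero n)]
    rw [h, leib, ih, deriv_phiR, Finset.sum_range_succ]
    ring

/-- The logarithmic derivative of `A_n`. -/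
def logA (n : ℕ) : RatFunc ℂ := (toRat (A n))′ / toRat (A n)

theorem logA_eq (n : ℕ) : logA n = ∑ i ∈ Finset.range n, wR i := by
  rw [logA, deriv_toRat_A, mul_div_cancel_right₀ _ (toRat_A_ne_zero n)]

theorem uR_eq (n : ℕ) : uR n = -2 * (logA n)′ := by
  rw [logA_eq]
  exact crumU_eq crum_seed_ne_zero seed_zero_deriv seed_succ_deriv n

theorem wR_eq (n : ℕ) : wR n = logA (n + 1) - logA n := by
  rw [logA_eq, logA_eq, Finset.sum_range_succ, add_sub_cancel_left]

/-! ### Wave functions of the Adler-Moser chain -/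

/-- The wave function `P_n(k)` with `ψ_n = e^{kz} P_n(k)`. -/
def waveR (n : ℕ) : (RatFunc ℂ)[X] := wave wR n

theorem waveR_succ (n : ℕ) : waveR (n + 1)
    = C (wR n) * waveR n - Differential.mapCoeffs (waveR n) - X * waveR n := rfl

theorem waveR_schrodinger (n : ℕ) : Differential.mapCoeffs (Differential.mapCoeffs (waveR n))
    + 2 * X * Differential.mapCoeffs (waveR n) = C (uR n) * waveR n :=
  wave_schrodinger crum_seed_ne_zero seed_zero_deriv seed_succ_deriv n

/-- This ties the weight `φ_n⁻²` of the backward recursion to the wave function at `k = 0`. -/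
theorem exists_waveR_coeff_zero (n : ℕ) :
    ∃ c : ℂ, c ≠ 0 ∧ (waveR (n + 1)).coeff 0 * phiR n = toRat (C c) := by
  obtain ⟨c, hc⟩ := exists_const_of_deriv_eq_zero
    (deriv_seed_mul_crum_one crum_seed_ne_zero seed_zero_deriv seed_succ_deriv n)
  have h0 : c ≠ 0 := by
    rintro rfl
    rw [C_0, map_zero] at hc
    exact mul_ne_zero (crum_seed_ne_zero n) (crum_seed_one_ne_zero (n + 1)) hc
  refine ⟨(-1) ^ (n + 1) * (normConst (n + 1) / normConst n) * c,
    mul_ne_zero (mul_ne_zero (pow_ne_zero _ (by norm_num))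
      (div_ne_zero (normConst_ne_zero _) (normConst_ne_zero _))) h0, ?_⟩
  have h := wave_eval_zero seed (n + 1)
  change (waveR (n + 1)).coeff 0 = _ at h
  rw [h, phiR_eq, C_mul, map_mul, ← hc, C_mul, map_mul]
  simp only [map_pow, map_neg, map_one]
  ring

theorem det_waveR (n : ℕ) :
    Matrix.det (Matrix.of fun i j : Fin (n + 1) =>
        if (j : ℕ) < n then C (toRat (derivative^[(i : ℕ)] (aSeq (2 * (j : ℕ) + 1))))
        else (X : (RatFunc ℂ)[X]) ^ (i : ℕ))
      = (-1) ^ n * C (toRat (rawTau n)) * waveR n := by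
  rw [toRat_rawTau, waveR, ← show crumW seed = wR from rfl, ← det_wave crum_seed_ne_zero]
  congr 1
  ext1 i j
  simp only [Matrix.of_apply, toRat_iterate, seed]

/-- By `det_waveR` the product is, up to a constant, a determinant whose entries are polynomials in
`z` and `k`. So `A_n` clears all denominators of `P_n`. -/
theorem exists_waveR_poly (n : ℕ) :
    ∃ Q : ℂ[X][X], C (toRat (A n)) * waveR n = Q.map toRat := by
  refine ⟨C (C ((-1) ^ n * normConst n)) * Matrix.det (Matrix.of fun i j : Fin (n + 1) =>
    if (j : ℕ) < n then C (derivative^[(i : ℕ)] (aSeq (2 * (j : ℕ) + 1)))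
    else (X : ℂ[X][X]) ^ (i : ℕ)), ?_⟩
  have h : (Matrix.det (Matrix.of fun i j : Fin (n + 1) =>
      if (j : ℕ) < n then C (derivative^[(i : ℕ)] (aSeq (2 * (j : ℕ) + 1)))
      else (X : ℂ[X][X]) ^ (i : ℕ))).map toRat = (-1) ^ n * C (toRat (rawTau n)) * waveR n := by
    rw [← det_waveR, ← coe_mapRingHom, RingHom.map_det]
    congr 1
    ext1 i j
    simp only [RingHom.mapMatrix_apply, Matrix.map_apply, Matrix.of_apply]
    split_ifs <;> simp
  rw [Polynomial.map_mul, h, A_eq]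
  have h2 : ((-1 : (RatFunc ℂ)[X]) ^ n) * (-1) ^ n = 1 := by
    rw [← mul_pow]; simp
  simp only [map_mul, map_pow, map_neg, map_one, Polynomial.map_mul, Polynomial.map_pow,
    Polynomial.map_neg, Polynomial.map_one, Polynomial.map_C]
  linear_combination (-C (toRat (C (normConst n))) * C (toRat (rawTau n)) * waveR n) * h2

/-! ### Reflection, signs and the wave function at `k = 1` -/

theorem sign_prod (n : ℕ) :
    ((-1 : ℂ[X]) ^ (n * (n + 3) / 2)) * ∏ i : Fin n, (-1 : ℂ[X]) ^ ((i : ℕ) + 1) = (-1) ^ n := by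
  rw [Fin.prod_univ_eq_prod_range (fun i => (-1 : ℂ[X]) ^ (i + 1)) n]
  induction n with
  | zero => simp
  | succ n ih =>
    have h2 : (n + 1) * (n + 1 + 3) / 2 = n * (n + 3) / 2 + (n + 2) := by
      rw [show (n + 1) * (n + 1 + 3) = n * (n + 3) + (n + 2) * 2 by ring,
        Nat.add_mul_div_right _ _ two_pos]
    have h3 : ((-1 : ℂ[X]) ^ n) * (-1) ^ n = 1 := by
      rw [← mul_pow]; simp
    rw [Finset.prod_range_succ, h2]
    simp only [pow_add, pow_one] at ih ⊢
    linear_combination (-((-1 : ℂ[X]) ^ n * (-1) ^ n)) * ih - (-1) ^ n * h3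

theorem iterate_derivative_comp_reflect (p : ℂ[X]) (i : ℕ) :
    (derivative^[i] p).comp (-X) = (-1) ^ i * derivative^[i] (p.comp (-X)) := by
  induction i with
  | zero => simp
  | succ i ih =>
    have h := congrArg derivative ih
    have h0 : derivative ((-1 : ℂ[X]) ^ i) = 0 := by
      rw [← C_1, ← C_neg, ← C_pow, derivative_C]
    rw [derivative_comp, derivative_mul, h0] at h
    rw [Function.iterate_succ_apply', Function.iterate_succ_apply', pow_succ]
    simp only [derivative_neg, derivative_X, zero_mul, zero_add] at h
    linear_combination -h

theorem B_eq (n : ℕ) : B n = (-1) ^ n * C (normConst n) *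
    Matrix.det (Matrix.of fun i j : Fin n => derivative^[(i : ℕ)] (bSeq (2 * (j : ℕ) + 1))) := by
  have h := RingHom.map_det (compRingHom (-X : ℂ[X]))
    (Matrix.of fun i j : Fin n => derivative^[(i : ℕ)] (aSeq (2 * (j : ℕ) + 1)))
  rw [coe_compRingHom_apply] at h
  have h2 : ((compRingHom (-X : ℂ[X])).mapMatrix
      (Matrix.of fun i j : Fin n => derivative^[(i : ℕ)] (aSeq (2 * (j : ℕ) + 1))))
      = Matrix.of fun i j : Fin n => (-1 : ℂ[X]) ^ ((i : ℕ) + 1)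
        * (Matrix.of fun i j : Fin n => derivative^[(i : ℕ)] (bSeq (2 * (j : ℕ) + 1))) i j := by
    ext1 i j
    simp only [RingHom.mapMatrix_apply, Matrix.map_apply, Matrix.of_apply, coe_compRingHom_apply]
    have hodd : ((-1 : ℂ[X]) ^ (2 * (j : ℕ) + 1)) = -1 := Odd.neg_one_pow ⟨j, rfl⟩
    rw [iterate_derivative_comp_reflect, bSeq, hodd, neg_one_mul, iterate_derivative_neg]
    ring
  rw [h2, Matrix.det_mul_column] at h
  rw [B, A_eq, mul_comp, C_comp, rawTau, h]
  simp only [C_pow, C_neg, C_1]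
  linear_combination (C (normConst n) * Matrix.det (Matrix.of fun i j : Fin n =>
    derivative^[(i : ℕ)] (bSeq (2 * (j : ℕ) + 1)))) * sign_prod n

/-- A Wronskian with a last column of ones is the Wronskian of the differences `f - f'`. -/
theorem det_last_ones {R : Type*} [CommRing R] (n : ℕ) (F : ℕ → ℕ → R) :
    Matrix.det (Matrix.of fun i j : Fin (n + 1) => if (j : ℕ) < n then F i j else 1)
      = Matrix.det (Matrix.of fun i j : Fin n => F i j - F (i + 1) j) := by
  set M : Matrix (Fin (n + 1)) (Fin (n + 1)) R :=
    Matrix.of fun i j : Fin (n + 1) => if (j : ℕ) < n then F i j else 1 with hM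
  -- Subtracting from each row its predecessor turns the last column into `(1, 0, …, 0)`.
  set M' : Matrix (Fin (n + 1)) (Fin (n + 1)) R :=
    Matrix.of (Fin.cons (M 0) fun i j => M i.succ j - M i.castSucc j) with hM'
  have h1 : M.det = M'.det := by
    refine Matrix.det_eq_of_forall_row_eq_smul_add_pred (fun _ => 1) (fun j => ?_) fun i j => ?_
    · simp [hM']
    · simp [hM']
  rw [h1, Matrix.det_succ_column M' (Fin.last n), Fin.sum_univ_succ]
  have h2 : ∀ i : Fin n, M' i.succ (Fin.last n) = 0 := fun i => by simp [hM', hM]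
  have h3 : M' 0 (Fin.last n) = 1 := by simp [hM', hM]
  simp only [h2, h3, mul_zero, zero_mul, Finset.sum_const_zero, add_zero, mul_one]
  -- The rows were subtracted in the opposite order, and the resulting `(-1) ^ n` cancels the
  -- cofactor sign.
  have h4 : M'.submatrix (Fin.succAbove 0) (Fin.succAbove (Fin.last n))
      = -(Matrix.of fun i j : Fin n => F i j - F (i + 1) j) := by
    ext i j
    simp [hM', hM]
  rw [h4, Matrix.det_neg, Fintype.card_fin, ← mul_assoc, ← pow_add]
  have : Even ((0 : Fin (n + 1)) + (Fin.last n : ℕ) + n) := by simp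
  rw [this.neg_one_pow, one_mul]

/-- At `k = 1` the exponential column consists of ones, so the determinant is the Wronskian of the
differences `a - a'`. By the generating function identity this equals the Wronskian of the reflected
polynomials. -/
theorem waveR_eval_one (n : ℕ) : (waveR n).eval 1 = toRat (B n) / toRat (A n) := by
  have h := congrArg (evalRingHom (1 : RatFunc ℂ)) (det_waveR n)
  rw [RingHom.map_det] at h
  have h2 : (evalRingHom (1 : RatFunc ℂ)).mapMatrix (Matrix.of fun i j : Fin (n + 1) =>
        if (j : ℕ) < n then C (toRat (derivative^[(i : ℕ)] (aSeq (2 * (j : ℕ) + 1))))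
        else (X : (RatFunc ℂ)[X]) ^ (i : ℕ))
      = Matrix.of fun i j : Fin (n + 1) => if (j : ℕ) < n then
          (fun i j => toRat (derivative^[i] (aSeq (2 * j + 1)))) i j else 1 := by
    ext1 i j
    simp only [RingHom.mapMatrix_apply, Matrix.map_apply, Matrix.of_apply]
    split_ifs <;> simp
  have h3 : (Matrix.of fun i j : Fin n => toRat (derivative^[(i : ℕ)] (aSeq (2 * (j : ℕ) + 1)))
        - toRat (derivative^[(i : ℕ) + 1] (aSeq (2 * (j : ℕ) + 1))))
      = toRat.mapMatrix (Matrix.of fun i j : Fin n =>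
        derivative^[(i : ℕ)] (aSeq (2 * (j : ℕ) + 1) - derivative (aSeq (2 * (j : ℕ) + 1)))) := by
    ext1 i j
    simp only [RingHom.mapMatrix_apply, Matrix.map_apply, Matrix.of_apply]
    rw [iterate_derivative_sub, map_sub, Function.iterate_succ_apply]
  rw [h2, det_last_ones n (fun i j => toRat (derivative^[i] (aSeq (2 * j + 1)))), h3,
    ← RingHom.map_det, det_aSeq_sub] at h
  rw [eq_div_iff (toRat_A_ne_zero n), B_eq, map_mul, h, A_eq]
  have h4 : ((-1 : RatFunc ℂ) ^ n) * (-1) ^ n = 1 := by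
    rw [← mul_pow]; simp
  simp only [coe_evalRingHom, eval_C, map_mul, map_pow, map_neg, map_one]
  linear_combination (-toRat (C (normConst n)) * toRat (rawTau n) * (waveR n).eval 1) * h4

theorem toRat_B (n : ℕ) : toRat (B n) = (waveR n).eval 1 * toRat (A n) := by
  rw [waveR_eval_one, div_mul_cancel₀ _ (toRat_A_ne_zero n)]

theorem natDegree_B (n : ℕ) : (B n).natDegree = n * (n + 1) / 2 := by
  rw [B, natDegree_C_mul (pow_ne_zero _ (by norm_num)), natDegree_comp, natDegree_neg,
    natDegree_X, mul_one, natDegree_A]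

theorem B_eval (n : ℕ) (z : ℂ) : (B n).eval z = 0 ↔ (A n).eval (-z) = 0 := by
  simp [B]

/-! ### Exactness with a formal spectral parameter -/

/-- Polynomials in `k` whose coefficients are polynomials in `z`. -/
def polSub : Subring (RatFunc ℂ)[X] := (mapRingHom toRat).range

theorem mem_polSub {M : (RatFunc ℂ)[X]} : M ∈ polSub ↔ ∀ n, ∃ q, toRat q = M.coeff n := by
  rw [polSub, mem_map_range]; rfl

theorem C_toRat_mem (p : ℂ[X]) : C (toRat p) ∈ polSub := ⟨C p, by simp⟩

theorem X_mem_polSub : X ∈ polSub := ⟨X, by simp⟩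

theorem mapCoeffs_mem {M : (RatFunc ℂ)[X]} (h : M ∈ polSub) :
    Differential.mapCoeffs M ∈ polSub := by
  rw [mem_polSub] at h ⊢
  intro n
  obtain ⟨q, hq⟩ := h n
  exact ⟨derivative q, by rw [Differential.coeff_mapCoeffs, ← hq, deriv_toRat]⟩

/-- The operator that corresponds to `d/dz` after multiplication by `e^{2kz}`. -/
def twist (T : (RatFunc ℂ)[X]) : (RatFunc ℂ)[X] := Differential.mapCoeffs T + 2 * X * T

theorem coeff_twist_zero (T : (RatFunc ℂ)[X]) : (twist T).coeff 0 = (T.coeff 0)′ := by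
  simp [twist, mul_assoc, mul_coeff_zero]

theorem coeff_twist_succ (T : (RatFunc ℂ)[X]) (n : ℕ) :
    (twist T).coeff (n + 1) = (T.coeff (n + 1))′ + 2 * T.coeff n := by
  rw [twist, coeff_add, Differential.coeff_mapCoeffs, mul_assoc, ← C_ofNat, coeff_C_mul,
    coeff_X_mul]

theorem twist_add (S T : (RatFunc ℂ)[X]) : twist (S + T) = twist S + twist T := by
  simp only [twist, map_add]; ring

theorem twist_C_mul (c : RatFunc ℂ) (T : (RatFunc ℂ)[X]) :
    twist (C c * T) = C c * twist T + C c′ * T := by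
  simp only [twist, leibP, Differential.mapCoeffs_C]; ring

/-- `e^{2kz} M` is a derivative, up to polynomials. -/
def Exact (M : (RatFunc ℂ)[X]) : Prop := ∃ T, M - twist T ∈ polSub

theorem exact_twist (T : (RatFunc ℂ)[X]) : Exact (twist T) :=
  ⟨T, by rw [sub_self]; exact polSub.zero_mem⟩

theorem exact_of_mem {M : (RatFunc ℂ)[X]} (h : M ∈ polSub) : Exact M :=
  ⟨0, by simpa [twist] using h⟩

theorem Exact.add {M M' : (RatFunc ℂ)[X]} (h : Exact M) (h' : Exact M') : Exact (M + M') := by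
  obtain ⟨T, hT⟩ := h
  obtain ⟨T', hT'⟩ := h'
  refine ⟨T + T', ?_⟩
  rw [twist_add, add_sub_add_comm]
  exact polSub.add_mem hT hT'

theorem Exact.const_mul {M : (RatFunc ℂ)[X]} (h : Exact M) (c : ℂ) :
    Exact (C (toRat (C c)) * M) := by
  obtain ⟨T, hT⟩ := h
  refine ⟨C (toRat (C c)) * T, ?_⟩
  rw [twist_C_mul, deriv_const, C_0, zero_mul, add_zero, ← mul_sub]
  exact polSub.mul_mem (C_toRat_mem _) hT

theorem Exact.neg {M : (RatFunc ℂ)[X]} (h : Exact M) : Exact (-M) := by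
  have := h.const_mul (-1)
  simpa using this

theorem Exact.sub {M M' : (RatFunc ℂ)[X]} (h : Exact M) (h' : Exact M') : Exact (M - M') := by
  rw [sub_eq_add_neg]; exact h.add h'.neg

theorem toRat_half_mul_two : toRat (C (1 / 2)) * 2 = 1 := by
  have : (2 : RatFunc ℂ) = toRat (C 2) := by
    rw [map_ofNat C, map_ofNat]
  rw [this, ← map_mul, ← C_mul]
  norm_num

theorem Exact.of_two_mul {M : (RatFunc ℂ)[X]} (h : Exact (2 * M)) : Exact M := by
  have := h.const_mul (1 / 2)
  rwa [← mul_assoc, ← C_ofNat, ← C_mul, toRat_half_mul_two, C_1, one_mul] at this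

theorem exists_toRat_two_mul {R : RatFunc ℂ} : (∃ q, toRat q = 2 * R) ↔ ∃ q, toRat q = R := by
  constructor
  · rintro ⟨q, hq⟩
    exact ⟨C (1 / 2) * q, by rw [map_mul, hq, ← mul_assoc, toRat_half_mul_two, one_mul]⟩
  · rintro ⟨q, rfl⟩
    exact ⟨2 * q, by rw [map_mul, map_ofNat]⟩

theorem exists_toRat_deriv_iff {R : RatFunc ℂ} : (∃ q, toRat q = R′) ↔ ∃ q, toRat q = R := by
  constructor
  · rintro ⟨q, hq⟩
    obtain ⟨p, hp⟩ := exists_toRat_of_deriv hq.symm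
    exact ⟨p, hp.symm⟩
  · rintro ⟨q, rfl⟩
    exact ⟨derivative q, (deriv_toRat q).symm⟩

/-- The two lowest coefficients of `X ^ 2 * M` vanish, so those of `T` have polynomial derivatives
up to polynomials. They are therefore polynomials themselves and can be dropped before dividing `T`
by `k²`. -/
theorem Exact.of_X_sq_mul {M : (RatFunc ℂ)[X]} (h : Exact (X ^ 2 * M)) : Exact M := by
  obtain ⟨T, hT⟩ := h
  rw [mem_polSub] at hT
  have h0 : ∃ q, toRat q = T.coeff 0 := by
    have := hT 0
    rw [coeff_sub, coeff_twist_zero, mul_coeff_zero] at this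
    simp only [coeff_X_pow, OfNat.zero_ne_ofNat, if_false, zero_mul, zero_sub] at this
    rw [← exists_toRat_deriv_iff]
    obtain ⟨q, hq⟩ := this
    exact ⟨-q, by rw [map_neg, hq, neg_neg]⟩
  have h1 : ∃ q, toRat q = T.coeff 1 := by
    have := hT 1
    rw [coeff_sub, coeff_twist_succ, coeff_X_pow_mul'] at this
    simp only [Nat.not_ofNat_le_one, if_false, zero_sub, zero_add] at this
    rw [← exists_toRat_deriv_iff]
    obtain ⟨q, hq⟩ := this
    obtain ⟨p, hp⟩ := h0
    exact ⟨-q - 2 * p, by rw [map_sub, map_neg, hq, map_mul, hp, map_ofNat]; ring⟩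
  refine ⟨divX (divX T), mem_polSub.2 fun n => ?_⟩
  have hn := hT (n + 2)
  rw [coeff_sub, coeff_twist_succ, coeff_X_pow_mul] at hn
  cases n with
  | zero =>
    rw [coeff_sub, coeff_twist_zero, coeff_divX, coeff_divX]
    obtain ⟨q, hq⟩ := hn
    obtain ⟨p, hp⟩ := h1
    refine ⟨q + 2 * p, ?_⟩
    rw [map_add, hq, map_mul, hp, map_ofNat]
    ring
  | succ n =>
    rw [coeff_sub, coeff_twist_succ, coeff_divX, coeff_divX, coeff_divX, coeff_divX]
    exact hn

/-- At `k = 0` the twisted derivative is the ordinary one, and the polynomial remainder has a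
primitive. -/
theorem Exact.exists_antideriv {M : (RatFunc ℂ)[X]} (h : Exact M) : ∃ R, R′ = M.coeff 0 := by
  obtain ⟨T, hT⟩ := h
  obtain ⟨q, hq⟩ := mem_polSub.1 hT 0
  rw [coeff_sub, coeff_twist_zero] at hq
  obtain ⟨p, hp⟩ := AdlerMoser.exists_antideriv q
  exact ⟨toRat p + T.coeff 0, by rw [map_add, deriv_toRat, hp, hq]; ring⟩

/-- Descending induction on the power of `k`: above the degree of `T` the coefficients are zero, and
each coefficient is determined by the derivative of the next one, up to polynomials. -/
theorem exists_toRat_of_exact_C {F : RatFunc ℂ} (h : Exact (C F)) : ∃ q, toRat q = F := by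
  obtain ⟨T, hT⟩ := h
  rw [mem_polSub] at hT
  have hstep : ∀ n, (∃ q, toRat q = T.coeff (n + 1)) → ∃ q, toRat q = T.coeff n := by
    intro n hn
    have h1 := hT (n + 1)
    rw [coeff_sub, coeff_twist_succ, coeff_C_succ] at h1
    rw [← exists_toRat_two_mul]
    obtain ⟨p, hp⟩ := exists_toRat_deriv_iff.2 hn
    obtain ⟨q, hq⟩ := h1
    exact ⟨-q - p, by rw [map_sub, map_neg, hp, hq]; ring⟩
  have hall : ∀ j n, T.natDegree + 1 ≤ n + j → ∃ q, toRat q = T.coeff n := by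
    intro j
    induction j with
    | zero =>
      intro n hn
      exact ⟨0, by rw [map_zero, coeff_eq_zero_of_natDegree_lt (by omega)]⟩
    | succ j ih => exact fun n hn => hstep n (ih (n + 1) (by omega))
  have h0 := hT 0
  rw [coeff_sub, coeff_twist_zero, coeff_C_zero] at h0
  obtain ⟨p, hp⟩ := exists_toRat_deriv_iff.2 (hall (T.natDegree + 1) 0 (by omega))
  obtain ⟨q, hq⟩ := h0
  exact ⟨q + p, by rw [map_add, hp, hq]; ring⟩

theorem mapCoeffs_two : Differential.mapCoeffs (2 : (RatFunc ℂ)[X]) = 0 := by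
  rw [← C_ofNat, Differential.mapCoeffs_C, ← map_ofNat (algebraMap ℂ[X] (RatFunc ℂ)),
    deriv_toRat, derivative_ofNat, map_zero, C_0]

/-- The inverse Darboux transformation: with exponentials restored, `(d/dz + w_n) ψ_{n+1} = -k²
ψ_n`. This is the source of the factor `k²` in the descent. -/
theorem mapCoeffs_waveR_succ (n : ℕ) : Differential.mapCoeffs (waveR (n + 1))
    = -C (wR n) * waveR (n + 1) - X ^ 2 * waveR n - X * waveR (n + 1) := by
  have h1 := waveR_schrodinger n
  have h2 := congrArg C (riccati_wR n)
  simp only [C_add, C_pow] at h2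
  simp only [waveR_succ, map_sub, leibP, Differential.mapCoeffs_C, Differential.mapCoeffs_X]
  linear_combination -h1 + waveR n * h2

/-- The linearized Darboux transformation relates the obstructions at consecutive levels. -/
theorem twist_step {n : ℕ} {F₀ F₁ : RatFunc ℂ}
    (h : (F₁ - F₀)′ + 2 * wR n * (F₁ - F₀) + 2 * F₀′ = 0) :
    2 * (C F₁′ * waveR (n + 1) ^ 2 + X ^ 2 * (C F₀′ * waveR n ^ 2))
      = twist (C (F₁ - F₀) * (waveR (n + 1) ^ 2 - X ^ 2 * waveR n ^ 2)) := by
  have h1 := mapCoeffs_waveR_succ n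
  have h2 := waveR_succ n
  have h3 := congrArg C h
  simp only [C_add, C_mul, C_0, map_sub, map_ofNat] at h3
  have h4 : Differential.mapCoeffs (waveR n)
      = C (wR n) * waveR n - X * waveR n - waveR (n + 1) := by
    linear_combination h2
  generalize waveR (n + 1) = P1 at *
  generalize waveR n = P0 at *
  simp only [twist_C_mul]
  simp only [twist, map_sub, pow_two, leibP, Differential.mapCoeffs_X, h1, h4]
  linear_combination (P1 ^ 2 + X ^ 2 * P0 ^ 2) * h3

/-- `twist_step` makes the upper obstruction plus `k²` times the lower one exact. Subtracting the
first and dividing by `k²` leaves the lower one. -/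
theorem exact_step {n : ℕ} {F₀ F₁ : RatFunc ℂ}
    (h : (F₁ - F₀)′ + 2 * wR n * (F₁ - F₀) + 2 * F₀′ = 0)
    (hF : Exact (C F₁′ * waveR (n + 1) ^ 2)) : Exact (C F₀′ * waveR n ^ 2) := by
  refine Exact.of_X_sq_mul ?_
  have h1 : Exact (C F₁′ * waveR (n + 1) ^ 2 + X ^ 2 * (C F₀′ * waveR n ^ 2)) :=
    Exact.of_two_mul (twist_step h ▸ exact_twist _)
  have := h1.sub hF
  rwa [add_sub_cancel_left] at this

/-- Changes of the independent variable give exact variations of the potential. -/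
theorem twist_gauge (n : ℕ) (h : RatFunc ℂ) :
    2 * ((C (h * (uR n)′ + 2 * h′ * uR n) + 2 * X ^ 2 * C h′) * waveR n ^ 2)
        - C h′′′ * waveR n ^ 2
      = twist (2 * C h * (C (uR n) + X ^ 2) * waveR n ^ 2
          - 2 * C h * (Differential.mapCoeffs (waveR n) + X * waveR n) ^ 2
          + 2 * C h′ * waveR n * (Differential.mapCoeffs (waveR n) + X * waveR n)
          - C h′′ * waveR n ^ 2) := by
  have h1 := waveR_schrodinger n
  have h2 : Differential.mapCoeffs (Differential.mapCoeffs (waveR n))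
      = C (uR n) * waveR n - 2 * X * Differential.mapCoeffs (waveR n) := by
    linear_combination h1
  generalize waveR n = P at *
  simp only [twist, map_sub, map_add, pow_two, leibP, Differential.mapCoeffs_X, mapCoeffs_two,
    Differential.mapCoeffs_C, C_mul, map_ofNat, h2]
  ring

/-! ### Bilinear identities and simple roots -/

theorem eval_one_mapCoeffs (M : (RatFunc ℂ)[X]) :
    (Differential.mapCoeffs M).eval 1 = (M.eval 1)′ := by
  induction M using Polynomial.induction_on' with
  | add p q hp hq => rw [map_add, eval_add, hp, hq, eval_add, map_add]
  | monomial n c => simp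

theorem eval_one_twist (T : (RatFunc ℂ)[X]) :
    (twist T).eval 1 = (T.eval 1)′ + 2 * T.eval 1 := by
  simp only [twist, eval_add, eval_mul, eval_one_mapCoeffs, eval_X, mul_one, eval_ofNat]

theorem toRat_deriv_A (n : ℕ) : toRat (derivative (A n)) = logA n * toRat (A n) := by
  rw [logA, div_mul_cancel₀ _ (toRat_A_ne_zero n), deriv_toRat]

theorem toRat_deriv_deriv_A (n : ℕ) :
    toRat (derivative (derivative (A n))) = ((logA n)′ + logA n ^ 2) * toRat (A n) := by
  rw [← deriv_toRat, toRat_deriv_A, leib, deriv_toRat, toRat_deriv_A]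
  ring

/-- The value of the wave function at `k = 1`, that is `B_n / A_n`. -/
def waveOne (n : ℕ) : RatFunc ℂ := (waveR n).eval 1

theorem waveOne_schrodinger (n : ℕ) :
    (waveOne n)′′ + 2 * (waveOne n)′ = uR n * waveOne n := by
  have := congrArg (Polynomial.eval 1) (waveR_schrodinger n)
  simp only [eval_add, eval_mul, eval_one_mapCoeffs, eval_X, mul_one, eval_ofNat, eval_C] at this
  exact this

theorem toRat_B' (n : ℕ) : toRat (B n) = waveOne n * toRat (A n) := toRat_B n

theorem toRat_deriv_B (n : ℕ) : toRat (derivative (B n))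
    = ((waveOne n)′ + waveOne n * logA n) * toRat (A n) := by
  rw [← deriv_toRat, toRat_B', leib, deriv_toRat, toRat_deriv_A]
  ring

theorem toRat_deriv_deriv_B (n : ℕ) : toRat (derivative (derivative (B n)))
    = ((waveOne n)′′ + 2 * (waveOne n)′ * logA n + waveOne n * ((logA n)′ + logA n ^ 2))
      * toRat (A n) := by
  rw [← deriv_toRat, toRat_deriv_B]
  simp only [leib, map_add]
  rw [deriv_toRat, toRat_deriv_A]
  ring

theorem bilinear_A (n : ℕ) : derivative (derivative (A (n + 1))) * A n
    - 2 * derivative (A (n + 1)) * derivative (A n) + A (n + 1) * derivative (derivative (A n))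
      = 0 := by
  apply toRat_injective
  have h1 := riccati_wR n
  rw [uR_eq, wR_eq, map_sub] at h1
  simp only [map_add, map_sub, map_mul, map_ofNat, map_zero, toRat_deriv_A, toRat_deriv_deriv_A]
  linear_combination toRat (A n) * toRat (A (n + 1)) * h1

theorem bilinear_AB (n : ℕ) : derivative (derivative (A n)) * B n
    - 2 * derivative (A n) * derivative (B n) + A n * derivative (derivative (B n))
      - 2 * (derivative (A n) * B n - A n * derivative (B n)) = 0 := by
  apply toRat_injective
  have h1 := waveOne_schrodinger n
  rw [uR_eq] at h1
  simp only [map_add, map_sub, map_mul, map_ofNat, map_zero, toRat_deriv_A, toRat_deriv_deriv_A,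
    toRat_B', toRat_deriv_B, toRat_deriv_deriv_B]
  linear_combination toRat (A n) * toRat (A n) * h1

/-- If `p'` vanished at `a` to order `d ≥ 1`, the relation would make `p'' q`, hence `p''`, vanish
to order `d`, whereas its order is `d - 1`. -/
theorem derivative_eval_ne_zero {p q : ℂ[X]} {a : ℂ} (hp : p ≠ 0) (hpa : p.eval a = 0)
    (hqa : q.eval a ≠ 0)
    (h : derivative (derivative p) * q - 2 * derivative p * derivative q
      + p * derivative (derivative q) = 0) : (derivative p).eval a ≠ 0 := by
  intro hp'
  have h1 := derivative_rootMultiplicity_of_root (p := p) (t := a) hpa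
  have h2 := derivative_rootMultiplicity_of_root (p := derivative p) (t := a) hp'
  have hne1 : derivative p ≠ 0 := by
    intro h0
    have := eq_C_of_natDegree_eq_zero (derivative_eq_zero.1 h0)
    rw [this, eval_C] at hpa
    rw [hpa, C_0] at this
    exact hp this
  have hne2 : derivative (derivative p) ≠ 0 := by
    intro h0
    have := eq_C_of_natDegree_eq_zero (derivative_eq_zero.1 h0)
    rw [this, eval_C] at hp'
    rw [hp', C_0] at this
    exact hne1 this
  have hpos : 0 < (derivative p).rootMultiplicity a := (rootMultiplicity_pos hne1).2 hp'
  set d := (derivative p).rootMultiplicity a with hd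
  have hdvd1 : (X - C a) ^ d ∣ derivative p := pow_rootMultiplicity_dvd _ _
  have hdvd0 : (X - C a) ^ d ∣ p :=
    (pow_dvd_pow _ (by omega)).trans (pow_rootMultiplicity_dvd p a)
  have hdvd : (X - C a) ^ d ∣ derivative (derivative p) * q := by
    have : derivative (derivative p) * q
        = derivative p * (2 * derivative q) - p * derivative (derivative q) := by
      linear_combination h
    rw [this]
    exact dvd_sub (hdvd1.mul_right _) (hdvd0.mul_right _)
  have hcop : IsCoprime ((X - C a) ^ d) q := by
    refine IsCoprime.pow_left ?_
    refine (irreducible_X_sub_C a).coprime_iff_not_dvd.2 ?_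
    rwa [dvd_iff_isRoot]
  have h3 := (le_rootMultiplicity_iff hne2).2 (hcop.dvd_of_dvd_mul_right hdvd)
  omega

section BaseLevel

variable {N : ℕ}

theorem derivative_A_eval_ne_zero
    (hA : ∀ z : ℂ, ¬ ((A (N + 1)).IsRoot z ∧ (A N).IsRoot z)) {a : ℂ}
    (ha : (A (N + 1)).eval a = 0) : (derivative (A (N + 1))).eval a ≠ 0 :=
  derivative_eval_ne_zero (A_ne_zero _) ha (fun h => hA a ⟨ha, h⟩) (bilinear_A N)

theorem isCoprime_of_roots {p q : ℂ[X]} (h : ∀ a, p.eval a = 0 → q.eval a ≠ 0) :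
    IsCoprime p q := by
  rw [isCoprime_iff_aeval_ne_zero_of_isAlgClosed (k := ℂ) ℂ]
  intro a
  simp only [coe_aeval_eq_eval]
  by_cases ha : p.eval a = 0
  · exact Or.inr (h a ha)
  · exact Or.inl ha

theorem isCoprime_A_derivative
    (hA : ∀ z : ℂ, ¬ ((A (N + 1)).IsRoot z ∧ (A N).IsRoot z)) :
    IsCoprime (A (N + 1)) (derivative (A (N + 1))) :=
  isCoprime_of_roots fun _ ha => derivative_A_eval_ne_zero hA ha

/-- At a common root `a` the bilinear relation reduces to `A' B' = 0`. Simplicity of `a` forces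
`B'(a) = 0`, and by reflection `-a` would be a double root of `A`. -/
theorem isCoprime_A_B
    (hA : ∀ z : ℂ, ¬ ((A (N + 1)).IsRoot z ∧ (A N).IsRoot z)) :
    IsCoprime (A (N + 1)) (B (N + 1)) := by
  refine isCoprime_of_roots fun a ha hb => ?_
  have h := congrArg (Polynomial.eval a) (bilinear_AB (N + 1))
  simp only [eval_add, eval_sub, eval_mul, eval_ofNat, ha, hb, mul_zero, zero_mul, sub_zero,
    zero_sub, add_zero, eval_zero, neg_eq_zero, mul_eq_zero, OfNat.ofNat_ne_zero, false_or] at h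
  have hb' := h.resolve_left (derivative_A_eval_ne_zero hA ha)
  refine derivative_A_eval_ne_zero hA ((B_eval _ _).1 hb) ?_
  rw [B, derivative_C_mul, derivative_comp] at hb'
  simpa using hb'

end BaseLevel

/-! ### Exactness at the top level -/

/-- A product `G P_n²` is exact up to a term with simple poles. -/
theorem exists_residue_decomp (n : ℕ) {m l : ℂ[X]}
    (hml : m * derivative (A n) = 1 + A n * l) {G : (RatFunc ℂ)[X]} (hG : G ∈ polSub) :
    ∃ T Z : (RatFunc ℂ)[X], Z ∈ polSub ∧
      G * waveR n ^ 2 = twist T + C (toRat m) * Differential.mapCoeffs G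
        * (C (toRat (A n)) * waveR n ^ 2) + Z := by
  obtain ⟨Q, hQ⟩ : ∃ Q, Q ∈ polSub ∧ C (toRat (A n)) * waveR n = Q := by
    obtain ⟨Q, hQ⟩ := exists_waveR_poly n
    exact ⟨_, ⟨Q, rfl⟩, hQ⟩
  obtain ⟨hQm, hQ⟩ := hQ
  have ha := toRat_A_ne_zero n
  have hinv : C (toRat (A n)) * C (toRat (A n))⁻¹ = 1 := by
    rw [← C_mul, mul_inv_cancel₀ ha, C_1]
  have h1 : C (toRat m) * C (toRat (derivative (A n)))
      = 1 + C (toRat (A n)) * C (toRat l) := by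
    have := congrArg (fun p => C (toRat p)) hml
    simpa only [map_mul, map_add, map_one] using this
  have h2 : Differential.mapCoeffs (C (toRat m)) * C (toRat (derivative (A n)))
      + C (toRat m) * C (toRat (derivative (derivative (A n))))
      = C (toRat (derivative (A n))) * C (toRat l)
        + C (toRat (A n)) * Differential.mapCoeffs (C (toRat l)) := by
    have := congrArg (fun p => Differential.mapCoeffs p) h1
    simp only [map_add, leibP, Differential.mapCoeffs_C, deriv_toRat,
      Derivation.map_one_eq_zero] at this ⊢
    linear_combination this
  have hbil : C (toRat (A n)) * (Differential.mapCoeffs (Differential.mapCoeffs Q)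
      + 2 * X * Differential.mapCoeffs Q)
      = 2 * (Differential.mapCoeffs Q + X * Q) * C (toRat (derivative (A n)))
        - Q * C (toRat (derivative (derivative (A n)))) := by
    have hs := waveR_schrodinger n
    rw [uR_eq] at hs
    rw [← hQ, toRat_deriv_A, toRat_deriv_deriv_A]
    simp only [map_add, leibP, Differential.mapCoeffs_C, deriv_toRat, toRat_deriv_A, C_mul, C_pow,
      C_neg, map_ofNat] at hs ⊢
    linear_combination C (toRat (A n)) ^ 2 * hs
  have hm := C_toRat_mem m
  have hl := C_toRat_mem l
  have hA := C_toRat_mem (A n)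
  have hX := X_mem_polSub
  have hdA : Differential.mapCoeffs (C (toRat (A n))) = C (toRat (derivative (A n))) := by
    rw [Differential.mapCoeffs_C, deriv_toRat]
  have hdinv : Differential.mapCoeffs (C (toRat (A n))⁻¹)
      = -C (toRat (derivative (A n))) * C (toRat (A n))⁻¹ ^ 2 := by
    rw [Differential.mapCoeffs_C, deriv_inv' ha, deriv_toRat, ← C_neg, ← C_pow, ← C_mul]
    congr 1
    field_simp
  generalize C (toRat (A n))⁻¹ = ai at *
  generalize C (toRat (derivative (derivative (A n)))) = a2 at *
  generalize C (toRat (derivative (A n))) = a1 at *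
  generalize C (toRat (A n)) = a at *
  generalize C (toRat m) = cm at *
  generalize C (toRat l) = cl at *
  have hdm := mapCoeffs_mem hm
  have hdl := mapCoeffs_mem hl
  have hdQ := mapCoeffs_mem hQm
  have hddQ := mapCoeffs_mem hdQ
  -- With `Q = A P` the product is `G Q² / A²`. As `m` inverts `A'` modulo `A`, the twist of `-G Q²
  -- m / A` has the same double poles. The second witness is `G Q` times the quotient by `A` found
  -- in `hE`.
  refine ⟨-(G * Q ^ 2 * cm) * ai, G * Q * (cm ^ 2 * (Differential.mapCoeffs
    (Differential.mapCoeffs Q) + 2 * X * Differential.mapCoeffs Q)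
      - 2 * Differential.mapCoeffs Q * cm * cl - 2 * X * Q * cm * cl
      + Q * (cl ^ 2 + cm * Differential.mapCoeffs cl - Differential.mapCoeffs cm * cl)), ?_, ?_⟩
  · have h2m : (2 : (RatFunc ℂ)[X]) ∈ polSub := ofNat_mem polSub 2
    exact polSub.mul_mem (polSub.mul_mem hG hQm) (polSub.add_mem (polSub.sub_mem (polSub.sub_mem
      (polSub.mul_mem (polSub.pow_mem hm 2) (polSub.add_mem hddQ
        (polSub.mul_mem (polSub.mul_mem h2m hX) hdQ)))
      (polSub.mul_mem (polSub.mul_mem (polSub.mul_mem h2m hdQ) hm) hl))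
      (polSub.mul_mem (polSub.mul_mem (polSub.mul_mem (polSub.mul_mem h2m hX) hQm) hm) hl))
      (polSub.mul_mem hQm (polSub.sub_mem (polSub.add_mem (polSub.pow_mem hl 2)
        (polSub.mul_mem hm hdl)) (polSub.mul_mem hdm hl))))
  · have hP : waveR n = ai * Q := by
      rw [← hQ]; linear_combination (-waveR n) * hinv
    rw [hP]
    -- The simple poles that do not involve `G'` disappear: by the Schrödinger equation their
    -- numerator is divisible by `A`.
    have hE : 2 * Differential.mapCoeffs Q * cm + Q * Differential.mapCoeffs cm
        + 2 * X * Q * cm - Q * cl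
        = a * (cm ^ 2 * (Differential.mapCoeffs (Differential.mapCoeffs Q)
          + 2 * X * Differential.mapCoeffs Q)
        - 2 * Differential.mapCoeffs Q * cm * cl - 2 * X * Q * cm * cl
        + Q * (cl ^ 2 + cm * Differential.mapCoeffs cl - Differential.mapCoeffs cm * cl)) := by
      linear_combination (-cm ^ 2) * hbil + (-2 * (Differential.mapCoeffs Q + X * Q) * cm
        + Q * (cl - Differential.mapCoeffs cm)) * h1 + Q * cm * h2
    simp only [twist, map_neg, leibP, hdinv, pow_two Q]
    linear_combination (-G * Q ^ 2 * ai ^ 2) * h1 + ai * G * Q * hE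
      + (G * Q * (cm ^ 2 * (Differential.mapCoeffs (Differential.mapCoeffs Q)
          + 2 * X * Differential.mapCoeffs Q)
        - 2 * Differential.mapCoeffs Q * cm * cl - 2 * X * Q * cm * cl
        + Q * (cl ^ 2 + cm * Differential.mapCoeffs cl - Differential.mapCoeffs cm * cl))
        - G * Q ^ 2 * ai * cl - Differential.mapCoeffs G * cm * Q ^ 2 * ai) * hinv

/-- A rational function with simple poles at simple roots of `A` can only be of the form
`Y' + 2Y` up to polynomials if it has no poles. -/
theorem dvd_of_simple_pole {p r z : ℂ[X]} {Y : RatFunc ℂ} (hp : p ≠ 0)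
    (hsimple : ∀ a, p.eval a = 0 → (derivative p).eval a ≠ 0)
    (h : toRat r / toRat p + toRat z = Y′ + 2 * Y) : p ∣ r := by
  have h2 : (2 : RatFunc ℂ) = toRat (C 2) := by
    rw [map_ofNat C, map_ofNat]
  have hreg : ∀ a, RegAt a Y := by
    intro a
    refine regAt_of_mul_deriv 2 ?_
    rw [← h2, ← h]
    by_cases ha : p.eval a = 0
    · obtain ⟨q, hq⟩ := dvd_iff_isRoot.2 ha
      have hqa : q.eval a ≠ 0 := by
        have := hsimple a ha
        rw [hq, derivative_mul] at this
        simpa using this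
      have hq0 := toRat_ne_zero (ne_zero_of_eval hqa)
      have hx0 := toRat_ne_zero (X_sub_C_ne_zero a)
      have heq : toRat (X - C a) * (toRat r / toRat p + toRat z)
          = toRat r / toRat q + toRat ((X - C a) * z) := by
        rw [hq, map_mul, map_mul]
        field_simp
      rw [heq]
      exact RegAt.add ⟨r, q, hqa, rfl⟩ (regAt_toRat _ _)
    · exact (regAt_toRat _ _).mul (RegAt.add ⟨r, p, ha, rfl⟩ (regAt_toRat _ _))
  obtain ⟨y, rfl⟩ := exists_toRat_of_regAt hreg
  refine ⟨derivative y + C 2 * y - z, toRat_injective ?_⟩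
  rw [deriv_toRat, h2] at h
  have hp0 := toRat_ne_zero hp
  rw [map_mul, map_sub, map_add, map_mul, ← h]
  field_simp
  ring

/-- The variation of `ψ_n e^{-z} = B_n / A_n` in the direction `(ξ, η)`. -/
def topS (n : ℕ) (ξ η : ℂ[X]) : RatFunc ℂ :=
  -(toRat (B n) * toRat ξ) / toRat (A n) ^ 2 + toRat η / toRat (A n)

/-- The linearized equation, in terms of the variations of `log A_n` and of `ψ_n`. -/
theorem linearized_schrodinger {n : ℕ} {ξ η : ℂ[X]} (h : LinearizedTkachenko n ξ η) :
    (topS n ξ η)′′ + 2 * (topS n ξ η)′ - uR n * topS n ξ η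
      + 2 * (toRat ξ / toRat (A n))′′ * waveOne n = 0 := by
  have ha := toRat_A_ne_zero n
  set α := toRat ξ / toRat (A n) with hα
  set β := toRat η / toRat (A n) with hβ
  have hS : topS n ξ η = β - waveOne n * α := by
    rw [topS, toRat_B', hα, hβ]
    field_simp
    ring
  have hξ : toRat ξ = α * toRat (A n) := (div_mul_cancel₀ _ ha).symm
  have hη : toRat η = β * toRat (A n) := (div_mul_cancel₀ _ ha).symm
  have hd : ∀ (p : ℂ[X]) (γ : RatFunc ℂ), toRat p = γ * toRat (A n) →
      toRat (derivative p) = (γ′ + γ * logA n) * toRat (A n) := by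
    intro p γ hp
    rw [← deriv_toRat, hp, leib, deriv_toRat, toRat_deriv_A]
    ring
  have hξ1 := hd _ _ hξ
  have hη1 := hd _ _ hη
  have hξ2 := hd _ _ hξ1
  have hη2 := hd _ _ hη1
  simp only [map_add, leib] at hξ2 hη2
  have hw := waveOne_schrodinger n
  rw [uR_eq] at hw ⊢
  have h' := congrArg toRat h
  simp only [map_add, map_sub, map_mul, map_ofNat, map_zero, hξ, hη, hξ1, hη1, hξ2, hη2,
    toRat_deriv_A, toRat_deriv_deriv_A, toRat_B', toRat_deriv_B, toRat_deriv_deriv_B] at h'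
  have ha2 : toRat (A n) * toRat (A n) ≠ 0 := mul_ne_zero ha ha
  apply mul_left_cancel₀ ha2
  rw [hS]
  simp only [map_sub, map_add, leib]
  linear_combination h' - 2 * α * toRat (A n) * toRat (A n) * hw

/-- If the linearized equation holds at the top level, then the obstruction at `k = 1` vanishes. -/
theorem exists_antideriv_top {n : ℕ} {ξ η : ℂ[X]} (h : LinearizedTkachenko n ξ η) :
    ∃ Y : RatFunc ℂ, 2 * ((toRat ξ / toRat (A n))′′ * waveOne n ^ 2) = Y′ + 2 * Y := by
  -- The witness is the Wronskian of the wave function at `k = 1` and its variation. In its twisted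
  -- derivative the potential cancels and only the source term remains.
  refine ⟨(waveOne n)′ * topS n ξ η - waveOne n * (topS n ξ η)′, ?_⟩
  have h1 := linearized_schrodinger h
  have h2 := waveOne_schrodinger n
  simp only [map_sub, leib]
  linear_combination waveOne n * h1 - topS n ξ η * h2

/-- The change of variable along `h` absorbs the poles of the variation of the potential and leaves
a polynomial `G`. The remaining poles of `G P²` come from `G'`, whose `k²` part is a multiple of
`h''` and is made divisible by `A`. Only `G₀'` can obstruct, and as it is free of `k`, the case `k =
1` decides. -/
theorem exact_top {N : ℕ} (hA : ∀ z : ℂ, ¬ ((A (N + 1)).IsRoot z ∧ (A N).IsRoot z))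
    {ξ η : ℂ[X]} (hlin : LinearizedTkachenko (N + 1) ξ η) :
    Exact (C (toRat ξ / toRat (A (N + 1)))′′ * waveR (N + 1) ^ 2) := by
  have ha := toRat_A_ne_zero (N + 1)
  obtain ⟨l', m, hlm⟩ := isCoprime_A_derivative hA
  have hml : m * derivative (A (N + 1)) = 1 + A (N + 1) * (-l') := by linear_combination hlm
  have hcopm : IsCoprime (A (N + 1)) m := ⟨l', derivative (A (N + 1)), by linear_combination hlm⟩
  -- a vector field that moves the roots in the direction `ξ`
  set h₀ : ℂ[X] := m * ξ with hh₀
  -- Modulo `A`, `h''` is `h₀'' + 2 A'² h₂`, and `m` inverts `A'`. This choice makes `h''` divisible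
  -- by `A` without changing `h` modulo `A`.
  set h₂ : ℂ[X] := -(C (1 / 2) * m ^ 2 * derivative (derivative h₀)) with hh₂
  set h : ℂ[X] := h₀ + A (N + 1) ^ 2 * h₂ with hh
  have hhalf : (C (1 / 2) : ℂ[X]) * 2 = 1 := by
    rw [← C_ofNat, ← C_mul]; norm_num
  obtain ⟨t, ht⟩ : ∃ t, ξ = h * derivative (A (N + 1)) + A (N + 1) * t :=
    ⟨l' * ξ - A (N + 1) * h₂ * derivative (A (N + 1)), by
      rw [hh, hh₀]; linear_combination (-ξ) * hlm⟩
  obtain ⟨q, hq⟩ : ∃ q, derivative (derivative h) = A (N + 1) * q := by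
    refine ⟨2 * derivative (derivative (A (N + 1))) * h₂
      + 4 * derivative (A (N + 1)) * derivative h₂ + A (N + 1) * derivative (derivative h₂)
      + derivative (derivative h₀) * l' * (2 - A (N + 1) * l'), ?_⟩
    have h2 : derivative (derivative h) = derivative (derivative h₀)
        + 2 * derivative (A (N + 1)) ^ 2 * h₂
        + A (N + 1) * (2 * derivative (derivative (A (N + 1))) * h₂
          + 4 * derivative (A (N + 1)) * derivative h₂
          + A (N + 1) * derivative (derivative h₂)) := by
      rw [hh]
      simp only [derivative_add, derivative_mul, pow_two]
      ring
    have h3 : 2 * derivative (A (N + 1)) ^ 2 * h₂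
        = -((1 - l' * A (N + 1)) ^ 2 * derivative (derivative h₀)) := by
      rw [hh₂]
      have : m * derivative (A (N + 1)) = 1 - l' * A (N + 1) := by linear_combination hlm
      rw [← this]
      linear_combination (-(derivative (A (N + 1)) ^ 2 * m ^ 2 * derivative (derivative h₀))) * hhalf
    rw [h2, h3]
    ring
  -- the gauge-transformed variation of the potential
  set G₀ : ℂ[X] := -2 * q * derivative (A (N + 1)) - 2 * derivative (derivative t)
    + C (1 / 2) * derivative (derivative (derivative h)) with hG₀
  set G : (RatFunc ℂ)[X] := C (toRat G₀) - 2 * X ^ 2 * C (toRat (derivative h)) with hG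
  have hGmem : G ∈ polSub := polSub.sub_mem (C_toRat_mem _) (polSub.mul_mem
    (polSub.mul_mem (ofNat_mem polSub 2) (polSub.pow_mem X_mem_polSub 2)) (C_toRat_mem _))
  have hα : toRat ξ / toRat (A (N + 1)) = toRat h * logA (N + 1) + toRat t := by
    rw [ht, map_add, map_mul, map_mul, toRat_deriv_A]
    field_simp
  -- Divisibility of `h''` by `A` cancels the poles of the logarithmic derivative, so that `G₀` can
  -- be a polynomial.
  have hqL : (toRat h)′′ * logA (N + 1) = toRat (q * derivative (A (N + 1))) := by
    rw [deriv_toRat, deriv_toRat, hq, map_mul, map_mul, toRat_deriv_A]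
    ring
  have hpot : 2 * (toRat ξ / toRat (A (N + 1)))′′
      = -toRat G₀ - (toRat h * (uR (N + 1))′ + 2 * (toRat h)′ * uR (N + 1))
        + toRat (C (1 / 2)) * (toRat h)′′′ := by
    rw [hα, uR_eq, hG₀]
    have h2 : (2 : RatFunc ℂ)′ = 0 := by
      have := congrArg (Polynomial.coeff · 0) mapCoeffs_two
      simpa [← C_ofNat] using this
    simp only [map_add, map_sub, map_mul, map_neg, map_ofNat, leib, h2, ← deriv_toRat] at hqL ⊢
    linear_combination 2 * hqL
  have hdecomp : 2 * (C (toRat ξ / toRat (A (N + 1)))′′ * waveR (N + 1) ^ 2)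
      = -(G * waveR (N + 1) ^ 2)
        - C (toRat (C (1 / 2))) * twist (2 * C (toRat h) * (C (uR (N + 1)) + X ^ 2)
            * waveR (N + 1) ^ 2
          - 2 * C (toRat h) * (Differential.mapCoeffs (waveR (N + 1)) + X * waveR (N + 1)) ^ 2
          + 2 * C (toRat h)′ * waveR (N + 1)
            * (Differential.mapCoeffs (waveR (N + 1)) + X * waveR (N + 1))
          - C (toRat h)′′ * waveR (N + 1) ^ 2) := by
    rw [← twist_gauge]
    have h3 := congrArg C hpot
    have h4 := congrArg C toRat_half_mul_two
    simp only [C_mul, C_add, C_sub, C_neg, map_ofNat, C_1] at h3 h4 ⊢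
    rw [hG, ← deriv_toRat h]
    linear_combination waveR (N + 1) ^ 2 * h3 + (C (toRat h) * C (uR (N + 1))′
      + 2 * C (toRat h)′ * C (uR (N + 1)) + 2 * X ^ 2 * C (toRat h)′) * waveR (N + 1) ^ 2 * h4
  obtain ⟨T, Z, hZ, hTZ⟩ := exists_residue_decomp (N + 1) hml hGmem
  have hdG : Differential.mapCoeffs G
      = C (toRat (derivative G₀)) - 2 * X ^ 2 * C (toRat (derivative (derivative h))) := by
    rw [hG]
    simp only [map_sub, leibP, pow_two, Differential.mapCoeffs_X, mapCoeffs_two,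
      Differential.mapCoeffs_C, deriv_toRat]
    ring
  -- the residues at `k = 1` vanish
  have hdvd : A (N + 1) ∣ derivative G₀ := by
    obtain ⟨Y, hY⟩ := exists_antideriv_top hlin
    obtain ⟨T', hT'⟩ : ∃ T', 2 * (C (toRat ξ / toRat (A (N + 1)))′′ * waveR (N + 1) ^ 2)
        = -(G * waveR (N + 1) ^ 2) - C (toRat (C (1 / 2))) * twist T' := ⟨_, hdecomp⟩
    have e1 := congrArg (Polynomial.eval 1) hT'
    have e2 := congrArg (Polynomial.eval 1) hTZ
    obtain ⟨Z', rfl⟩ := hZ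
    rw [hdG] at e2
    simp only [eval_add, eval_sub, eval_neg, eval_mul, eval_pow, eval_ofNat, eval_C,
      eval_one_twist, eval_X, one_pow, mul_one] at e1 e2
    change _ = -(_ * waveOne (N + 1) ^ 2) - _ at e1
    change _ * waveOne (N + 1) ^ 2 = _ + _ * (_ * waveOne (N + 1) ^ 2) + _ at e2
    change 2 * (_ * waveOne (N + 1) ^ 2) = _ at e1
    have hz : ∃ z, toRat z = Polynomial.eval 1 ((mapRingHom toRat) Z') :=
      ⟨Z'.eval 1, by
        rw [coe_mapRingHom, ← map_one toRat, eval_map, eval₂_hom]⟩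
    obtain ⟨z, hz⟩ := hz
    rw [← hz] at e2
    -- At `k = 1` the exact terms collect into one expression `Y' + 2 Y`. What remains is a
    -- polynomial and a fraction over `A`, to which `dvd_of_simple_pole` applies.
    have key : toRat (m * (derivative G₀ - 2 * derivative (derivative h)) * B (N + 1) ^ 2)
          / toRat (A (N + 1)) + toRat z
        = (-Y - toRat (C (1 / 2)) * Polynomial.eval 1 T' - Polynomial.eval 1 T)′
          + 2 * (-Y - toRat (C (1 / 2)) * Polynomial.eval 1 T' - Polynomial.eval 1 T) := by
      have hB : toRat (m * (derivative G₀ - 2 * derivative (derivative h)) * B (N + 1) ^ 2)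
          / toRat (A (N + 1)) = toRat m * (toRat (derivative G₀)
            - 2 * toRat (derivative (derivative h)))
            * (toRat (A (N + 1)) * waveOne (N + 1) ^ 2) := by
        simp only [map_mul, map_sub, map_pow, map_ofNat, toRat_B']
        field_simp
      rw [hB]
      simp only [map_sub, map_neg, leib, deriv_const]
      linear_combination e1 - e2 - hY
    have hdvd1 := dvd_of_simple_pole (A_ne_zero _)
      (fun _ ha => derivative_A_eval_ne_zero hA ha) key
    -- `m` and `B` are invertible modulo `A`, which leaves `G₀' - 2 h''`. The second term is already
    -- divisible by `A`.
    have hdvd2 := hcopm.dvd_of_dvd_mul_left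
      ((isCoprime_A_B hA).pow_right.dvd_of_dvd_mul_right hdvd1)
    have hdvd3 : A (N + 1) ∣ 2 * derivative (derivative h) := by
      rw [hq]; exact (dvd_mul_right _ _).mul_left _
    simpa using dvd_add hdvd2 hdvd3
  obtain ⟨r, hr⟩ := hdvd
  have hexact : Exact (G * waveR (N + 1) ^ 2) := by
    rw [hTZ]
    refine Exact.add (Exact.add (exact_twist T) (exact_of_mem ?_)) (exact_of_mem hZ)
    obtain ⟨Q, hQ⟩ := exists_waveR_poly (N + 1)
    have : C (toRat m) * Differential.mapCoeffs G * (C (toRat (A (N + 1))) * waveR (N + 1) ^ 2)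
        = C (toRat m) * (C (toRat r) - 2 * X ^ 2 * C (toRat q))
          * (C (toRat (A (N + 1))) * waveR (N + 1)) ^ 2 := by
      rw [hdG, hr, hq]
      simp only [map_mul]
      ring
    rw [this, hQ]
    exact polSub.mul_mem (polSub.mul_mem (C_toRat_mem _) (polSub.sub_mem (C_toRat_mem _)
      (polSub.mul_mem (polSub.mul_mem (ofNat_mem polSub 2) (polSub.pow_mem X_mem_polSub 2))
        (C_toRat_mem _)))) (polSub.pow_mem ⟨Q, rfl⟩ 2)
  refine Exact.of_two_mul ?_
  rw [hdecomp]
  exact hexact.neg.sub ((exact_twist _).const_mul _)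

/-! ### The backward step for rational functions -/

theorem waveOne_eq (n : ℕ) : waveOne n = toRat (B n) / toRat (A n) := waveR_eval_one n

theorem deriv_waveOne (n : ℕ) : (waveOne n)′ = wR n * waveOne n - waveOne n - waveOne (n + 1) := by
  have := congrArg (Polynomial.eval 1) (waveR_succ n)
  simp only [eval_sub, eval_mul, eval_one_mapCoeffs, eval_X, one_mul, eval_C] at this
  change waveOne (n + 1) = wR n * waveOne n - (waveOne n)′ - waveOne n at this
  linear_combination this

theorem deriv_waveOne_succ (n : ℕ) :
    (waveOne (n + 1))′ = -wR n * waveOne (n + 1) - waveOne n - waveOne (n + 1) := by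
  have := congrArg (Polynomial.eval 1) (mapCoeffs_waveR_succ n)
  simp only [eval_sub, eval_mul, eval_neg, eval_pow, one_pow, eval_one_mapCoeffs, eval_X, one_mul,
    eval_C] at this
  exact this

/-- `A_0, …, A_N` do not vanish at `z`. -/
def NonRoot (N : ℕ) (z : ℂ) : Prop := ∀ m ≤ N, (A m).eval z ≠ 0

theorem regAt_phiR {N n : ℕ} (hn : n < N) {z : ℂ} (hz : NonRoot N z) : RegAt z (phiR n) :=
  ⟨_, _, hz n hn.le, rfl⟩

theorem regAt_phiR_inv {N n : ℕ} (hn : n < N) {z : ℂ} (hz : NonRoot N z) : RegAt z (phiR n)⁻¹ :=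
  ⟨_, _, hz (n + 1) hn, by rw [phiR, inv_div]⟩

theorem wR_eq_div (n : ℕ) : wR n = (phiR n)′ * (phiR n)⁻¹ := by
  rw [deriv_phiR, mul_inv_cancel_right₀ (phiR_ne_zero n)]

theorem regAt_wR {N n : ℕ} (hn : n < N) {z : ℂ} (hz : NonRoot N z) : RegAt z (wR n) := by
  rw [wR_eq_div]
  exact (regAt_phiR hn hz).deriv.mul (regAt_phiR_inv hn hz)

theorem regAt_waveOne {N n : ℕ} (hn : n ≤ N) {z : ℂ} (hz : NonRoot N z) : RegAt z (waveOne n) :=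
  ⟨_, _, hz n hn, waveOne_eq n⟩

theorem degLE_phiR (n : ℕ) : DegLE (phiR n) (n + 1) :=
  Or.inr (intDegree_phiR n).le

theorem degLE_phiR_inv (n : ℕ) : DegLE (phiR n)⁻¹ (-(n + 1)) :=
  Or.inr (by rw [RatFunc.intDegree_inv, intDegree_phiR])

theorem degLE_wR (n : ℕ) : DegLE (wR n) (-1) := by
  rw [wR_eq_div]
  exact ((degLE_phiR n).deriv.mul (degLE_phiR_inv n)).mono (by omega)

theorem degLE_waveOne (n : ℕ) : DegLE (waveOne n) 0 := by
  rw [waveOne_eq]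
  by_cases hB : B n = 0
  · simp [hB, degLE_zero]
  · exact Or.inr (by rw [intDegree_div_toRat hB (A_ne_zero n), natDegree_A, natDegree_B, sub_self])

/-- What the linearized Darboux transformation preserves on its way down. -/
structure Admissible (N n : ℕ) (F S : RatFunc ℂ) : Prop where
  deg_left : DegLE F (-1)
  deg_right : DegLE S (-1)
  reg_left : ∀ z, NonRoot N z → RegAt z F
  reg_right : ∀ z, NonRoot N z → RegAt z S
  exact : Exact (C F′ * waveR n ^ 2)
  schrodinger : S′′ + 2 * S′ - uR n * S + 2 * F′ * waveOne n = 0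

/-- The linearized Darboux system, for rational functions. -/
structure DarbouxRel (n : ℕ) (F S F₁ S₁ : RatFunc ℂ) : Prop where
  left : F′ - 2 * wR n * F + F₁′ + 2 * wR n * F₁ = 0
  right : S′ + S = wR n * S + (F₁ - F) * waveOne n - S₁

/-- Exactness at `k = 0` gives a primitive of `F₁′ P_{n+1}(0)²`, a constant multiple of `F₁′ φ_n⁻²`.
That function has degree at most `-2(n+1) - 2`, which fixes the bound for the normalized primitive.
-/
theorem exists_darboux_antideriv {n : ℕ} {F₁ : RatFunc ℂ} (hdeg : DegLE F₁ (-1))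
    (hF : Exact (C F₁′ * waveR (n + 1) ^ 2)) :
    ∃ R, R′ * phiR n ^ 2 = F₁′ ∧ DegLE R (-2 * (n + 1) - 1) := by
  obtain ⟨R₀, hR₀⟩ := hF.exists_antideriv
  obtain ⟨c, hc, hcφ⟩ := exists_waveR_coeff_zero n
  rw [coeff_C_mul, pow_two, mul_coeff_zero] at hR₀
  have hφ := phiR_ne_zero n
  have hcc : toRat (C c⁻¹) * toRat (C c) = 1 := by
    rw [← map_mul, ← C_mul, inv_mul_cancel₀ hc, C_1, map_one]
  have h1 : (toRat (C c⁻¹) ^ 2 * R₀)′ * phiR n ^ 2 = F₁′ := by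
    rw [pow_two, leib, leib, deriv_const, hR₀]
    linear_combination F₁′ * toRat (C c⁻¹) ^ 2 *
      ((waveR (n + 1)).coeff 0 * phiR n + toRat (C c)) * hcφ
      + F₁′ * (toRat (C c⁻¹) * toRat (C c) + 1) * hcc
  have h2 : (toRat (C c⁻¹) ^ 2 * R₀)′ = F₁′ * ((phiR n)⁻¹ * (phiR n)⁻¹) := by
    rw [← h1]; field_simp
  obtain ⟨R, hR, hRd⟩ := exists_degLE_antideriv (d := -2 * (n + 1) - 1)
    (R := toRat (C c⁻¹) ^ 2 * R₀) (by omega)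
    (by
      rw [h2]
      exact (hdeg.deriv.mul ((degLE_phiR_inv n).mul (degLE_phiR_inv n))).mono (by omega))
  exact ⟨R, by rw [hR, h1], hRd⟩

theorem exists_darboux_step {N n : ℕ} (hn : n < N) {F₁ S₁ : RatFunc ℂ}
    (h : Admissible N (n + 1) F₁ S₁) :
    ∃ F S, Admissible N n F S ∧ DarbouxRel n F S F₁ S₁ := by
  obtain ⟨R, hR, hRd⟩ := exists_darboux_antideriv h.deg_left h.exact
  have hφ := phiR_ne_zero n
  have h2 : (2 : RatFunc ℂ)′ = 0 := by
    have := deriv_const 2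
    rwa [C_ofNat, map_ofNat] at this
  -- `g` is the difference `F₁ - F`, the variation of `w_n`. In terms of `g`, the first Darboux
  -- equation reads `g′ = 2 w_n g + 2 F₁′`.
  obtain ⟨g, hg⟩ : ∃ g, g = 2 * (phiR n * phiR n * R) := ⟨_, rfl⟩
  have hg' : g′ = 2 * wR n * g + 2 * F₁′ := by
    rw [hg, leib, leib, leib, h2, deriv_phiR]
    linear_combination 2 * hR
  have hgd : DegLE g (-1) := by
    rw [hg, ← map_ofNat toRat 2]
    exact ((degLE_toRat _).mul (((degLE_phiR n).mul (degLE_phiR n)).mul hRd)).mono (by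
      have : (OfNat.ofNat 2 : ℂ[X]).natDegree = 0 := natDegree_ofNat 2
      omega)
  have hgr : ∀ z, NonRoot N z → RegAt z g := by
    intro z hz
    have hRz : RegAt z R := by
      refine regAt_of_deriv ?_
      have : R′ = F₁′ * ((phiR n)⁻¹ * (phiR n)⁻¹) := by rw [← hR]; field_simp
      rw [this]
      exact (h.reg_left z hz).deriv.mul ((regAt_phiR_inv hn hz).mul (regAt_phiR_inv hn hz))
    rw [hg, ← map_ofNat toRat 2]
    exact (regAt_toRat _ z).mul (((regAt_phiR hn hz).mul (regAt_phiR hn hz)).mul hRz)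
  -- This linearizes the inverse Darboux relation `deriv_waveOne_succ`, so `S` requires no
  -- integration. The Schrödinger equation at level `n + 1` then gives the second Darboux equation.
  obtain ⟨S, hS⟩ : ∃ S, S = -(S₁′ + S₁ + wR n * S₁ + g * waveOne (n + 1)) := ⟨_, rfl⟩
  have hP := deriv_waveOne n
  have hP1 := deriv_waveOne_succ n
  have hE := h.schrodinger
  rw [uR_succ] at hE
  have hS' : S′ = wR n * S + g * waveOne n - S₁ - S := by
    rw [hS]
    simp only [map_neg, map_add, leib, hP1, hg']
    linear_combination -hE
  refine ⟨F₁ - g, S, ⟨h.deg_left.sub hgd, ?_, fun z hz => (h.reg_left z hz).sub (hgr z hz), ?_,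
    exact_step ?_ h.exact, ?_⟩, ?_, ?_⟩
  · rw [hS]
    refine DegLE.neg (DegLE.add (DegLE.add (DegLE.add ?_ h.deg_right) ?_) ?_)
    · exact h.deg_right.deriv.mono (by omega)
    · exact ((degLE_wR n).mul h.deg_right).mono (by omega)
    · exact (hgd.mul (degLE_waveOne _)).mono (by omega)
  · intro z hz
    rw [hS]
    have hS₁ := h.reg_right z hz
    exact (((hS₁.deriv.add hS₁).add ((regAt_wR hn hz).mul hS₁)).add
      ((hgr z hz).mul (regAt_waveOne hn hz))).neg
  · rw [sub_sub_cancel, map_sub, hg']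
    ring
  · rw [← riccati_wR]
    simp only [map_add, map_sub, leib, hP, hg', hS']
    rw [hS]
    ring
  · rw [map_sub, hg']
    ring
  · rw [hS']
    ring

theorem admissible_top {N : ℕ} (hA : ∀ z : ℂ, ¬ ((A (N + 1)).IsRoot z ∧ (A N).IsRoot z))
    {ξ η : ℂ[X]} (hξ : ξ.degree < (A (N + 1)).degree) (hη : η.degree < (A (N + 1)).degree)
    (hlin : LinearizedTkachenko (N + 1) ξ η) :
    Admissible (N + 1) (N + 1) (toRat ξ / toRat (A (N + 1)))′ (topS (N + 1) ξ η) := by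
  have hdeg : ∀ p : ℂ[X], p.degree < (A (N + 1)).degree →
      DegLE (toRat p / toRat (A (N + 1))) (-1) := by
    intro p hp
    by_cases hp0 : p = 0
    · simp [hp0, degLE_zero]
    refine Or.inr ?_
    rw [intDegree_div_toRat hp0 (A_ne_zero _)]
    have := natDegree_lt_natDegree hp0 hp
    omega
  have hS : topS (N + 1) ξ η = -(waveOne (N + 1) * (toRat ξ / toRat (A (N + 1))))
      + toRat η / toRat (A (N + 1)) := by
    rw [topS, waveOne_eq]
    ring
  refine ⟨(hdeg ξ hξ).deriv.mono (by omega), ?_, fun z hz => RegAt.deriv ⟨_, _, hz _ le_rfl, rfl⟩,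
    ?_, exact_top hA hlin, ?_⟩
  · rw [hS]
    exact DegLE.add (((degLE_waveOne _).mul (hdeg ξ hξ)).mono (by omega)).neg (hdeg η hη)
  · intro z hz
    rw [hS]
    exact ((regAt_waveOne le_rfl hz).mul ⟨_, _, hz _ le_rfl, rfl⟩).neg.add ⟨_, _, hz _ le_rfl, rfl⟩
  · exact linearized_schrodinger hlin

theorem eq_zero_of_toRat_degLE {p : ℂ[X]} (h : DegLE (toRat p) (-1)) : toRat p = 0 := by
  rcases h with h | h
  · exact h
  · rw [RatFunc.intDegree_polynomial] at h
    omega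

/-- As `P_0 = 1`, exactness makes `F` a polynomial, and its decay at infinity kills it. What remains
for `S` is `S′′ + 2 S′ = 0`, whose rational solutions are constants. -/
theorem Admissible.eq_zero {N : ℕ} {F S : RatFunc ℂ} (h : Admissible N 0 F S) : F = 0 ∧ S = 0 := by
  have hF : F = 0 := by
    have hex := h.exact
    rw [show waveR 0 = 1 from rfl, one_pow, mul_one] at hex
    obtain ⟨q, hq⟩ := exists_toRat_of_exact_C hex
    obtain ⟨p, rfl⟩ := exists_toRat_of_deriv hq.symm
    exact eq_zero_of_toRat_degLE h.deg_left
  refine ⟨hF, ?_⟩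
  have hu : uR 0 = 0 := by
    rw [uR_eq, logA, A_zero, map_one]
    simp
  have hS := h.schrodinger
  rw [hF, hu] at hS
  have h0 : S′ = 0 := by
    refine eq_zero_of_deriv_add_mul (two_ne_zero (α := ℂ)) ?_
    rw [C_ofNat, map_ofNat]
    simpa using hS
  obtain ⟨c, rfl⟩ := exists_const_of_deriv_eq_zero h0
  exact eq_zero_of_toRat_degLE h.deg_right

/-- The rational functions behind the backward chain. -/
theorem exists_darboux_chain {N : ℕ} (hA : ∀ z : ℂ, ¬ ((A (N + 1)).IsRoot z ∧ (A N).IsRoot z))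
    {ξ η : ℂ[X]} (hξ : ξ.degree < (A (N + 1)).degree) (hη : η.degree < (A (N + 1)).degree)
    (hlin : LinearizedTkachenko (N + 1) ξ η) :
    ∃ F S : ℕ → RatFunc ℂ, F 0 = (toRat ξ / toRat (A (N + 1)))′ ∧ S 0 = topS (N + 1) ξ η ∧
      (∀ j ≤ N + 1, Admissible (N + 1) (N + 1 - j) (F j) (S j)) ∧
      ∀ j ≤ N, DarbouxRel (N - j) (F (j + 1)) (S (j + 1)) (F j) (S j) := by
  -- The hypotheses sit under the existential, with default `0` when they fail, so that `choose`
  -- yields a total map to iterate.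
  have hstep : ∀ (j : ℕ) (FS : RatFunc ℂ × RatFunc ℂ), ∃ FS' : RatFunc ℂ × RatFunc ℂ,
      j ≤ N → Admissible (N + 1) (N - j + 1) FS.1 FS.2 →
        Admissible (N + 1) (N - j) FS'.1 FS'.2 ∧ DarbouxRel (N - j) FS'.1 FS'.2 FS.1 FS.2 := by
    intro j FS
    by_cases h : j ≤ N ∧ Admissible (N + 1) (N - j + 1) FS.1 FS.2
    · obtain ⟨F, S, hFS⟩ := exists_darboux_step (by omega) h.2
      exact ⟨(F, S), fun _ _ => hFS⟩
    · exact ⟨0, fun h1 h2 => (h ⟨h1, h2⟩).elim⟩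
  choose next hnext using hstep
  let chain : ℕ → RatFunc ℂ × RatFunc ℂ := fun j =>
    Nat.rec ((toRat ξ / toRat (A (N + 1)))′, topS (N + 1) ξ η) next j
  have hadm : ∀ j ≤ N + 1, Admissible (N + 1) (N + 1 - j) (chain j).1 (chain j).2 := by
    intro j
    induction j with
    | zero => exact fun _ => admissible_top hA hξ hη hlin
    | succ j ih =>
      intro hj
      have h1 := ih (by omega)
      rw [show N + 1 - j = N - j + 1 by omega] at h1
      rw [show N + 1 - (j + 1) = N - j by omega]
      exact (hnext j (chain j) (by omega) h1).1
  refine ⟨fun j => (chain j).1, fun j => (chain j).2, rfl, rfl, hadm, fun j hj => ?_⟩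
  have h1 := hadm j (by omega)
  rw [show N + 1 - j = N - j + 1 by omega] at h1
  exact (hnext j (chain j) hj h1).2

/-! ### Integrals along horizontal half-lines -/

/-- A root `a` lies on the half-line ending at `z` exactly when `a - z` is outside
`Complex.slitPlane`. The set is thus a finite intersection of preimages of that open set. -/
theorem isOpen_slitPlane (N : ℕ) : IsOpen (slitPlane N) := by
  have h : slitPlane N = ⋂ n ∈ Set.Iic N, ⋂ a ∈ {a | (A n).IsRoot a},
      (fun z => a - z) ⁻¹' Complex.slitPlane := by
    ext z
    simp only [slitPlane, Set.mem_ofPred_eq, Set.mem_iInter, Set.mem_Iic, Set.mem_preimage,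
      Complex.mem_slitPlane_iff, Complex.sub_re, Complex.sub_im]
    refine forall₂_congr fun n _ => ⟨fun h a ha => ?_, fun h t ht h0 => ?_⟩
    · by_contra! hc
      refine h (a.re - z.re) hc.1 ?_
      have : z + ((a.re - z.re : ℝ) : ℂ) = a := by
        apply Complex.ext
        · simp
        · simp only [Complex.add_im, Complex.ofReal_im, add_zero]; linarith [hc.2]
      rw [this]
      exact ha
    · have := h _ h0
      simp only [Complex.add_re, Complex.ofReal_re, Complex.add_im, Complex.ofReal_im] at this
      rcases this with h1 | h1
      · linarith
      · exact h1 (by ring)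
  rw [h]
  refine (Set.finite_Iic N).isOpen_biInter fun n _ => Set.Finite.isOpen_biInter ?_ fun a _ =>
    Complex.isOpen_slitPlane.preimage (by fun_prop)
  exact finite_setOfPred_isRoot (A_ne_zero n)

theorem add_mem_slitPlane {N : ℕ} {z : ℂ} (hz : z ∈ slitPlane N) {t : ℝ} (ht : t ≤ 0) :
    z + t ∈ slitPlane N := by
  intro n hn s hs
  rw [add_assoc, ← Complex.ofReal_add]
  exact hz n hn _ (by linarith)

theorem nonRoot_of_mem {N : ℕ} {z : ℂ} (hz : z ∈ slitPlane N) : NonRoot N z := by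
  intro n hn
  simpa using hz n hn 0 le_rfl

theorem tendsto_ray (z : ℂ) :
    Filter.Tendsto (fun t : ℝ => z + (t : ℂ)) Filter.atBot (Bornology.cobounded ℂ) := by
  rw [← tendsto_norm_atTop_iff_cobounded]
  refine Filter.tendsto_atTop_mono (f := fun t : ℝ => |t| - ‖z‖) (fun t => ?_)
    (Filter.tendsto_atTop_add_const_right _ _ Filter.tendsto_abs_atBot_atTop)
  have := norm_sub_norm_le (t : ℂ) (-z)
  rw [norm_neg, sub_neg_eq_add, Complex.norm_real, Real.norm_eq_abs, add_comm (t : ℂ)] at this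
  exact this

/-- A rational function of degree at most `-d` is `O(t ^ (-d))` along a horizontal half-line. -/
theorem isBigO_val {R : RatFunc ℂ} {d : ℕ} (hR : DegLE R (-d)) (z : ℂ) :
    (fun t : ℝ => val R (z + t) * (t : ℂ) ^ d) =O[Filter.atBot] (fun _ => (1 : ℂ)) := by
  rcases hR with rfl | hR
  · have : ∀ a, val 0 a = 0 := fun a => by rw [← map_zero toRat, val_toRat, eval_zero]
    simp only [this, zero_mul]
    exact Asymptotics.isBigO_zero _ _
  obtain ⟨p, q, hq, rfl⟩ := exists_rep R
  by_cases hp : p = 0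
  · have : ∀ a, val (toRat p / toRat q) a = 0 := fun a => by
      rw [hp, map_zero, zero_div, ← map_zero toRat, val_toRat, eval_zero]
    simp only [this, zero_mul]
    exact Asymptotics.isBigO_zero _ _
  rw [intDegree_div_toRat hp hq] at hR
  -- On the half-line `X - z` takes the value `t`, so the power of `t` is absorbed into the
  -- numerator.
  have hdeg : (p * (X - C z) ^ d).degree ≤ q.degree := by
    have hm := (monic_X_sub_C z).pow d
    rw [degree_le_iff_coeff_zero]
    intro n hn
    refine coeff_eq_zero_of_natDegree_lt ?_
    rw [natDegree_mul hp hm.ne_zero, natDegree_pow, natDegree_X_sub_C, mul_one]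
    have := (natDegree_lt_iff_degree_lt hq).2 hn
    omega
  have h1 := (isBigO_cobounded_of_degree_le hdeg).comp_tendsto (tendsto_ray z)
  have h2 : ∀ᶠ a in Bornology.cobounded ℂ, q.eval a ≠ 0 := by
    have := Set.Finite.isBounded (finite_setOfPred_isRoot hq)
    filter_upwards [Bornology.isBounded_def.1 this] with a ha
    exact ha
  have h3 := (h1.mul (Asymptotics.isBigO_refl
    (fun t : ℝ => (q.eval (z + t))⁻¹) Filter.atBot))
  refine h3.congr' ?_ ?_
  · filter_upwards [(tendsto_ray z).eventually h2] with t ht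
    simp only [Function.comp, eval_mul, eval_pow, eval_sub, eval_X, eval_C, add_sub_cancel_left]
    rw [val_div ht, div_eq_mul_inv]
    ring
  · filter_upwards [(tendsto_ray z).eventually h2] with t ht
    simp only [Function.comp]
    rw [mul_inv_cancel₀ ht]

theorem isBigO_val_const {R : RatFunc ℂ} (hR : DegLE R 0) (z : ℂ) :
    (fun t : ℝ => val R (z + t)) =O[Filter.atBot] (fun _ => (1 : ℂ)) := by
  simpa using isBigO_val (d := 0) (by simpa using hR) z

theorem tendsto_val {R : RatFunc ℂ} (hR : DegLE R (-1)) (z : ℂ) :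
    Filter.Tendsto (fun t : ℝ => val R (z + t)) Filter.atBot (nhds 0) := by
  have h := isBigO_val (d := 1) (by simpa using hR) z
  have h1 := h.mul (Asymptotics.isBigO_refl (fun t : ℝ => ((t⁻¹ : ℝ) : ℂ)) Filter.atBot)
  refine (h1.congr' ?_ (g₂ := fun t : ℝ => ((t⁻¹ : ℝ) : ℂ)) ?_).trans_tendsto ?_
  · filter_upwards [Filter.eventually_lt_atBot 0] with t ht
    have : (t : ℂ) ≠ 0 := by exact_mod_cast ht.ne
    push_cast
    field_simp
  · exact Filter.Eventually.of_forall fun t => one_mul _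
  · simpa using (tendsto_inv_atBot_zero (𝕜 := ℝ)).ofReal

theorem hasDerivAt_comp_ray {H : ℂ → ℂ} {h' z : ℂ} {t : ℝ} (h : HasDerivAt H h' (z + t)) :
    HasDerivAt (fun t : ℝ => H (z + t)) h' t :=
  (HasDerivAt.comp_const_add z (t : ℂ) h).comp_ofReal

/-- The decay at `-∞` singles out one primitive, so exhibiting a decaying primitive evaluates the
integral. -/
theorem rayIntegral_eq {h H : ℂ → ℂ} {z : ℂ}
    (hH : ∀ t : ℝ, t ≤ 0 → HasDerivAt H (h (z + t)) (z + t)) (hint : RayIntegrable h z)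
    (hlim : Filter.Tendsto (fun t : ℝ => H (z + t)) Filter.atBot (nhds 0)) :
    rayIntegral h z = H z := by
  have := MeasureTheory.integral_Iic_of_hasDerivAt_of_tendsto' (a := (0 : ℝ))
    (fun t ht => hasDerivAt_comp_ray (hH t ht)) hint hlim
  rw [rayIntegral, this]
  simp

theorem continuousOn_val_ray {R : RatFunc ℂ} {z : ℂ}
    (hR : ∀ t : ℝ, t ≤ 0 → RegAt (z + t) R) :
    ContinuousOn (fun t : ℝ => val R (z + t)) (Set.Iic 0) :=
  fun t ht => (hasDerivAt_comp_ray (hR t ht).hasDerivAt).continuousAt.continuousWithinAt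

theorem rayIntegrable_val {R : RatFunc ℂ} {z : ℂ} (hdeg : DegLE R (-2))
    (hR : ∀ t : ℝ, t ≤ 0 → RegAt (z + t) R) : RayIntegrable (val R) z := by
  have h0 := isBigO_val_const (hdeg.mono (by norm_num)) z
  have h2 := isBigO_val (d := 2) (by simpa using hdeg) z
  -- Boundedness of both `R` and `t² R` gives the bound `(1 + t²)⁻¹`, which is integrable on the
  -- whole line.
  have h3 := (h0.add h2).mul (Asymptotics.isBigO_refl
    (fun t : ℝ => (((1 + t ^ 2)⁻¹ : ℝ) : ℂ)) Filter.atBot)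
  refine MeasureTheory.LocallyIntegrableOn.integrableOn_of_isBigO_atBot
    ((continuousOn_val_ray hR).locallyIntegrableOn measurableSet_Iic)
    (g := fun t : ℝ => (((1 + t ^ 2)⁻¹ : ℝ) : ℂ)) (h3.congr (fun t => ?_) (fun t => ?_)) ?_
  · have : (1 + (t : ℂ) ^ 2) ≠ 0 := by
      have : (1 + t ^ 2 : ℝ) ≠ 0 := by positivity
      exact_mod_cast this
    push_cast
    field_simp
  · rw [one_mul]
  · exact ((integrable_inv_one_add_sq.ofReal).integrableAtFilter _)

theorem isBigO_exp_ray (z : ℂ) : (fun t : ℝ => Complex.exp (z + t)) =O[Filter.atBot] Real.exp :=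
  Asymptotics.IsBigO.of_bound (Real.exp z.re) (Filter.Eventually.of_forall fun t => by
    rw [Complex.norm_exp, Complex.add_re, Complex.ofReal_re, Real.exp_add, Real.norm_eq_abs,
      Real.abs_exp])

theorem isBigO_exp_mul_val {R : RatFunc ℂ} {z : ℂ} (hdeg : DegLE R 0) :
    (fun t : ℝ => Complex.exp (z + t) * val R (z + t)) =O[Filter.atBot] Real.exp := by
  have h := (isBigO_exp_ray z).mul ((isBigO_val_const hdeg z).trans
    (Asymptotics.isBigO_const_const (1 : ℂ) (one_ne_zero (α := ℝ)) _))
  simpa using h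

theorem hasDerivAt_exp_mul_val {R : RatFunc ℂ} {z : ℂ} (hR : RegAt z R) :
    HasDerivAt (fun z => Complex.exp z * val R z) (Complex.exp z * val (R′ + R) z) z := by
  refine ((Complex.hasDerivAt_exp z).mul hR.hasDerivAt).congr_deriv ?_
  rw [val_add hR.deriv hR]
  ring

theorem rayIntegrable_exp_mul_val {R : RatFunc ℂ} {z : ℂ} (hdeg : DegLE R 0)
    (hR : ∀ t : ℝ, t ≤ 0 → RegAt (z + t) R) :
    RayIntegrable (fun z => Complex.exp z * val R z) z := by
  refine MeasureTheory.LocallyIntegrableOn.integrableOn_of_isBigO_atBot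
    (ContinuousOn.locallyIntegrableOn (fun t ht => ?_) measurableSet_Iic)
    (isBigO_exp_mul_val hdeg) ⟨_, Filter.Iic_mem_atBot 0, integrableOn_exp_Iic 0⟩
  exact (hasDerivAt_comp_ray (hasDerivAt_exp_mul_val
    (hR t ht))).continuousAt.continuousWithinAt

theorem RayIntegrable.congr {g h : ℂ → ℂ} {z : ℂ} (hg : RayIntegrable g z)
    (heq : ∀ t : ℝ, t ≤ 0 → h (z + t) = g (z + t)) : RayIntegrable h z :=
  MeasureTheory.IntegrableOn.congr_fun hg (fun t ht => (heq t ht).symm) measurableSet_Iic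

theorem rayIntegral_congr {g h : ℂ → ℂ} {z : ℂ}
    (heq : ∀ t : ℝ, t ≤ 0 → h (z + t) = g (z + t)) : rayIntegral h z = rayIntegral g z :=
  MeasureTheory.setIntegral_congr_fun measurableSet_Iic heq

/-! ### The backward recursion in terms of rational functions -/

section Step

variable {N n : ℕ} {z : ℂ}

theorem phi_ne_zero (hn : n < N) (hz : NonRoot N z) : phi n z ≠ 0 :=
  div_ne_zero (hz _ hn) (hz _ hn.le)

theorem val_phiR_inv (hn : n < N) (hz : NonRoot N z) : val (phiR n)⁻¹ z = (phi n z)⁻¹ := by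
  rw [phiR, phi, inv_div, inv_div, val_div (hz _ hn)]

theorem logDeriv_phi (hn : n < N) (hz : NonRoot N z) : logDeriv (phi n) z = val (wR n) z := by
  have h1 := (regAt_phiR hn hz).hasDerivAt
  have h2 : phi n =ᶠ[nhds z] val (phiR n) := by
    filter_upwards [((A n).continuous.continuousAt (x := z)).eventually_ne (hz n hn.le)] with y hy
    exact (val_div hy).symm
  rw [logDeriv_apply, (h1.congr_of_eventuallyEq h2).deriv, wR_eq_div,
    val_mul (regAt_phiR hn hz).deriv (regAt_phiR_inv hn hz), val_phiR_inv hn hz, div_eq_mul_inv]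

theorem psi_eq (hn : n ≤ N) (hz : NonRoot N z) : psi n z = val (waveOne n) z * Complex.exp z := by
  rw [psi, waveOne_eq, val_div (hz n hn)]

variable {F S F₁ S₁ : RatFunc ℂ} {f f₁ σ₁ : ℂ → ℂ}

theorem hasDerivAt_of_eqOn_slitPlane {g h : ℂ → ℂ} {h' : ℂ} (hgh : ∀ z ∈ slitPlane N, g z = h z)
    (hz : z ∈ slitPlane N) (hh : HasDerivAt h h' z) : HasDerivAt g h' z :=
  hh.congr_of_eventuallyEq (by
    filter_upwards [(isOpen_slitPlane N).mem_nhds hz] with y hy using hgh y hy)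

theorem integrandF_eq (hn : n < N) (h₁ : Admissible N (n + 1) F₁ S₁)
    (hf₁ : ∀ z ∈ slitPlane N, f₁ z = val F₁ z) (hz : z ∈ slitPlane N) :
    integrandF n f₁ z
      = val ((phiR n)⁻¹ * (phiR n)⁻¹ * (F₁′ + (wR n * F₁ + wR n * F₁))) z := by
  have hz' := nonRoot_of_mem hz
  have hF := h₁.reg_left z hz'
  have hφ := regAt_phiR_inv hn hz'
  have hw := regAt_wR hn hz'
  rw [integrandF, (hasDerivAt_of_eqOn_slitPlane hf₁ hz hF.hasDerivAt).deriv, logDeriv_phi hn hz',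
    hf₁ z hz, val_mul (hφ.mul hφ) (hF.deriv.add ((hw.mul hF).add (hw.mul hF))), val_mul hφ hφ,
    val_add hF.deriv ((hw.mul hF).add (hw.mul hF)), val_add (hw.mul hF) (hw.mul hF),
    val_mul hw hF, val_phiR_inv hn hz', pow_two, mul_inv]
  ring

theorem deriv_inv_phiR (n : ℕ) : ((phiR n)⁻¹)′ = -(wR n * (phiR n)⁻¹) := by
  rw [deriv_inv' (phiR_ne_zero n), deriv_phiR]
  have := phiR_ne_zero n
  field_simp

theorem rayIntegrable_integrandF (hn : n < N) (h₁ : Admissible N (n + 1) F₁ S₁)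
    (hf₁ : ∀ z ∈ slitPlane N, f₁ z = val F₁ z) (hz : z ∈ slitPlane N) :
    RayIntegrable (integrandF n f₁) z := by
  refine (rayIntegrable_val ?_ fun t ht => ?_).congr fun t ht =>
    integrandF_eq hn h₁ hf₁ (add_mem_slitPlane hz ht)
  · have hwF : DegLE (wR n * F₁) (-2) := (degLE_wR n).mul h₁.deg_left
    exact (((degLE_phiR_inv n).mul (degLE_phiR_inv n)).mul
      ((h₁.deg_left.deriv.mono (by norm_num)).add (hwF.add hwF))).mono (by omega)
  · have hz' := nonRoot_of_mem (add_mem_slitPlane hz ht)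
    have hF := h₁.reg_left _ hz'
    have hφ := regAt_phiR_inv hn hz'
    have hw := regAt_wR hn hz'
    exact (hφ.mul hφ).mul (hF.deriv.add ((hw.mul hF).add (hw.mul hF)))

/-- By the first Darboux equation `-φ_n⁻² F` is a primitive of the integrand, and its negative
degree makes it vanish at `-∞`. -/
theorem backF_eq (hn : n < N) (h : Admissible N n F S) (h₁ : Admissible N (n + 1) F₁ S₁)
    (hrel : DarbouxRel n F S F₁ S₁)
    (hf₁ : ∀ z ∈ slitPlane N, f₁ z = val F₁ z) (hz : z ∈ slitPlane N) :
    backF n f₁ z = val F z := by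
  have hz' := nonRoot_of_mem hz
  have hφ := regAt_phiR_inv hn hz'
  have hint := rayIntegral_eq (h := integrandF n f₁) (H := val (-((phiR n)⁻¹ * (phiR n)⁻¹ * F)))
    (z := z) (fun t ht => ?_) (rayIntegrable_integrandF hn h₁ hf₁ hz) (tendsto_val ?_ z)
  · rw [backF, hint, val_neg ((hφ.mul hφ).mul (h.reg_left z hz')),
      val_mul (hφ.mul hφ) (h.reg_left z hz'), val_mul hφ hφ, val_phiR_inv hn hz']
    have := phi_ne_zero hn hz'
    field_simp
  · have hzt := add_mem_slitPlane hz ht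
    have hzt' := nonRoot_of_mem hzt
    have hφt := regAt_phiR_inv hn hzt'
    refine ((hφt.mul hφt).mul (h.reg_left _ hzt')).neg.hasDerivAt.congr_deriv ?_
    rw [integrandF_eq hn h₁ hf₁ hzt]
    congr 1
    simp only [map_neg, leib, deriv_inv_phiR]
    linear_combination (-((phiR n)⁻¹ * (phiR n)⁻¹)) * hrel.left
  · exact (((degLE_phiR_inv n).mul (degLE_phiR_inv n)).mul h.deg_left).neg.mono (by omega)

theorem integrandSigma_eq (hn : n < N) (h : Admissible N n F S) (h₁ : Admissible N (n + 1) F₁ S₁)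
    (hf₁ : ∀ z ∈ slitPlane N, f₁ z = val F₁ z) (hf : ∀ z ∈ slitPlane N, f z = val F z)
    (hσ₁ : ∀ z ∈ slitPlane N, σ₁ z = Complex.exp z * val S₁ z) (hz : z ∈ slitPlane N) :
    integrandSigma n f₁ f σ₁ z
      = Complex.exp z * val ((phiR n)⁻¹ * (waveOne n * (F₁ - F) - S₁)) z := by
  have hz' := nonRoot_of_mem hz
  have hF := h.reg_left z hz'
  have hF₁ := h₁.reg_left z hz'
  have hS₁ := h₁.reg_right z hz'
  have hφ := regAt_phiR_inv hn hz'
  have hP := regAt_waveOne hn.le hz'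
  rw [integrandSigma, hf₁ z hz, hf z hz, hσ₁ z hz, psi_eq hn.le hz',
    val_mul hφ ((hP.mul (hF₁.sub hF)).sub hS₁), val_sub (hP.mul (hF₁.sub hF)) hS₁,
    val_mul hP (hF₁.sub hF), val_sub hF₁ hF, val_phiR_inv hn hz']
  ring

theorem rayIntegrable_integrandSigma (hn : n < N) (h : Admissible N n F S)
    (h₁ : Admissible N (n + 1) F₁ S₁)
    (hf₁ : ∀ z ∈ slitPlane N, f₁ z = val F₁ z) (hf : ∀ z ∈ slitPlane N, f z = val F z)
    (hσ₁ : ∀ z ∈ slitPlane N, σ₁ z = Complex.exp z * val S₁ z) (hz : z ∈ slitPlane N) :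
    RayIntegrable (integrandSigma n f₁ f σ₁) z := by
  refine (rayIntegrable_exp_mul_val ?_ fun t ht => ?_).congr fun t ht =>
    integrandSigma_eq hn h h₁ hf₁ hf hσ₁ (add_mem_slitPlane hz ht)
  · exact ((degLE_phiR_inv n).mul ((((degLE_waveOne n).mul (h₁.deg_left.sub h.deg_left)).mono
      (by norm_num)).sub h₁.deg_right)).mono (by omega)
  · have hz' := nonRoot_of_mem (add_mem_slitPlane hz ht)
    exact (regAt_phiR_inv hn hz').mul (((regAt_waveOne hn.le hz').mul
      ((h₁.reg_left _ hz').sub (h.reg_left _ hz'))).sub (h₁.reg_right _ hz'))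

/-- By the second Darboux equation `e^z φ_n⁻¹ S` is a primitive of the integrand, and the
exponential makes it decay at `-∞`. -/
theorem backSigma_eq (hn : n < N) (h : Admissible N n F S) (h₁ : Admissible N (n + 1) F₁ S₁)
    (hrel : DarbouxRel n F S F₁ S₁)
    (hf₁ : ∀ z ∈ slitPlane N, f₁ z = val F₁ z) (hf : ∀ z ∈ slitPlane N, f z = val F z)
    (hσ₁ : ∀ z ∈ slitPlane N, σ₁ z = Complex.exp z * val S₁ z) (hz : z ∈ slitPlane N) :
    backSigma n f₁ f σ₁ z = Complex.exp z * val S z := by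
  have hz' := nonRoot_of_mem hz
  have hφ := regAt_phiR_inv hn hz'
  have hint := rayIntegral_eq (h := integrandSigma n f₁ f σ₁)
    (H := fun z => Complex.exp z * val ((phiR n)⁻¹ * S) z)
    (z := z) (fun t ht => ?_) (rayIntegrable_integrandSigma hn h h₁ hf₁ hf hσ₁ hz)
    ((isBigO_exp_mul_val ?_).trans_tendsto Real.tendsto_exp_atBot)
  · rw [backSigma, hint, val_mul hφ (h.reg_right z hz'), val_phiR_inv hn hz']
    have := phi_ne_zero hn hz'
    field_simp
  · have hzt := add_mem_slitPlane hz ht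
    have hzt' := nonRoot_of_mem hzt
    refine (hasDerivAt_exp_mul_val
      ((regAt_phiR_inv hn hzt').mul (h.reg_right _ hzt'))).congr_deriv ?_
    rw [integrandSigma_eq hn h h₁ hf₁ hf hσ₁ hzt]
    congr 2
    simp only [leib, deriv_inv_phiR]
    linear_combination (phiR n)⁻¹ * hrel.right
  · exact ((degLE_phiR_inv n).mul h.deg_right).mono (by omega)

theorem hasDerivAt_left (hn : n < N) (h : Admissible N n F S) (h₁ : Admissible N (n + 1) F₁ S₁)
    (hrel : DarbouxRel n F S F₁ S₁)
    (hf₁ : ∀ z ∈ slitPlane N, f₁ z = val F₁ z) (hf : ∀ z ∈ slitPlane N, f z = val F z)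
    (hz : z ∈ slitPlane N) :
    HasDerivAt f (2 * logDeriv (phi n) z * f z - deriv f₁ z
      - 2 * logDeriv (phi n) z * f₁ z) z := by
  have hz' := nonRoot_of_mem hz
  have hF := h.reg_left z hz'
  have hF₁ := h₁.reg_left z hz'
  have hw := regAt_wR hn hz'
  refine (hasDerivAt_of_eqOn_slitPlane hf hz hF.hasDerivAt).congr_deriv ?_
  rw [(hasDerivAt_of_eqOn_slitPlane hf₁ hz hF₁.hasDerivAt).deriv, logDeriv_phi hn hz',
    hf z hz, hf₁ z hz]
  have hFd : F′ = (wR n * F + wR n * F) - F₁′ - (wR n * F₁ + wR n * F₁) := by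
    linear_combination hrel.left
  rw [hFd, val_sub (((hw.mul hF).add (hw.mul hF)).sub hF₁.deriv) ((hw.mul hF₁).add (hw.mul hF₁)),
    val_sub ((hw.mul hF).add (hw.mul hF)) hF₁.deriv, val_add (hw.mul hF) (hw.mul hF),
    val_add (hw.mul hF₁) (hw.mul hF₁), val_mul hw hF, val_mul hw hF₁]
  ring

theorem hasDerivAt_right {σ : ℂ → ℂ} (hn : n < N) (h : Admissible N n F S)
    (h₁ : Admissible N (n + 1) F₁ S₁) (hrel : DarbouxRel n F S F₁ S₁)
    (hf₁ : ∀ z ∈ slitPlane N, f₁ z = val F₁ z) (hf : ∀ z ∈ slitPlane N, f z = val F z)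
    (hσ₁ : ∀ z ∈ slitPlane N, σ₁ z = Complex.exp z * val S₁ z)
    (hσ : ∀ z ∈ slitPlane N, σ z = Complex.exp z * val S z) (hz : z ∈ slitPlane N) :
    HasDerivAt σ (logDeriv (phi n) z * σ z + psi n z * (f₁ z - f z) - σ₁ z) z := by
  have hz' := nonRoot_of_mem hz
  have hF := h.reg_left z hz'
  have hF₁ := h₁.reg_left z hz'
  have hS := h.reg_right z hz'
  have hS₁ := h₁.reg_right z hz'
  have hw := regAt_wR hn hz'
  have hP := regAt_waveOne hn.le hz'
  refine (hasDerivAt_of_eqOn_slitPlane hσ hz (hasDerivAt_exp_mul_val hS)).congr_deriv ?_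
  rw [logDeriv_phi hn hz', hf z hz, hf₁ z hz, hσ z hz, hσ₁ z hz, psi_eq hn.le hz', hrel.right,
    val_sub ((hw.mul hS).add ((hF₁.sub hF).mul hP)) hS₁, val_add (hw.mul hS) ((hF₁.sub hF).mul hP),
    val_mul hw hS, val_mul (hF₁.sub hF) hP, val_sub hF₁ hF]
  ring

end Step

/-! ### Assembly of the backward chain -/

theorem deriv_eval_div {N : ℕ} (ξ : ℂ[X]) {z : ℂ} (hz : z ∈ slitPlane N) :
    deriv (fun z => ξ.eval z / (A N).eval z) z = val (toRat ξ / toRat (A N))′ z := by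
  have hr : RegAt z (toRat ξ / toRat (A N)) := ⟨_, _, nonRoot_of_mem hz N le_rfl, rfl⟩
  exact (hasDerivAt_of_eqOn_slitPlane
    (fun y hy => (val_div (nonRoot_of_mem hy N le_rfl)).symm) hz hr.hasDerivAt).deriv

theorem val_topS {N : ℕ} (ξ η : ℂ[X]) {z : ℂ} (hz : z ∈ slitPlane N) :
    val (topS N ξ η) z = -((B N).eval z * ξ.eval z) / (A N).eval z ^ 2
      + η.eval z / (A N).eval z := by
  have ha := nonRoot_of_mem hz N le_rfl
  have ha2 : (A N ^ 2).eval z ≠ 0 := by rw [eval_pow]; exact pow_ne_zero 2 ha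
  rw [topS, ← map_mul, ← map_neg, ← map_pow,
    val_add ⟨_, _, ha2, rfl⟩ ⟨_, _, ha, rfl⟩, val_div ha2, val_div ha, eval_neg, eval_mul, eval_pow]

/-- The backward chain consists of rational functions, and of such functions times `e^z`. -/
theorem backChain_eq {N : ℕ} {ξ η : ℂ[X]} {F S : ℕ → RatFunc ℂ}
    (hF : F 0 = (toRat ξ / toRat (A (N + 1)))′) (hS : S 0 = topS (N + 1) ξ η)
    (hadm : ∀ j ≤ N + 1, Admissible (N + 1) (N + 1 - j) (F j) (S j))
    (hrel : ∀ j ≤ N, DarbouxRel (N - j) (F (j + 1)) (S (j + 1)) (F j) (S j)) :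
    ∀ j ≤ N + 1, ∀ z ∈ slitPlane (N + 1),
      (backChain (N + 1) ξ η j).1 z = val (F j) z ∧
      (backChain (N + 1) ξ η j).2 z = Complex.exp z * val (S j) z := by
  intro j
  induction j with
  | zero =>
    intro _ z hz
    rw [hF, hS, val_topS ξ η hz]
    exact ⟨deriv_eval_div ξ hz, rfl⟩
  | succ j ih =>
    intro hj
    have ih := ih (by omega)
    have h₁ := hadm j (by omega)
    have h := hadm (j + 1) hj
    have hr := hrel j (by omega)
    rw [show N + 1 - j = N - j + 1 by omega] at h₁
    rw [show N + 1 - (j + 1) = N - j by omega] at h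
    simp only [backChain, show N + 1 - (j + 1) = N - j by omega]
    have hf := fun z hz => backF_eq (z := z) (by omega) h h₁ hr (fun z hz => (ih z hz).1) hz
    exact fun z hz => ⟨hf z hz, backSigma_eq (by omega) h h₁ hr (fun z hz => (ih z hz).1) hf
      (fun z hz => (ih z hz).2) hz⟩

/-- The top level is written `N + 1` so that its predecessor needs no truncated subtraction. Level
`n` is entry `N + 1 - n` of the rational chain. -/
theorem backward_darboux (N : ℕ) (hA : ∀ z : ℂ, ¬ ((A (N + 1)).IsRoot z ∧ (A N).IsRoot z))
    (ξ η : ℂ[X]) (hξ : ξ.degree < (((N + 1) * (N + 1 + 1) / 2 : ℕ) : WithBot ℕ))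
    (hη : η.degree < (((N + 1) * (N + 1 + 1) / 2 : ℕ) : WithBot ℕ))
    (hlin : LinearizedTkachenko (N + 1) ξ η) :
    (∀ n < N + 1, ∀ z ∈ slitPlane (N + 1),
      RayIntegrable (integrandF n (fLevel (N + 1) ξ η (n + 1))) z ∧
      RayIntegrable (integrandSigma n (fLevel (N + 1) ξ η (n + 1))
          (fLevel (N + 1) ξ η n) (sigmaLevel (N + 1) ξ η (n + 1))) z ∧
      HasDerivAt (fLevel (N + 1) ξ η n)
        (2 * logDeriv (phi n) z * fLevel (N + 1) ξ η n z - deriv (fLevel (N + 1) ξ η (n + 1)) z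
          - 2 * logDeriv (phi n) z * fLevel (N + 1) ξ η (n + 1) z) z ∧
      HasDerivAt (sigmaLevel (N + 1) ξ η n)
        (logDeriv (phi n) z * sigmaLevel (N + 1) ξ η n z
          + psi n z * (fLevel (N + 1) ξ η (n + 1) z - fLevel (N + 1) ξ η n z)
          - sigmaLevel (N + 1) ξ η (n + 1) z) z) ∧
    (∀ z ∈ slitPlane (N + 1),
      fLevel (N + 1) ξ η 0 z = 0 ∧ sigmaLevel (N + 1) ξ η 0 z = 0 ∧
      xiLevel (N + 1) ξ η 0 z = 0 ∧ etaLevel (N + 1) ξ η 0 z = 0) := by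
  rw [← natDegree_A, ← degree_eq_natDegree (A_ne_zero _)] at hξ hη
  obtain ⟨F, S, hF, hS, hadm, hrel⟩ := exists_darboux_chain hA hξ hη hlin
  have hval := backChain_eq hF hS hadm hrel
  have hf : ∀ n ≤ N + 1, ∀ z ∈ slitPlane (N + 1),
      fLevel (N + 1) ξ η n z = val (F (N + 1 - n)) z :=
    fun n _ z hz => (hval _ (by omega) z hz).1
  have hσ : ∀ n ≤ N + 1, ∀ z ∈ slitPlane (N + 1),
      sigmaLevel (N + 1) ξ η n z = Complex.exp z * val (S (N + 1 - n)) z :=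
    fun n _ z hz => (hval _ (by omega) z hz).2
  constructor
  · intro n hn z hz
    have h := hadm (N + 1 - n) (by omega)
    have h₁ := hadm (N - n) (by omega)
    have hr := hrel (N - n) (by omega)
    rw [show N + 1 - (N + 1 - n) = n by omega] at h
    rw [show N + 1 - (N - n) = n + 1 by omega] at h₁
    rw [show N - (N - n) = n by omega, show N - n + 1 = N + 1 - n by omega] at hr
    have hf₁ := hf (n + 1) hn
    have hσ₁ := hσ (n + 1) hn
    rw [show N + 1 - (n + 1) = N - n by omega] at hf₁ hσ₁
    exact ⟨rayIntegrable_integrandF hn h₁ hf₁ hz,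
      rayIntegrable_integrandSigma hn h h₁ hf₁ (hf n hn.le) hσ₁ hz,
      hasDerivAt_left hn h h₁ hr hf₁ (hf n hn.le) hz,
      hasDerivAt_right hn h h₁ hr hf₁ (hf n hn.le) hσ₁ (hσ n hn.le) hz⟩
  · have h := hadm (N + 1) le_rfl
    rw [Nat.sub_self] at h
    obtain ⟨hF0, hS0⟩ := h.eq_zero
    have hval0 : ∀ z, val 0 z = 0 := fun z => by rw [← map_zero toRat, val_toRat, eval_zero]
    have hf0 : ∀ z ∈ slitPlane (N + 1), fLevel (N + 1) ξ η 0 z = 0 := fun z hz => by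
      rw [hf 0 (Nat.zero_le _) z hz, Nat.sub_zero, hF0, hval0]
    intro z hz
    have hσ0 : sigmaLevel (N + 1) ξ η 0 z = 0 := by
      rw [hσ 0 (Nat.zero_le _) z hz, Nat.sub_zero, hS0, hval0, mul_zero]
    -- The half-line to the left of `z` stays in the slit domain, so `f_0` vanishes on the whole
    -- path of integration.
    have hξ0 : xiLevel (N + 1) ξ η 0 z = 0 := by
      rw [xiLevel, rayIntegral_congr (g := fun _ => 0)
        (fun t ht => hf0 _ (add_mem_slitPlane hz ht)), rayIntegral]
      simp
    exact ⟨hf0 z hz, hσ0, hξ0, by rw [etaLevel, hσ0, hξ0]; simp⟩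

end AdlerMoser

end

theorem proposition2 (N : ℕ) (hN : 1 ≤ N)
    (hA : ∀ z : ℂ, ¬ ((AdlerMoser.A N).IsRoot z ∧ (AdlerMoser.A (N - 1)).IsRoot z))
    (ξ η : Polynomial ℂ)
    (hξ : ξ.degree < ((N * (N + 1) / 2 : ℕ) : WithBot ℕ))
    (hη : η.degree < ((N * (N + 1) / 2 : ℕ) : WithBot ℕ))
    (hlin : AdlerMoser.LinearizedTkachenko N ξ η) :
    -- the recursion is well defined, and it solves the linearized Darboux system
    (∀ n < N, ∀ z ∈ AdlerMoser.slitPlane N,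
      AdlerMoser.RayIntegrable
        (AdlerMoser.integrandF n (AdlerMoser.fLevel N ξ η (n + 1))) z ∧
      AdlerMoser.RayIntegrable
        (AdlerMoser.integrandSigma n (AdlerMoser.fLevel N ξ η (n + 1))
          (AdlerMoser.fLevel N ξ η n) (AdlerMoser.sigmaLevel N ξ η (n + 1))) z ∧
      HasDerivAt (AdlerMoser.fLevel N ξ η n)
        (2 * logDeriv (AdlerMoser.phi n) z * AdlerMoser.fLevel N ξ η n z
          - deriv (AdlerMoser.fLevel N ξ η (n + 1)) z
          - 2 * logDeriv (AdlerMoser.phi n) z * AdlerMoser.fLevel N ξ η (n + 1) z) z ∧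
      HasDerivAt (AdlerMoser.sigmaLevel N ξ η n)
        (logDeriv (AdlerMoser.phi n) z * AdlerMoser.sigmaLevel N ξ η n z
          + AdlerMoser.psi n z *
            (AdlerMoser.fLevel N ξ η (n + 1) z - AdlerMoser.fLevel N ξ η n z)
          - AdlerMoser.sigmaLevel N ξ η (n + 1) z) z) ∧
    -- and at level zero everything vanishes
    (∀ z ∈ AdlerMoser.slitPlane N,
      AdlerMoser.fLevel N ξ η 0 z = 0 ∧ AdlerMoser.sigmaLevel N ξ η 0 z = 0 ∧
      AdlerMoser.xiLevel N ξ η 0 z = 0 ∧ AdlerMoser.etaLevel N ξ η 0 z = 0) := by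
  obtain ⟨M, rfl⟩ := Nat.exists_eq_succ_of_ne_zero (Nat.one_le_iff_ne_zero.1 hN)
  exact AdlerMoser.backward_darboux M hA ξ η hξ hη hlin
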